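/- **Lemma 3.1.** Conventions. All chains are time-homogeneous Markov chains in discrete time $t\ge 0$ on measurable state spaces. A chain with transition probability $P$ on $E$ is $\phi$-irreducible ($\phi$ a nontrivial measure) if for all $x$ and all $A$ with $\phi(A)>0$ we have $P^n(x,A)>0$ for some $n$; it is Harris recurrent if moreover each such $A$ is visited infinitely often $\mathbb P_x$-almost surely, for every $x\in E$. It is ergodic if there is an invariant probability measure $\pi$ with $\sup_A|P^n(x,A)-\pi(A)|\to 0$ for every $x\in E$. A measurable function $f\ge 0$ with $\phi(f>0)>0$ is small if $P^m\ge b\,f\otimes\kappa$ for some $m\ge 1$, $b>0$ and some nontrivial measure $\kappa$. A pair $(s,\nu)$, where $s\ge0$ is measurable with $\phi(s>0)>0$ and $\nu$ is a probability measure, is an atom for $P$ if $P\ge s\otimes\nu$, i.e. $P(x,A)\ge s(x)\nu(A)$ for all $x$, $A$. Then $0\le s\le 1$ and $P(x,\cdot)=(1-s(x))Q(x,\cdot)+s(x)\nu$ with a transition probability $Q$ (where $Q(x,\cdot)=\delta_x$ if $s(x)=1$); the split chain $\{(X_t,Y_t)\}$ on $E\times\{0,1\}$ moves by $X_{t+1}\sim\nu$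 if $Y_t=1$, $X_{t+1}\sim Q(X_t,\cdot)$ if $Y_t=0$, and then $Y_{t+1}=1$ with probability $s(X_{t+1})$, $Y_{t+1}=0$ otherwise. Let $S_\alpha=\min\{t\ge1: Y_t=1\}$ and let $\mathbb P_\alpha$ be the law of the split chain started at $(x,1)$, $x\in E$ arbitrary. A measurable, eventually positive function $L$ is slowly varying if $L(cu)/L(u)\to1$ as $u\to\infty$ for every $c>0$. For $\beta\in(0,1)$, the tail condition with exponent $\beta$ holds for $P$ and $(s,\nu)$ if for some slowly varying $L_s$ $$\mathbb P_\alpha(S_\alpha>n)=\frac{1}{\Gamma(1-\beta)\,n^{\beta}L_s(n)}\,(1+o(1)),\qquad n\to\infty .$$ A $\phi$-irreducible Harris recurrent chain is $\beta$-null recurrent if there are a small function $f$, an initial distribution $\lambda$ and a slowly varying function $L_f$ with $$\mathbb E_\lambda\sum_{t=0}^n f(X_t)\sim\frac{1}{\Gamma(1+\beta)}\,n^{\beta}L_f(n),\qquad n\to\infty .$$ Statement. Let $\{X_t\}$ and $\{W_t\}$ be independent Markov chains with transition probabilities $P_1$ and $P_2$ on $E_1$ and $E_2$ and arbitrary initial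 distributions. Let $\{X_t\}$ be $\phi_1$-irreducible and Harris recurrent with an atom $(s_1,\nu_1)$, and let $\{W_t\}$ be $\phi_2$-irreducible and ergodic with an atom $(s_2,\nu_2)$. Let $\beta\in(0,1)$ and assume that the tail condition with exponent $\beta$ holds for $P_1$ and $(s_1,\nu_1)$. Then the compound process $\{(X_t,W_t)\}$ is a Markov chain with transition probability $P=P_1\otimes P_2$, and for some nontrivial measure $\phi$ on $E_1\times E_2$ it is $\phi$-irreducible, Harris recurrent and $\beta$-null recurrent with the same $\beta$; moreover $(s_1\otimes s_2,\nu_1\otimes\nu_2)$ is an atom for $P$, and the tail condition with exponent $\beta$ holds for $P$ and this atom. -/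

import Mathlib

open MeasureTheory ProbabilityTheory Filter Topology
open scoped ENNReal NNReal

namespace NullRecurrent

noncomputable section

/-- `X` is a (time-homogeneous) Markov chain on the probability space `(Ω, μ)` with transition
probability `P`, with respect to its own history `σ(X_0, …, X_n)`; its initial law is arbitrary. -/
structure IsMarkovChain {Ω E : Type*} [MeasurableSpace Ω] [mE : MeasurableSpace E]
    (X : ℕ → Ω → E) (P : Kernel E E) (μ : Measure Ω) : Prop where
  measurable : ∀ t, Measurable (X t)
  markov : ∀ (n : ℕ) (A : Set E), MeasurableSet A →
    μ[(X (n + 1) ⁻¹' A).indicator (fun _ => (1 : ℝ)) | ⨆ j ≤ n, mE.comap (X j)]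
      =ᵐ[μ] fun ω => (P (X n ω)).real A

/-- The law on path space `ℕ → E` of the Markov chain with transition probability `P` and
initial distribution `lam`. -/
def chainLaw {E : Type*} [MeasurableSpace E] (P : Kernel E E) [IsMarkovKernel P]
    (lam : Measure E) : Measure (ℕ → E) :=
  Kernel.trajMeasure (X := fun _ => E) lam
    (fun n => P.comap (fun h : (Π _ : Finset.Iic n, E) => h ⟨n, Finset.mem_Iic.2 le_rfl⟩)
      (measurable_pi_apply _))

/-- A `ϕ`-irreducible, Harris recurrent chain (`ϕ` nontrivial): from every starting point, every
set of positive `ϕ`-measure is almost surely visited infinitely often. -/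
structure IsHarrisRecurrent {E : Type*} [MeasurableSpace E] (ϕ : Measure E)
    (P : Kernel E E) [IsMarkovKernel P] : Prop where
  ne_zero : ϕ ≠ 0
  irreducible : P.IsIrreducible ϕ
  recurrent : ∀ A : Set E, MeasurableSet A → 0 < ϕ A → ∀ x : E,
    ∀ᵐ ω ∂(chainLaw P (Measure.dirac x)), ∃ᶠ t in atTop, ω t ∈ A

/-- Ergodicity: there is an invariant probability measure to which the `n`-step transition
probabilities converge in total variation, from every starting point. -/
def IsErgodic {E : Type*} [MeasurableSpace E] (P : Kernel E E) : Prop :=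
  ∃ π : Measure E, IsProbabilityMeasure π ∧ P.Invariant π ∧
    ∀ x : E, ∀ ε : ℝ, 0 < ε → ∀ᶠ n : ℕ in atTop,
      ∀ A : Set E, MeasurableSet A → |((P ^ n) x).real A - π.real A| ≤ ε

/-- `f` is a small function: nonnegative and measurable with `ϕ`-positive support, and
`P ^ m ≥ b f ⊗ κ` for some `m ≥ 1`, `b > 0` and some nontrivial measure `κ`. (Such an `f` is
automatically bounded.) -/
def IsSmall {E : Type*} [MeasurableSpace E] (ϕ : Measure E) (P : Kernel E E)
    (f : E → ℝ≥0∞) : Prop :=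
  Measurable f ∧ 0 < ϕ (Function.support f) ∧
    ∃ (κ : Measure E) (b : ℝ≥0) (m : ℕ), κ ≠ 0 ∧ 0 < b ∧ 1 ≤ m ∧
      ∀ (x : E) (A : Set E), MeasurableSet A → b * f x * κ A ≤ (P ^ m) x A

/-- The minorization inequality `P ≥ s ⊗ ν`, with `ν` a probability measure. -/
structure Minorizes {E : Type*} [MeasurableSpace E] (P : Kernel E E)
    (s : E → ℝ≥0∞) (ν : Measure E) : Prop where
  measurable : Measurable s
  prob : IsProbabilityMeasure ν
  le : ∀ (x : E) (A : Set E), MeasurableSet A → s x * ν A ≤ P x A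

/-- `(s, ν)` is an atom for `P`: the minorization inequality holds and `s` has `ϕ`-positive
support. In particular `s` is a small function and `ν` a small measure, with `m = b = 1`. -/
structure IsAtom {E : Type*} [MeasurableSpace E] (ϕ : Measure E) (P : Kernel E E)
    (s : E → ℝ≥0∞) (ν : Measure E) : Prop extends Minorizes P s ν where
  pos : 0 < ϕ (Function.support s)

/-- `L` is slowly varying at infinity. -/
structure SlowlyVarying (L : ℝ → ℝ) : Prop where
  measurable : Measurable L
  pos : ∀ᶠ x in atTop, 0 < L x
  tendsto : ∀ c : ℝ, 0 < c → Tendsto (fun x => L (c * x) / L x) atTop (𝓝 1)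

/-- `β`-null recurrence of a `ϕ`-irreducible Harris recurrent chain: `0 < β < 1` and
`𝔼_lam ∑_{t ≤ n} f (X_t) ∼ n ^ β L(n) / Γ(1 + β)` for some small function `f`, some initial
distribution `lam` and some slowly varying function `L`. -/
def IsBetaNullRecurrent {E : Type*} [MeasurableSpace E] (ϕ : Measure E) (P : Kernel E E)
    [IsMarkovKernel P] (β : ℝ) : Prop :=
  IsHarrisRecurrent ϕ P ∧ 0 < β ∧ β < 1 ∧
    ∃ (f : E → ℝ≥0∞) (lam : Measure E) (L : ℝ → ℝ),
      IsSmall ϕ P f ∧ IsProbabilityMeasure lam ∧ SlowlyVarying L ∧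
      Asymptotics.IsEquivalent atTop
        (fun n : ℕ => (∫⁻ ω, ∑ t ∈ Finset.range (n + 1), f (ω t) ∂(chainLaw P lam)).toReal)
        (fun n : ℕ => 1 / Real.Gamma (1 + β) * (n : ℝ) ^ β * L n)

section Split

variable {E : Type*} [MeasurableSpace E] {P : Kernel E E} {s : E → ℝ≥0∞} {ν : Measure E}

lemma Minorizes.smul_le (h : Minorizes P s ν) (x : E) : s x • ν ≤ P x :=
  Measure.le_iff.2 fun A hA => by simpa using h.le x A hA

lemma Minorizes.le_one [IsMarkovKernel P] (h : Minorizes P s ν) (x : E) : s x ≤ 1 := by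
  have := h.prob
  simpa using h.le x Set.univ MeasurableSet.univ

/-- The residual transition probability `Q` in the decomposition
`P(x, ·) = (1 - s(x)) Q(x, ·) + s(x) ν`, with `Q(x, ·) = δ_x` where `s(x) = 1`. -/
def residual (P : Kernel E E) [IsMarkovKernel P] (s : E → ℝ≥0∞) (ν : Measure E)
    (h : Minorizes P s ν) : Kernel E E where
  toFun x := by
    classical
    exact if s x < 1 then (1 - s x)⁻¹ • (P x - s x • ν) else Measure.dirac x
  measurable' := by
    classical
    have := h.prob
    refine Measurable.ite (measurableSet_lt h.measurable measurable_const) ?_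
      Measure.measurable_dirac
    refine Measure.measurable_of_measurable_coe _ fun A hA => ?_
    have hfin : ∀ x, IsFiniteMeasure (s x • ν) := fun x =>
      ⟨by simpa using (h.le_one x).trans_lt ENNReal.one_lt_top⟩
    have heq : (fun x => ((1 - s x)⁻¹ • (P x - s x • ν)) A)
        = fun x => (1 - s x)⁻¹ * (P x A - s x * ν A) := by
      funext x
      have := hfin x
      simp [Measure.sub_apply hA (h.smul_le x)]
    rw [heq]
    exact ((measurable_const.sub h.measurable).inv).mul
      ((Kernel.measurable_coe P hA).sub (h.measurable.mul_const _))

instance (P : Kernel E E) [IsMarkovKernel P] (s : E → ℝ≥0∞) (ν : Measure E)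
    (h : Minorizes P s ν) : IsMarkovKernel (residual P s ν h) := by
  have := h.prob
  refine ⟨fun x => ⟨?_⟩⟩
  change (if s x < 1 then (1 - s x)⁻¹ • (P x - s x • ν) else Measure.dirac x) Set.univ = 1
  split_ifs with hs
  · have : IsFiniteMeasure (s x • ν) :=
      ⟨by simpa using hs.trans ENNReal.one_lt_top⟩
    have h0 : 1 - s x ≠ 0 := (tsub_pos_of_lt hs).ne'
    have h1 : 1 - s x ≠ ∞ := (lt_of_le_of_lt tsub_le_self ENNReal.one_lt_top).ne
    simp [Measure.sub_apply MeasurableSet.univ (h.smul_le x), ENNReal.inv_mul_cancel h0 h1]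
  · simp

/-- The `E`-component moves according to `ν` from `(x, 1)` and according to `Q(x, ·)`
from `(x, 0)`. -/
def splitMove (P : Kernel E E) [IsMarkovKernel P] (s : E → ℝ≥0∞) (ν : Measure E)
    (h : Minorizes P s ν) : Kernel (E × Bool) E where
  toFun z := if z.2 = true then ν else residual P s ν h z.1
  measurable' := by
    refine Measurable.ite ?_ measurable_const
      ((residual P s ν h).measurable.comp measurable_fst)
    exact measurable_snd (measurableSet_singleton true)

instance (P : Kernel E E) [IsMarkovKernel P] (s : E → ℝ≥0∞) (ν : Measure E)
    (h : Minorizes P s ν) : IsMarkovKernel (splitMove P s ν h) := by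
  have := h.prob
  refine ⟨fun z => ?_⟩
  change IsProbabilityMeasure (if z.2 = true then ν else residual P s ν h z.1)
  split_ifs <;> infer_instance

/-- Given `X_t = x`, the mark `Y_t` is `1` with probability `s(x)` and `0` otherwise. -/
def splitMark (P : Kernel E E) (s : E → ℝ≥0∞) (ν : Measure E)
    (h : Minorizes P s ν) : Kernel E (E × Bool) where
  toFun x := s x • Measure.dirac (x, true) + (1 - s x) • Measure.dirac (x, false)
  measurable' := by
    refine Measure.measurable_of_measurable_coe _ fun A hA => ?_
    have hd : ∀ b : Bool, Measurable fun x : E => Measure.dirac (x, b) A := fun b =>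
      (Measure.measurable_coe hA).comp
        (Measure.measurable_dirac.comp (measurable_id.prodMk measurable_const))
    have heq : (fun x => (s x • Measure.dirac (x, true) + (1 - s x) • Measure.dirac (x, false)) A)
        = fun x => s x * Measure.dirac (x, true) A + (1 - s x) * Measure.dirac (x, false) A := by
      funext x
      simp
    rw [heq]
    exact (h.measurable.mul (hd true)).add
      ((measurable_const.sub h.measurable).mul (hd false))

instance (P : Kernel E E) [IsMarkovKernel P] (s : E → ℝ≥0∞) (ν : Measure E)
    (h : Minorizes P s ν) : IsMarkovKernel (splitMark P s ν h) := by
  refine ⟨fun x => ⟨?_⟩⟩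
  change (s x • Measure.dirac (x, true) + (1 - s x) • Measure.dirac (x, false)) Set.univ = 1
  simp [add_tsub_cancel_of_le (h.le_one x)]

/-- Transition probability of the split chain `(X_t, Y_t)` on `E × {0, 1}`. -/
def splitKernel (P : Kernel E E) [IsMarkovKernel P] (s : E → ℝ≥0∞) (ν : Measure E)
    (h : Minorizes P s ν) : Kernel (E × Bool) (E × Bool) :=
  Kernel.comp (splitMark P s ν h) (splitMove P s ν h)

instance (P : Kernel E E) [IsMarkovKernel P] (s : E → ℝ≥0∞) (ν : Measure E)
    (h : Minorizes P s ν) : IsMarkovKernel (splitKernel P s ν h) := by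
  unfold splitKernel
  infer_instance

/-- The recurrence time `S_α = min {t ≥ 1 : Y_t = 1}` of the atom `α = E × {1}` (it is `⊤` if the
path of the split chain never returns to `α`). -/
def recurrenceTime (ω : ℕ → E × Bool) : ℕ∞ :=
  ⨅ t ∈ {t : ℕ | 1 ≤ t ∧ (ω t).2 = true}, (t : ℕ∞)

/-- The tail condition: `0 < β < 1` and, for a slowly varying function `L`,
`ℙ_α(S_α > n) ∼ 1 / (Γ(1 - β) n ^ β L(n))`, where `ℙ_α` is the law of the split chain started at
`(x, 1)`, `x` arbitrary. -/
def TailCondition (P : Kernel E E) [IsMarkovKernel P] (s : E → ℝ≥0∞) (ν : Measure E)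
    (h : Minorizes P s ν) (β : ℝ) : Prop :=
  0 < β ∧ β < 1 ∧ ∃ L : ℝ → ℝ, SlowlyVarying L ∧ ∀ x : E,
    Asymptotics.IsEquivalent atTop
      (fun n : ℕ => (chainLaw (splitKernel P s ν h) (Measure.dirac (x, true))).real
        {ω | (n : ℕ∞) < recurrenceTime ω})
      (fun n : ℕ => 1 / (Real.Gamma (1 - β) * (n : ℝ) ^ β * L n))

end Split

/-- `s₁ ⊗ s₂`, the first component of the product atom. -/
def prodFun {E₁ E₂ : Type*} (s₁ : E₁ → ℝ≥0∞) (s₂ : E₂ → ℝ≥0∞) (z : E₁ × E₂) : ℝ≥0∞ :=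
  s₁ z.1 * s₂ z.2

end

end NullRecurrent

namespace NullRecurrent
noncomputable section

/-! The argument is a comparison of renewal sequences. For a minorizing pair `(s, ν)` put u 0 = 1
and u (n+1) = ∫ P^n s dν (`renewalSeq`), and let a n be the probability that the split chain started
in the atom is unmarked at the times 1, …, n (`tailSeq`). A last exit decomposition gives ∑_{k ≤ n}
u k * a (n-k) = 1, that is U(r) A(r) (1-r) = 1 for the generating functions. Two independent chains
return to the product atom exactly when both return, so u' = u * v with v the renewal sequence of
the second atom (`atomReturn_prod`). Ergodicity gives v n → c = ∫ s₂ dπ, and irreducibility makes c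
positive (`exists_tendsto_atomReturn`).

The tail condition makes a regularly varying of index -β. The Abelian theorem
`tendsto_genFun_mul_div` turns this into the behaviour of A, hence of U, which diverges at 1.
Therefore U' ~ c U and A' ~ A / c. Karamata's theorem `tendsto_partialSum_div_genFun` then yields
the partial sums of u', and its monotone density form `tendsto_coeff_div_genFun` yields a' ~ a / c.
Both conclusions hold with the slowly varying function c L (`renewal_comparison`).

For Harris recurrence, the probability of visiting a set infinitely often is a bounded harmonic
function of the product chain. Total variation convergence of the second chain removes the
dependence on the second coordinate, and Harris recurrence of the first chain removes the rest
(`exists_const_chainLaw_parallelComp`). By Lévy's zero-one law the constant is 0 or 1, and the value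
0 is excluded for sets reachable from the atom because ∑ u' diverges
(`exists_chainLaw_ioSet_ne_zero`). -/

/-! ### Karamata's Tauberian theorem and the monotone density theorem -/

/-- The method of moments on a compact interval: the weights `w n` placed at the points `y n j` are
probability measures on [0, 1], convergence of moments is convergence on polynomials, and
Weierstrass approximation extends it to continuous functions with an error that total mass one keeps
uniform in `n`. -/
lemma tendsto_tsum_of_tendsto_moments {w y : ℕ → ℕ → ℝ}
    (hw : ∀ᶠ n in atTop, (∀ j, 0 ≤ w n j) ∧ HasSum (w n) 1)
    (hy : ∀ᶠ n in atTop, ∀ j, y n j ∈ Set.Icc (0 : ℝ) 1)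
    {σ : Measure ℝ} [IsProbabilityMeasure σ] {z : ℝ → ℝ} (hz : Measurable z)
    (hz1 : ∀ᵐ t ∂σ, z t ∈ Set.Icc (0 : ℝ) 1)
    (hmom : ∀ k : ℕ, Tendsto (fun n => ∑' j, w n j * y n j ^ k) atTop (𝓝 (∫ t, z t ^ k ∂σ)))
    {g : ℝ → ℝ} (hg : Continuous g) :
    Tendsto (fun n => ∑' j, w n j * g (y n j)) atTop (𝓝 (∫ t, g (z t) ∂σ)) := by
  have bdd : ∀ {f : ℝ → ℝ}, Continuous f → ∃ C, ∀ x ∈ Set.Icc (0 : ℝ) 1, ‖f x‖ ≤ C := fun hf =>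
    isCompact_Icc.exists_bound_of_continuousOn hf.continuousOn
  have hsum : ∀ {f : ℝ → ℝ}, Continuous f →
      ∀ᶠ n in atTop, Summable fun j => w n j * f (y n j) := by
    intro f hf
    obtain ⟨C, hC⟩ := bdd hf
    filter_upwards [hw, hy] with n hn hyn
    refine Summable.of_norm_bounded (g := fun j => w n j * C) (hn.2.summable.mul_right C)
      fun j => ?_
    rw [norm_mul, Real.norm_of_nonneg (hn.1 j)]
    exact mul_le_mul_of_nonneg_left (hC _ (hyn j)) (hn.1 j)
  have hint : ∀ {f : ℝ → ℝ}, Continuous f → Integrable (fun t => f (z t)) σ := by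
    intro f hf
    obtain ⟨C, hC⟩ := bdd hf
    refine Integrable.of_bound (hf.measurable.comp hz).aestronglyMeasurable C ?_
    filter_upwards [hz1] with t ht using hC _ ht
  have hpoly : ∀ p : Polynomial ℝ,
      Tendsto (fun n => ∑' j, w n j * p.eval (y n j)) atTop (𝓝 (∫ t, p.eval (z t) ∂σ)) := by
    intro p
    induction p using Polynomial.induction_on' with
    | add p q hp hq =>
      have h := hp.add hq
      simp only [Polynomial.eval_add]
      rw [integral_add (hint p.continuous) (hint q.continuous)]
      refine h.congr' ?_
      filter_upwards [hsum p.continuous, hsum q.continuous] with n h1 h2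
      rw [← h1.tsum_add h2]
      simp only [mul_add]
    | monomial k c =>
      have h := (hmom k).const_mul c
      simp only [Polynomial.eval_monomial]
      rw [integral_const_mul]
      refine h.congr fun n => ?_
      rw [← tsum_mul_left]
      exact tsum_congr fun j => by ring
  rw [Metric.tendsto_atTop']
  intro ε hε
  obtain ⟨p, hp⟩ := exists_polynomial_near_of_continuousOn 0 1 g hg.continuousOn (ε / 3)
    (by positivity)
  have h1 : ∀ᶠ n in atTop, |∑' j, w n j * g (y n j) - ∑' j, w n j * p.eval (y n j)| ≤ ε / 3 := by
    filter_upwards [hw, hy, hsum hg, hsum p.continuous] with n hn hyn hs1 hs2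
    rw [← hs1.tsum_sub hs2, ← Real.norm_eq_abs]
    refine tsum_of_norm_bounded (g := fun j => w n j * (ε / 3))
      (by simpa using hn.2.mul_right (ε / 3)) fun j => ?_
    rw [← mul_sub, norm_mul, Real.norm_of_nonneg (hn.1 j), norm_sub_rev]
    exact mul_le_mul_of_nonneg_left (hp _ (hyn j)).le (hn.1 j)
  have h2 : |∫ t, p.eval (z t) ∂σ - ∫ t, g (z t) ∂σ| ≤ ε / 3 := by
    rw [← integral_sub (hint p.continuous) (hint hg), ← Real.norm_eq_abs]
    refine (norm_integral_le_of_norm_le_const (C := ε / 3) ?_).trans (by simp)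
    filter_upwards [hz1] with t ht using (hp _ ht).le
  have h3 := (Metric.tendsto_atTop'.1 (hpoly p)) (ε / 3) (by positivity)
  obtain ⟨N, hN⟩ := h3
  obtain ⟨N1, hN1⟩ := eventually_atTop.1 h1
  refine ⟨max N N1, fun n hn => ?_⟩
  have e1 := hN n (lt_of_le_of_lt (le_max_left _ _) hn)
  have e2 := hN1 n (le_of_lt (lt_of_le_of_lt (le_max_right _ _) hn))
  rw [Real.dist_eq] at *
  rw [abs_le] at e2 h2
  rw [abs_lt] at *
  constructor <;> linarith [e1.1, e1.2, e2.1, e2.2, h2.1, h2.2]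

lemma integral_gammaMeasure {ρ : ℝ} (hρ : 0 < ρ) (f : ℝ → ℝ) :
    ∫ t, f t ∂(gammaMeasure ρ 1)
      = (∫ t in Set.Ioi (0 : ℝ), t ^ (ρ - 1) * Real.exp (-t) * f t) / Real.Gamma ρ := by
  unfold gammaMeasure
  rw [integral_withDensity_eq_integral_toReal_smul]
  · rw [div_eq_inv_mul, ← integral_const_mul, ← integral_indicator measurableSet_Ioi]
    have h0 : ∀ᵐ t : ℝ, t ≠ 0 := by simp [ae_iff]
    refine integral_congr_ae ?_
    filter_upwards [h0] with t ht
    rcases lt_or_gt_of_ne ht with h | h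
    · have : t ∉ Set.Ioi (0 : ℝ) := by simp [h.le]
      simp [gammaPDF_of_neg h, this]
    · have : t ∈ Set.Ioi (0 : ℝ) := h
      rw [gammaPDF_of_nonneg h.le, ENNReal.toReal_ofReal, Set.indicator_of_mem this]
      · simp only [Real.one_rpow, one_mul, smul_eq_mul]; ring
      · have := Real.Gamma_pos_of_pos hρ
        positivity
  · exact (measurable_gammaPDFReal ρ 1).ennreal_ofReal
  · exact ae_of_all _ fun t => by simp [gammaPDF]

/-- These moments are what singles out the Gamma law: (k+1)^(-ρ) is the limit of U(r^(k+1)) / U(r)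
when U is regularly varying of index ρ at 1. -/
lemma integral_exp_neg_pow_gammaMeasure {ρ : ℝ} (hρ : 0 < ρ) (k : ℕ) :
    ∫ t, Real.exp (-t) ^ k ∂(gammaMeasure ρ 1) = ((k : ℝ) + 1) ^ (-ρ) := by
  rw [integral_gammaMeasure hρ]
  have : ∀ t : ℝ, t ^ (ρ - 1) * Real.exp (-t) * Real.exp (-t) ^ k
      = t ^ (ρ - 1) * Real.exp (-(((k : ℝ) + 1) * t)) := by
    intro t
    rw [mul_assoc, ← Real.exp_nat_mul, ← Real.exp_add]
    ring_nf
  simp only [this]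
  rw [Real.integral_rpow_mul_exp_neg_mul_Ioi hρ (by positivity),
    mul_div_assoc, div_self (Real.Gamma_pos_of_pos hρ).ne', mul_one, one_div,
    Real.inv_rpow (by positivity), Real.rpow_neg (by positivity)]

/-- In the variable y = exp (-t) the integrand is y⁻¹ on y ≥ exp (-x). This is the test function
that cancels the Abel weights and leaves plain partial sums, so the value is the Tauberian limit. -/
lemma integral_indicator_exp_gammaMeasure {ρ : ℝ} (hρ : 0 < ρ) {x : ℝ} (hx : 0 ≤ x) :
    ∫ t, (Set.Iic x).indicator (fun t => Real.exp t) t ∂(gammaMeasure ρ 1)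
      = x ^ ρ / Real.Gamma (1 + ρ) := by
  rw [integral_gammaMeasure hρ]
  have : ∀ t : ℝ, t ^ (ρ - 1) * Real.exp (-t) * (Set.Iic x).indicator (fun t => Real.exp t) t
      = (Set.Iic x).indicator (fun t => t ^ (ρ - 1)) t := by
    intro t
    by_cases h : t ∈ Set.Iic x
    · simp only [Set.indicator_of_mem h]
      rw [mul_assoc, ← Real.exp_add]; simp
    · simp [h]
  simp only [this]
  rw [integral_indicator measurableSet_Iic, Measure.restrict_restrict measurableSet_Iic,
    Set.inter_comm, Set.Ioi_inter_Iic, ← intervalIntegral.integral_of_le hx,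
    integral_rpow (Or.inl (by linarith)), add_comm 1 ρ, Real.Gamma_add_one hρ.ne']
  simp only [sub_add_cancel, Real.zero_rpow hρ.ne', sub_zero]
  rw [div_div]

/-- The generating function of a real sequence. -/
def genFun (a : ℕ → ℝ) (r : ℝ) : ℝ := ∑' j, a j * r ^ j

/-- The points `exp (-1 / n)`, which increase to `1`. -/
def expInv (n : ℕ) : ℝ := Real.exp (-(1 / (n : ℝ)))

lemma expInv_pos (n : ℕ) : 0 < expInv n := Real.exp_pos _

lemma expInv_lt_one {n : ℕ} (hn : 1 ≤ n) : expInv n < 1 := by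
  have : (0 : ℝ) < n := by exact_mod_cast hn
  rw [expInv, ← Real.exp_zero]
  exact Real.exp_lt_exp.2 (by simp [this])

lemma expInv_pow (n j : ℕ) : expInv n ^ j = Real.exp (-((j : ℝ) / n)) := by
  rw [expInv, ← Real.exp_nat_mul]; ring_nf

lemma exp_neg_le_expInv_pow {n j : ℕ} (hn : 1 ≤ n) {x : ℝ} :
    Real.exp (-x) ≤ expInv n ^ j ↔ (j : ℝ) ≤ x * n := by
  have : (0 : ℝ) < n := by exact_mod_cast hn
  rw [expInv_pow, Real.exp_le_exp, neg_le_neg_iff, div_le_iff₀ this]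

lemma summable_genFun {a : ℕ → ℝ} (ha : ∀ n, a n ∈ Set.Icc (0 : ℝ) 1) {r : ℝ} (h0 : 0 ≤ r)
    (h1 : r < 1) : Summable fun j => a j * r ^ j := by
  refine Summable.of_nonneg_of_le (fun j => mul_nonneg (ha j).1 (pow_nonneg h0 j)) (fun j => ?_)
    (summable_geometric_of_lt_one h0 h1)
  exact mul_le_of_le_one_left (pow_nonneg h0 j) (ha j).2

lemma genFun_pos {a : ℕ → ℝ} (ha : ∀ n, a n ∈ Set.Icc (0 : ℝ) 1) (ha0 : 0 < a 0) {r : ℝ}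
    (h0 : 0 ≤ r) (h1 : r < 1) : 0 < genFun a r :=
  (summable_genFun ha h0 h1).tsum_pos (fun j => mul_nonneg (ha j).1 (pow_nonneg h0 j)) 0
    (by simpa using ha0)

/-- A continuous function between `y ↦ y⁻¹ 1_{y ≥ d}` and `y ↦ y⁻¹ 1_{y ≥ c}`. -/
def tent (c d y : ℝ) : ℝ := min 1 (max 0 ((y - c) / (d - c))) / max y c

lemma continuous_tent {c : ℝ} (hc : 0 < c) (d : ℝ) : Continuous (tent c d) := by
  refine Continuous.div (by fun_prop) (by fun_prop) fun y => ?_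
  exact (lt_max_of_lt_right hc).ne'

lemma tent_nonneg {c : ℝ} (hc : 0 < c) (d y : ℝ) : 0 ≤ tent c d y :=
  div_nonneg (le_min zero_le_one (le_max_left _ _)) (lt_max_of_lt_right hc).le

lemma tent_of_le {c d y : ℝ} (hcd : c < d) (hy : y ≤ c) : tent c d y = 0 := by
  have : (y - c) / (d - c) ≤ 0 := div_nonpos_of_nonpos_of_nonneg (by linarith) (by linarith)
  simp [tent, max_eq_left this]

lemma tent_le_inv {c d y : ℝ} (hc : 0 < c) (hy : c ≤ y) : tent c d y ≤ y⁻¹ := by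
  rw [tent, max_eq_left hy, inv_eq_one_div]
  exact div_le_div_of_nonneg_right (min_le_left _ _) (hc.le.trans hy)

lemma tent_eq_inv {c d y : ℝ} (hcd : c < d) (hy : d ≤ y) : tent c d y = y⁻¹ := by
  have h : 1 ≤ (y - c) / (d - c) := by rw [le_div_iff₀ (by linarith)]; linarith
  rw [tent, max_eq_left (hcd.le.trans hy), min_eq_left (h.trans (le_max_right _ _)), one_div]

/-- Karamata's Tauberian theorem, for power series along the points `exp (-1 / n)`. -/
theorem tendsto_partialSum_div_genFun {u : ℕ → ℝ} (hu : ∀ n, u n ∈ Set.Icc (0 : ℝ) 1)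
    (hu0 : 0 < u 0) {ρ : ℝ} (hρ : 0 < ρ)
    (hrv : ∀ k : ℕ, 1 ≤ k → Tendsto (fun n => genFun u (expInv n ^ k) / genFun u (expInv n))
      atTop (𝓝 ((k : ℝ) ^ (-ρ)))) {x : ℝ} (hx : 0 < x) :
    Tendsto (fun n : ℕ => (∑ j ∈ Finset.range (⌊x * n⌋₊ + 1), u j) / genFun u (expInv n)) atTop
      (𝓝 (x ^ ρ / Real.Gamma (1 + ρ))) := by
  -- With r = exp (-1/n), the masses u j r^j / U(r) sit at the points r^j. Their k-th moment is
  -- U(r^(k+1)) / U(r). The index n = 0 is excluded below because `expInv 0` equals 1.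
  set w : ℕ → ℕ → ℝ := fun n j => u j * expInv n ^ j / genFun u (expInv n) with hwdef
  have hG : ∀ {n : ℕ}, 1 ≤ n → 0 < genFun u (expInv n) := fun hn =>
    genFun_pos hu hu0 (expInv_pos _).le (expInv_lt_one hn)
  have hw : ∀ᶠ n in atTop, (∀ j, 0 ≤ w n j) ∧ HasSum (w n) 1 := by
    filter_upwards [eventually_ge_atTop 1] with n hn
    refine ⟨fun j => div_nonneg (mul_nonneg (hu j).1 (pow_nonneg (expInv_pos _).le _)) (hG hn).le,
      ?_⟩
    have := (summable_genFun hu (expInv_pos n).le (expInv_lt_one hn)).hasSum.div_const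
      (genFun u (expInv n))
    rwa [← genFun, div_self (hG hn).ne'] at this
  have hy : ∀ᶠ n : ℕ in atTop, ∀ j, expInv n ^ j ∈ Set.Icc (0 : ℝ) 1 := by
    filter_upwards [eventually_ge_atTop 1] with n hn j
    exact ⟨pow_nonneg (expInv_pos _).le _, pow_le_one₀ (expInv_pos _).le (expInv_lt_one hn).le⟩
  have := isProbabilityMeasure_gammaMeasure hρ one_pos
  have hpos : ∀ᵐ t ∂(gammaMeasure ρ 1), (0 : ℝ) ≤ t := by
    unfold gammaMeasure
    rw [ae_withDensity_iff (f := gammaPDF ρ 1) (measurable_gammaPDFReal ρ 1).ennreal_ofReal]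
    refine ae_of_all _ fun t ht => ?_
    by_contra h
    exact ht (gammaPDF_of_neg (not_le.1 h))
  have hz1 : ∀ᵐ t ∂(gammaMeasure ρ 1), Real.exp (-t) ∈ Set.Icc (0 : ℝ) 1 := by
    filter_upwards [hpos] with t ht
    exact ⟨(Real.exp_pos _).le, Real.exp_le_one_iff.2 (by linarith)⟩
  have hmom : ∀ k : ℕ, Tendsto (fun n => ∑' j, w n j * (expInv n ^ j) ^ k) atTop
      (𝓝 (∫ t, Real.exp (-t) ^ k ∂(gammaMeasure ρ 1))) := by
    intro k
    rw [integral_exp_neg_pow_gammaMeasure hρ]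
    have := hrv (k + 1) (by omega)
    push_cast at this
    refine this.congr fun n => ?_
    rw [genFun, ← tsum_div_const]
    refine tsum_congr fun j => ?_
    simp only [hwdef]
    rw [← pow_mul]
    ring
  -- The test function jumps at y = exp (-x), so it is replaced by a continuous one lying between
  -- the cut-offs for x₁ and x₂. The partial sums then interlace with a sequence whose limit is
  -- known.
  have key : ∀ {x₁ x₂ : ℝ}, 0 < x₁ → x₁ < x₂ → ∃ I : ℝ,
      x₁ ^ ρ / Real.Gamma (1 + ρ) ≤ I ∧ I ≤ x₂ ^ ρ / Real.Gamma (1 + ρ) ∧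
      ∃ Λ : ℕ → ℝ, Tendsto Λ atTop (𝓝 I) ∧ ∀ᶠ n : ℕ in atTop,
        (∑ j ∈ Finset.range (⌊x₁ * n⌋₊ + 1), u j) / genFun u (expInv n) ≤ Λ n ∧
        Λ n ≤ (∑ j ∈ Finset.range (⌊x₂ * n⌋₊ + 1), u j) / genFun u (expInv n) := by
    intro x₁ x₂ h1 h12
    have hc : 0 < Real.exp (-x₂) := Real.exp_pos _
    have hcd : Real.exp (-x₂) < Real.exp (-x₁) := Real.exp_lt_exp.2 (by linarith)
    set g := tent (Real.exp (-x₂)) (Real.exp (-x₁)) with hg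
    have hgc : Continuous g := continuous_tent hc _
    have hgint : Integrable (fun t => g (Real.exp (-t))) (gammaMeasure ρ 1) := by
      obtain ⟨C, hC⟩ := isCompact_Icc.exists_bound_of_continuousOn
        (hgc.continuousOn (s := Set.Icc (0 : ℝ) 1))
      refine Integrable.of_bound
        (hgc.measurable.comp (by fun_prop)).aestronglyMeasurable C ?_
      filter_upwards [hz1] with t ht using hC _ ht
    have hind : ∀ y : ℝ, Integrable ((Set.Iic y).indicator (fun t => Real.exp t))
        (gammaMeasure ρ 1) := by
      intro y
      refine Integrable.of_bound
        (Real.measurable_exp.indicator measurableSet_Iic).aestronglyMeasurable (Real.exp y)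
        (ae_of_all _ fun t => ?_)
      by_cases h : t ∈ Set.Iic y
      · simpa [Set.indicator_of_mem h] using h
      · simp [h, (Real.exp_pos _).le]
    refine ⟨∫ t, g (Real.exp (-t)) ∂(gammaMeasure ρ 1), ?_, ?_, _,
      tendsto_tsum_of_tendsto_moments hw hy (by fun_prop) hz1 hmom hgc, ?_⟩
    · rw [← integral_indicator_exp_gammaMeasure hρ h1.le]
      refine integral_mono (hind _) hgint fun t => ?_
      by_cases h : t ∈ Set.Iic x₁
      · simp only [Set.indicator_of_mem h]
        rw [hg, tent_eq_inv hcd (Real.exp_le_exp.2 (by simpa using h)), Real.exp_neg, inv_inv]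
      · simpa [h] using tent_nonneg hc _ _
    · rw [← integral_indicator_exp_gammaMeasure hρ (h1.trans h12).le]
      refine integral_mono hgint (hind _) fun t => ?_
      by_cases h : t ∈ Set.Iic x₂
      · simp only [Set.indicator_of_mem h]
        refine (tent_le_inv hc (Real.exp_le_exp.2 (by simpa using h))).trans ?_
        rw [Real.exp_neg, inv_inv]
      · simp only [h, not_false_eq_true, Set.indicator_of_notMem]
        exact (tent_of_le hcd (Real.exp_le_exp.2 (by simpa using (not_le.1 h).le))).le
    · filter_upwards [eventually_ge_atTop 1, hw] with n hn hwn
      have hn' : (0 : ℝ) < n := by exact_mod_cast hn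
      have hmem : ∀ {x : ℝ} {j : ℕ}, 0 ≤ x → (j ∈ Finset.range (⌊x * n⌋₊ + 1) ↔
          Real.exp (-x) ≤ expInv n ^ j) := by
        intro x j hx
        rw [Finset.mem_range, Nat.lt_succ_iff, Nat.le_floor_iff (by positivity),
          exp_neg_le_expInv_pow hn]
      have hzero : ∀ j ∉ Finset.range (⌊x₂ * n⌋₊ + 1), w n j * g (expInv n ^ j) = 0 := by
        intro j hj
        rw [hmem (h1.trans h12).le, not_le] at hj
        rw [hg, tent_of_le hcd hj.le, mul_zero]
      have hpowpos : ∀ j, 0 < expInv n ^ j := fun j => pow_pos (expInv_pos _) _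
      -- Dividing by the position y = r^j removes the Abel factor.
      have hterm : ∀ j, w n j * (expInv n ^ j)⁻¹ = u j / genFun u (expInv n) := by
        intro j
        simp only [hwdef]
        field_simp [(hpowpos j).ne']
      rw [tsum_eq_sum hzero, Finset.sum_div, Finset.sum_div]
      constructor
      · have hsub : Finset.range (⌊x₁ * n⌋₊ + 1) ⊆ Finset.range (⌊x₂ * n⌋₊ + 1) := by
          apply Finset.range_subset_range.2
          gcongr
        refine le_trans (Finset.sum_le_sum fun j hj => ?_)
          (Finset.sum_le_sum_of_subset_of_nonneg hsub fun j _ _ =>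
            mul_nonneg (hwn.1 j) (tent_nonneg hc _ _))
        rw [hg, tent_eq_inv hcd ((hmem h1.le).1 hj), hterm]
      · refine Finset.sum_le_sum fun j hj => ?_
        rw [← hterm]
        exact mul_le_mul_of_nonneg_left (tent_le_inv hc ((hmem (h1.trans h12).le).1 hj)) (hwn.1 j)
  have hcont : ContinuousAt (fun y : ℝ => y ^ ρ / Real.Gamma (1 + ρ)) x :=
    (Real.continuousAt_rpow_const x ρ (Or.inl hx.ne')).div_const _
  -- By continuity of x ↦ x^ρ the gap in `key` can be closed: the lower bound uses a pair y < x, the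
  -- upper bound a pair x < y.
  rw [tendsto_order]
  constructor
  · intro b hb
    have h1 : ∀ᶠ y in 𝓝[<] x, b < y ^ ρ / Real.Gamma (1 + ρ) :=
      (hcont.eventually (lt_mem_nhds hb)).filter_mono nhdsWithin_le_nhds
    have h2 : ∀ᶠ y in 𝓝[<] x, 0 < y := (lt_mem_nhds hx).filter_mono nhdsWithin_le_nhds
    obtain ⟨y, ⟨hyb, hy0⟩, hyx⟩ := ((h1.and h2).and self_mem_nhdsWithin).exists
    obtain ⟨I, hI1, -, Λ, hΛ, hb'⟩ := key hy0 hyx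
    filter_upwards [hb', hΛ.eventually (lt_mem_nhds (hyb.trans_le hI1))] with n h3 h4
    exact h4.trans_le h3.2
  · intro b hb
    have h1 : ∀ᶠ y in 𝓝[>] x, y ^ ρ / Real.Gamma (1 + ρ) < b :=
      (hcont.eventually (gt_mem_nhds hb)).filter_mono nhdsWithin_le_nhds
    obtain ⟨y, hyb, hyx⟩ := (h1.and self_mem_nhdsWithin).exists
    obtain ⟨I, -, hI1, Λ, hΛ, hb'⟩ := key hx hyx
    filter_upwards [hb', hΛ.eventually (gt_mem_nhds (hI1.trans_lt hyb))] with n h3 h4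
    exact h3.1.trans_lt h4

/-- The monotone density theorem: for nonincreasing coefficients Karamata's Tauberian theorem
gives the asymptotics of the coefficients themselves. -/
theorem tendsto_coeff_div_genFun {a : ℕ → ℝ} (ha : ∀ n, a n ∈ Set.Icc (0 : ℝ) 1)
    (ha0 : 0 < a 0) (hanti : Antitone a) {ρ : ℝ} (hρ : 0 < ρ)
    (hrv : ∀ k : ℕ, 1 ≤ k → Tendsto (fun n => genFun a (expInv n ^ k) / genFun a (expInv n))
      atTop (𝓝 ((k : ℝ) ^ (-ρ)))) :
    Tendsto (fun n : ℕ => n * a n / genFun a (expInv n)) atTop (𝓝 (1 / Real.Gamma ρ)) := by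
  set F : ℝ → ℕ → ℝ := fun x n =>
    (∑ j ∈ Finset.range (⌊x * n⌋₊ + 1), a j) / genFun a (expInv n) with hF
  have hT : ∀ x : ℝ, 0 < x → Tendsto (F x) atTop (𝓝 (x ^ ρ / Real.Gamma (1 + ρ))) :=
    fun x hx => tendsto_partialSum_div_genFun ha ha0 hρ hrv hx
  have hΓ : 0 < Real.Gamma ρ := Real.Gamma_pos_of_pos hρ
  have hG : ∀ {n : ℕ}, 1 ≤ n → 0 < genFun a (expInv n) := fun hn =>
    genFun_pos ha ha0 (expInv_pos _).le (expInv_lt_one hn)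
  -- difference quotients of `x ↦ x ^ ρ` at `1`
  have hslope : Tendsto (fun x : ℝ => (x ^ ρ / Real.Gamma (1 + ρ) - 1 ^ ρ / Real.Gamma (1 + ρ))
      / (x - 1)) (𝓝[≠] 1) (𝓝 (1 / Real.Gamma ρ)) := by
    have h := (Real.hasDerivAt_rpow_const (x := 1) (p := ρ) (Or.inl one_ne_zero)).div_const
      (Real.Gamma (1 + ρ))
    have h2 := hasDerivAt_iff_tendsto_slope.1 h
    rw [Real.one_rpow, mul_one, add_comm, Real.Gamma_add_one hρ.ne', div_mul_cancel_left₀ hρ.ne',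
      inv_eq_one_div] at h2
    refine h2.congr fun x => ?_
    rw [slope_def_field, add_comm 1 ρ, Real.Gamma_add_one hρ.ne']
  have hcount : ∀ x : ℝ, 0 < x → Tendsto (fun n : ℕ => ((⌊x * n⌋₊ : ℝ) - n) / n) atTop
      (𝓝 (x - 1)) := by
    intro x hx
    have h := (tendsto_nat_floor_mul_div_atTop hx.le).comp
      (tendsto_natCast_atTop_atTop (R := ℝ))
    have h2 := h.sub_const 1
    refine h2.congr' ?_
    filter_upwards [eventually_ge_atTop 1] with n hn
    have : (n : ℝ) ≠ 0 := by positivity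
    simp only [Function.comp]
    field_simp
  -- For x > 1 the coefficients with index in (n, xn] are at most `a n`, so the difference quotient
  -- of `F` between 1 and x is a lower bound for the sequence; for x < 1 those in (xn, n] are at
  -- least `a n` and it is an upper bound. Letting x → 1 gives the derivative of x^ρ / Γ(1+ρ) at 1.
  rw [tendsto_order]
  constructor
  · intro b hb
    have h1 : ∀ᶠ x in 𝓝[>] (1 : ℝ), b < (x ^ ρ / Real.Gamma (1 + ρ) -
        1 ^ ρ / Real.Gamma (1 + ρ)) / (x - 1) :=
      (hslope.eventually (lt_mem_nhds hb)).filter_mono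
        (nhdsWithin_mono _ fun x (hx : 1 < x) => hx.ne')
    obtain ⟨x, hxb, hx1⟩ := (h1.and self_mem_nhdsWithin).exists
    have hx1 : 1 < x := hx1
    have hlim := ((hT x (by linarith)).sub (hT 1 one_pos)).div (hcount x (by linarith))
      (by linarith)
    filter_upwards [hlim.eventually (lt_mem_nhds hxb), eventually_ge_atTop 1,
      (hcount x (by linarith)).eventually (lt_mem_nhds (show (0 : ℝ) < x - 1 by linarith))]
      with n h3 hn h4
    refine h3.trans_le ?_
    have hn' : (0 : ℝ) < n := by exact_mod_cast hn
    simp only [Pi.div_apply, hF, one_mul, Nat.floor_natCast]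
    rw [← sub_div, div_le_iff₀ h4, div_mul_div_comm, mul_comm (genFun a _) (n : ℝ),
      mul_assoc, mul_div_mul_left _ _ hn'.ne']
    refine div_le_div_of_nonneg_right ?_ (hG hn).le
    have hle : n ≤ ⌊x * n⌋₊ := Nat.le_floor (by nlinarith)
    rw [← Finset.sum_Ico_eq_sub _ (by omega)]
    refine (Finset.sum_le_card_nsmul _ _ (a n) fun j hj => hanti ?_).trans ?_
    · have := (Finset.mem_Ico.1 hj).1; omega
    · rw [Nat.card_Ico, nsmul_eq_mul, Nat.add_sub_add_right, Nat.cast_sub hle, mul_comm]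
  · intro b hb
    have h1 : ∀ᶠ x in 𝓝[<] (1 : ℝ), (x ^ ρ / Real.Gamma (1 + ρ) -
        1 ^ ρ / Real.Gamma (1 + ρ)) / (x - 1) < b :=
      (hslope.eventually (gt_mem_nhds hb)).filter_mono
        (nhdsWithin_mono _ fun x (hx : x < 1) => hx.ne)
    have h2 : ∀ᶠ x in 𝓝[<] (1 : ℝ), 0 < x :=
      (lt_mem_nhds one_pos).filter_mono nhdsWithin_le_nhds
    obtain ⟨x, ⟨hxb, hx0⟩, hx1⟩ := ((h1.and h2).and self_mem_nhdsWithin).exists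
    have hx1 : x < 1 := hx1
    have hlim := ((hT x hx0).sub (hT 1 one_pos)).div (hcount x hx0) (by linarith)
    filter_upwards [hlim.eventually (gt_mem_nhds hxb), eventually_ge_atTop 1,
      (hcount x hx0).eventually (gt_mem_nhds (show x - 1 < (0 : ℝ) by linarith))]
      with n h3 hn h4
    refine lt_of_le_of_lt ?_ h3
    have hn' : (0 : ℝ) < n := by exact_mod_cast hn
    simp only [Pi.div_apply, hF, one_mul, Nat.floor_natCast]
    rw [← sub_div, le_div_iff_of_neg h4, div_mul_div_comm, mul_comm (genFun a _) (n : ℝ),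
      mul_assoc, mul_div_mul_left _ _ hn'.ne']
    refine div_le_div_of_nonneg_right ?_ (hG hn).le
    have hle : ⌊x * n⌋₊ ≤ n := Nat.floor_le_of_le (by nlinarith)
    rw [← neg_le_neg_iff, neg_sub, ← Finset.sum_Ico_eq_sub _ (by omega)]
    refine le_trans ?_ (Finset.card_nsmul_le_sum _ _ (a n) fun j hj => hanti ?_)
    · rw [Nat.card_Ico, nsmul_eq_mul, Nat.add_sub_add_right, Nat.cast_sub hle]
      apply le_of_eq; ring
    · have := (Finset.mem_Ico.1 hj).2; omega

/-! ### Regularly varying sequences, Potter's bound and the Abelian theorem -/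

lemma SlowlyVarying.tendsto_div_natCast {L : ℝ → ℝ} (hL : SlowlyVarying L) {p q : ℕ} (hp : 1 ≤ p)
    (hq : 1 ≤ q) :
    Tendsto (fun m : ℕ => L ((p * m : ℕ) : ℝ) / L ((q * m : ℕ) : ℝ)) atTop (𝓝 1) := by
  have h : ∀ c : ℕ, 1 ≤ c → Tendsto (fun m : ℕ => L ((c * m : ℕ) : ℝ) / L (m : ℝ)) atTop (𝓝 1) := by
    intro c hc
    have := (hL.tendsto c (by exact_mod_cast hc)).comp (tendsto_natCast_atTop_atTop (R := ℝ))
    simpa [Function.comp_def] using this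
  have h2 := (h p hp).div (h q hq) one_ne_zero
  rw [div_one] at h2
  refine h2.congr' ?_
  filter_upwards [(tendsto_natCast_atTop_atTop (R := ℝ)).eventually hL.pos] with m hm
  simp only [Pi.div_apply]
  rw [div_div_div_cancel_right₀ hm.ne']

/-- The constant and the slowly varying factor cancel in the limit. The Abelian theorem needs the
tail only through these ratios, together with its monotonicity. -/
lemma tendsto_ratio_of_isEquivalent {a : ℕ → ℝ} {β G : ℝ} (hG : 0 < G) {L : ℝ → ℝ}
    (hL : SlowlyVarying L)
    (h : Asymptotics.IsEquivalent atTop a fun n : ℕ => 1 / (G * (n : ℝ) ^ β * L n))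
    {p q : ℕ} (hp : 1 ≤ p) (hq : 1 ≤ q) :
    Tendsto (fun m : ℕ => a (p * m) / a (q * m)) atTop (𝓝 (((p : ℝ) / q) ^ (-β))) := by
  have hmul : ∀ c : ℕ, 1 ≤ c → Tendsto (fun m : ℕ => c * m) atTop atTop := fun c hc =>
    tendsto_id.const_mul_atTop' hc
  have he := ((h.comp_tendsto (hmul p hp)).div (h.comp_tendsto (hmul q hq)))
  refine he.symm.tendsto_nhds ?_
  have h1 := (hL.tendsto_div_natCast hq hp).mul_const (((p : ℝ) / q) ^ (-β))
  rw [one_mul] at h1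
  refine h1.congr' ?_
  have hLq := ((tendsto_natCast_atTop_atTop (R := ℝ)).comp (hmul q hq)).eventually hL.pos
  have hLp := ((tendsto_natCast_atTop_atTop (R := ℝ)).comp (hmul p hp)).eventually hL.pos
  filter_upwards [hLp, hLq, eventually_ge_atTop 1] with m h2 h3 hm
  simp only [Function.comp, Pi.div_apply] at *
  have hp' : (0 : ℝ) < p := by exact_mod_cast hp
  have hq' : (0 : ℝ) < q := by exact_mod_cast hq
  have hm' : (0 : ℝ) < m := by exact_mod_cast hm
  rw [Real.rpow_neg (by positivity), Real.div_rpow hp'.le hq'.le]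
  push_cast at *
  rw [Real.mul_rpow hp'.le hm'.le, Real.mul_rpow hq'.le hm'.le]
  have e1 := Real.rpow_pos_of_pos hp' β
  have e2 := Real.rpow_pos_of_pos hq' β
  have e3 := Real.rpow_pos_of_pos hm' β
  field_simp

/-- Regular variation along rational multiples extends to real multiples of a nonincreasing
sequence. -/
lemma tendsto_floor_ratio {a : ℕ → ℝ} (hpos : ∀ n, 0 < a n) (hanti : Antitone a) {β : ℝ}
    (h : ∀ p q : ℕ, 1 ≤ p → 1 ≤ q →
      Tendsto (fun m : ℕ => a (p * m) / a (q * m)) atTop (𝓝 (((p : ℝ) / q) ^ (-β))))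
    {x : ℝ} (hx : 0 < x) :
    Tendsto (fun n : ℕ => a ⌊n * x⌋₊ / a n) atTop (𝓝 (x ^ (-β))) := by
  have hcont : ContinuousAt (fun y : ℝ => y ^ (-β)) x :=
    Real.continuousAt_rpow_const x _ (Or.inl hx.ne')
  have hdiv : ∀ q : ℕ, 1 ≤ q → Tendsto (fun n : ℕ => n / q) atTop atTop := fun q hq =>
    Nat.tendsto_div_const_atTop (by omega)
  have hrat : ∀ r : ℚ, 0 < r → ∃ p q : ℕ, 1 ≤ p ∧ 1 ≤ q ∧ (r : ℝ) = (p : ℝ) / q := by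
    intro r hr
    refine ⟨r.num.toNat, r.den, ?_, r.pos, ?_⟩
    · have := Rat.num_pos.2 hr; omega
    · have h1 : ((r.num.toNat : ℕ) : ℝ) = ((r.num : ℤ) : ℝ) := by
        have : ((r.num.toNat : ℕ) : ℤ) = r.num := Int.toNat_of_nonneg (Rat.num_pos.2 hr).le
        exact_mod_cast congrArg (Int.cast (R := ℝ)) this
      rw [h1]
      exact_mod_cast (Rat.num_div_den r).symm
  have hmod : ∀ q n : ℕ, 1 ≤ q → q * (n / q) ≤ n ∧ n < q * (n / q + 1) := fun q n hq =>
    ⟨Nat.mul_div_le n q, Nat.lt_mul_div_succ n (by omega)⟩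
  rw [tendsto_order]
  constructor
  · intro b hb
    obtain ⟨y, hyx, hyb⟩ : ∃ y, x < y ∧ ∀ z ∈ Set.Ioo x y, b < z ^ (-β) := by
      have h1 : ∀ᶠ z in 𝓝[>] x, b < z ^ (-β) :=
        (hcont.eventually (lt_mem_nhds hb)).filter_mono nhdsWithin_le_nhds
      obtain ⟨y, hy, hy2⟩ := (mem_nhdsGT_iff_exists_Ioo_subset).1 h1
      exact ⟨y, hy, fun z hz => hy2 hz⟩
    obtain ⟨r, hr1, hr2⟩ := exists_rat_btwn hyx
    obtain ⟨p, q, hp, hq, hpq⟩ := hrat r (by exact_mod_cast hx.trans hr1)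
    have h3 := ((h p q hp hq).comp (hdiv q hq)).eventually
      (lt_mem_nhds (hpq ▸ hyb r ⟨hr1, hr2⟩))
    have hq' : (0 : ℝ) < q := by exact_mod_cast hq
    rw [hpq, lt_div_iff₀ hq'] at hr1
    -- With p/q > x and m = ⌊n/q⌋, one has q m ≤ n always, and n x ≤ p m as soon as n passes this
    -- threshold; it absorbs the rounding loss of at most p.
    have h4 : ∀ᶠ n : ℕ in atTop, (p * q : ℝ) / (p - x * q) ≤ n :=
      (tendsto_natCast_atTop_atTop (R := ℝ)).eventually (eventually_ge_atTop _)
    filter_upwards [h3, h4] with n h5 h6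
    refine h5.trans_le ?_
    obtain ⟨e1, e2⟩ := hmod q n hq
    simp only [Function.comp]
    refine div_le_div₀ (hpos _).le (hanti ?_) (hpos _) (hanti e1)
    refine Nat.floor_le_of_le ?_
    rw [div_le_iff₀ (by linarith)] at h6
    have e3 : (n : ℝ) < q * ((n / q : ℕ) + 1) := by exact_mod_cast e2
    push_cast
    have hp' : (0 : ℝ) < p := by exact_mod_cast hp
    nlinarith [mul_lt_mul_of_pos_left e3 hp', mul_pos hp' hq']
  · intro b hb
    obtain ⟨y, hyx, hyb⟩ : ∃ y, y < x ∧ ∀ z ∈ Set.Ioo y x, z ^ (-β) < b := by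
      have h1 : ∀ᶠ z in 𝓝[<] x, z ^ (-β) < b :=
        (hcont.eventually (gt_mem_nhds hb)).filter_mono nhdsWithin_le_nhds
      obtain ⟨y, hy, hy2⟩ := (mem_nhdsLT_iff_exists_Ioo_subset).1 h1
      exact ⟨y, hy, fun z hz => hy2 hz⟩
    obtain ⟨r, hr1, hr2⟩ := exists_rat_btwn (max_lt hyx hx)
    obtain ⟨p, q, hp, hq, hpq⟩ := hrat r (by exact_mod_cast (le_max_right _ _).trans_lt hr1)
    have h3 := ((h p q hp hq).comp ((tendsto_add_atTop_nat 1).comp (hdiv q hq))).eventually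
      (gt_mem_nhds (hpq ▸ hyb r ⟨(le_max_left _ _).trans_lt hr1, hr2⟩))
    have hq' : (0 : ℝ) < q := by exact_mod_cast hq
    rw [hpq, div_lt_iff₀ hq'] at hr2
    -- Here p/q < x, and n/q is rounded up to m + 1: then n ≤ q (m+1) always, and p (m+1) ≤ n x
    -- beyond this threshold.
    have h4 : ∀ᶠ n : ℕ in atTop, (p * q : ℝ) / (x * q - p) ≤ n :=
      (tendsto_natCast_atTop_atTop (R := ℝ)).eventually (eventually_ge_atTop _)
    filter_upwards [h3, h4] with n h5 h6
    refine lt_of_le_of_lt ?_ h5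
    obtain ⟨e1, e2⟩ := hmod q n hq
    simp only [Function.comp]
    refine div_le_div₀ (hpos _).le (hanti ?_) (hpos _) (hanti e2.le)
    refine Nat.le_floor ?_
    rw [div_le_iff₀ (by linarith)] at h6
    have e3 : (q : ℝ) * (n / q : ℕ) ≤ n := by exact_mod_cast e1
    push_cast
    have hp' : (0 : ℝ) < p := by exact_mod_cast hp
    nlinarith [mul_le_mul_of_nonneg_left e3 hp'.le, mul_pos hp' hq']

/-- Potter's bound for a nonincreasing regularly varying sequence. -/
lemma exists_potter_bound {a : ℕ → ℝ} (hpos : ∀ n, 0 < a n) (hanti : Antitone a) {β γ : ℝ}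
    (hγ : 0 < γ) (hβγ : β < γ)
    (h : Tendsto (fun m : ℕ => a (1 * m) / a (2 * m)) atTop (𝓝 (((1 : ℕ) / (2 : ℕ) : ℝ) ^ (-β)))) :
    ∃ C : ℝ, 0 < C ∧ ∀ n j : ℕ, 1 ≤ n → j ≤ n → a j ≤ C * ((n : ℝ) / (j + 1)) ^ γ * a n := by
  -- The ratio a j / a (2j) tends to 2^β < 2^γ, so far out each doubling of the index costs at most
  -- a factor 2^γ. About log₂ (n/j) doublings lead from j to n.
  have hlt : ((1 : ℕ) / (2 : ℕ) : ℝ) ^ (-β) < (2 : ℝ) ^ γ := by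
    push_cast
    rw [one_div, Real.inv_rpow (by norm_num), Real.rpow_neg (by norm_num), inv_inv]
    exact Real.rpow_lt_rpow_of_exponent_lt (by norm_num) hβγ
  obtain ⟨N0, hN0⟩ := eventually_atTop.1 (h.eventually (gt_mem_nhds hlt))
  set N := max N0 1 with hN
  have hstep : ∀ j, N ≤ j → a j ≤ 2 ^ γ * a (2 * j) := by
    intro j hj
    have := hN0 j ((le_max_left _ _).trans hj)
    rw [one_mul, div_lt_iff₀ (hpos _)] at this
    exact this.le
  have hiter : ∀ m j, N ≤ j → a j ≤ ((2 : ℝ) ^ m) ^ γ * a (2 ^ m * j) := by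
    intro m
    induction m with
    | zero => intro j hj; simp
    | succ m ih =>
      intro j hj
      refine (ih j hj).trans ?_
      have h1 := hstep (2 ^ m * j) (hj.trans (Nat.le_mul_of_pos_left _ (by positivity)))
      have h2 : (0 : ℝ) < ((2 : ℝ) ^ m) ^ γ := by positivity
      refine (mul_le_mul_of_nonneg_left h1 h2.le).trans (le_of_eq ?_)
      rw [← mul_assoc, ← Real.mul_rpow (by positivity) (by norm_num), ← pow_succ, ← mul_assoc,
        ← pow_succ']
  have hlarge : ∀ n j, N ≤ j → j ≤ n → a j ≤ 2 ^ γ * ((n : ℝ) / j) ^ γ * a n := by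
    intro n j hj hjn
    have hj1 : 1 ≤ j := (le_max_right _ _).trans hj
    have hj0 : (0 : ℝ) < j := by exact_mod_cast hj1
    have hx : 1 ≤ (n : ℝ) / j := by rw [le_div_iff₀ hj0, one_mul]; exact_mod_cast hjn
    obtain ⟨m, hm1, hm2⟩ := exists_nat_pow_near hx (one_lt_two (α := ℝ))
    refine (hiter (m + 1) j hj).trans ?_
    have h1 : a (2 ^ (m + 1) * j) ≤ a n := by
      refine hanti ?_
      rw [div_lt_iff₀ hj0] at hm2
      exact_mod_cast hm2.le
    rw [← Real.mul_rpow (by norm_num) (by positivity)]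
    refine mul_le_mul (Real.rpow_le_rpow (by positivity) ?_ hγ.le) h1 (hpos _).le (by positivity)
    rw [pow_succ']
    linarith
  have hN1 : (1 : ℝ) ≤ N := by exact_mod_cast le_max_right _ _
  have hr : 1 ≤ a 0 / a N := by rw [le_div_iff₀ (hpos _), one_mul]; exact hanti (Nat.zero_le _)
  have h2γ : (0 : ℝ) < 2 ^ γ := by positivity
  -- One factor 2^γ pays for the last doubling overshooting n, the other for passing from j to j +
  -- 1, and a 0 / a N covers the indices j < N. The denominator j + 1 admits j = 0.
  refine ⟨2 ^ γ * 2 ^ γ * (a 0 / a N), by have := hpos 0; have := hpos N; positivity, ?_⟩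
  intro n j hn hjn
  have hn0 : (0 : ℝ) < n := by exact_mod_cast hn
  have hj1 : (0 : ℝ) < (j : ℝ) + 1 := by positivity
  have hjn' : (j : ℝ) ≤ n := by exact_mod_cast hjn
  have hn1 : (1 : ℝ) ≤ n := by exact_mod_cast hn
  have hX : (0 : ℝ) < ((n : ℝ) / (j + 1)) ^ γ := by positivity
  have h21 : (1 : ℝ) ≤ 2 ^ γ := Real.one_le_rpow (by norm_num) hγ.le
  by_cases hj : N ≤ j
  · have hjpos : (1 : ℝ) ≤ j := hN1.trans (by exact_mod_cast hj)
    refine (hlarge n j hj hjn).trans (mul_le_mul_of_nonneg_right ?_ (hpos _).le)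
    have h1 : ((n : ℝ) / j) ^ γ ≤ 2 ^ γ * ((n : ℝ) / (j + 1)) ^ γ := by
      rw [← Real.mul_rpow (by norm_num) (by positivity)]
      refine Real.rpow_le_rpow (by positivity) ?_ hγ.le
      rw [← mul_div_assoc, div_le_div_iff₀ (by linarith) hj1]
      nlinarith
    calc 2 ^ γ * ((n : ℝ) / j) ^ γ ≤ 2 ^ γ * (2 ^ γ * ((n : ℝ) / (j + 1)) ^ γ) :=
          mul_le_mul_of_nonneg_left h1 h2γ.le
      _ = 2 ^ γ * 2 ^ γ * 1 * ((n : ℝ) / (j + 1)) ^ γ := by ring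
      _ ≤ _ := by gcongr
  · have hjN : (j : ℝ) + 1 ≤ N := by exact_mod_cast (not_le.1 hj)
    have h0 : a j ≤ a 0 / a N * a N := by
      rw [div_mul_cancel₀ _ (hpos _).ne']; exact hanti (Nat.zero_le _)
    refine h0.trans ?_
    have key : a N ≤ 2 ^ γ * 2 ^ γ * ((n : ℝ) / (j + 1)) ^ γ * a n := by
      by_cases hnN : N ≤ n
      · refine (hlarge n N le_rfl hnN).trans (mul_le_mul_of_nonneg_right ?_ (hpos _).le)
        rw [mul_assoc]
        refine mul_le_mul_of_nonneg_left ?_ h2γ.le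
        refine le_trans ?_ (le_mul_of_one_le_left hX.le h21)
        exact Real.rpow_le_rpow (by positivity)
          (div_le_div_of_nonneg_left hn0.le hj1 hjN) hγ.le
      · refine (hanti (not_le.1 hnN).le).trans (le_mul_of_one_le_left (hpos _).le ?_)
        rw [mul_assoc, ← Real.mul_rpow (by norm_num) (by positivity)]
        refine one_le_mul_of_one_le_of_one_le h21 (Real.one_le_rpow ?_ hγ.le)
        rw [← mul_div_assoc, le_div_iff₀ hj1]
        linarith
    calc a 0 / a N * a N ≤ a 0 / a N * (2 ^ γ * 2 ^ γ * ((n : ℝ) / (j + 1)) ^ γ * a n) :=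
          mul_le_mul_of_nonneg_left key (by linarith)
      _ = _ := by ring

lemma hasDerivAt_exp_neg_mul (k t : ℝ) :
    HasDerivAt (fun x => Real.exp (-(k * x))) (Real.exp (-(k * t)) * -k) t := by
  have h1 : HasDerivAt (fun x : ℝ => -(k * x)) (-(k * 1)) t :=
    ((hasDerivAt_id t).const_mul k).fun_neg
  rw [mul_one] at h1
  exact h1.exp

lemma integrableOn_floor_mul_exp {a : ℕ → ℝ} (ha : ∀ n, a n ∈ Set.Icc (0 : ℝ) 1) (n : ℕ) {k : ℕ}
    (hk : 1 ≤ k) :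
    IntegrableOn (fun t : ℝ => a ⌊n * t⌋₊ * Real.exp (-(k * t))) (Set.Ici 0) := by
  have hk' : (1 : ℝ) ≤ k := by exact_mod_cast hk
  rw [integrableOn_Ici_iff_integrableOn_Ioi]
  refine (Real.GammaIntegral_convergent one_pos).mono' ?_ ?_
  · refine Measurable.aestronglyMeasurable ?_
    have : Measurable fun t : ℝ => a ⌊n * t⌋₊ :=
      (measurable_from_top (f := a)).comp (Nat.measurable_floor.comp (by fun_prop))
    fun_prop
  · refine (ae_restrict_iff' measurableSet_Ioi).2 (ae_of_all _ fun t (ht : 0 < t) => ?_)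
    rw [norm_mul, Real.norm_of_nonneg (ha _).1, Real.norm_of_nonneg (Real.exp_pos _).le]
    simp only [sub_self, Real.rpow_zero, mul_one]
    refine (mul_le_of_le_one_left (Real.exp_pos _).le (ha _).2).trans ?_
    exact Real.exp_le_exp.2 (by nlinarith)

/-- The integrand has the constant coefficient a j on [j/n, (j+1)/n), where the exponential
integrates to r^(kj) (1 - r^k) / k with r = exp (-1/n). This rewrites the generating function as a
Laplace integral, to which dominated convergence applies. -/
lemma integral_floor_mul_exp {a : ℕ → ℝ} (ha : ∀ n, a n ∈ Set.Icc (0 : ℝ) 1) {n k : ℕ}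
    (hn : 1 ≤ n) (hk : 1 ≤ k) :
    ∫ t in Set.Ioi (0 : ℝ), a ⌊n * t⌋₊ * Real.exp (-(k * t))
      = genFun a (expInv n ^ k) * (1 - expInv n ^ k) / k := by
  have hn' : (0 : ℝ) < n := by exact_mod_cast hn
  have hk' : (0 : ℝ) < k := by exact_mod_cast hk
  set S : ℕ → Set ℝ := fun j => Set.Ico ((j : ℝ) / n) ((j + 1 : ℕ) / n) with hS
  have hmem : ∀ {t : ℝ} {j : ℕ}, 0 ≤ t → (t ∈ S j ↔ ⌊n * t⌋₊ = j) := by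
    intro t j ht
    simp only [hS, Set.mem_Ico]
    rw [Nat.floor_eq_iff (by positivity), div_le_iff₀ hn', lt_div_iff₀ hn', mul_comm t]
    push_cast
    rfl
  have hSnn : ∀ {t : ℝ} {j : ℕ}, t ∈ S j → 0 ≤ t := fun h => le_trans (by positivity) h.1
  have hU : Set.Ici (0 : ℝ) = ⋃ j, S j := by
    ext t
    rw [Set.mem_iUnion]
    exact ⟨fun ht => ⟨_, (hmem ht).2 rfl⟩, fun ⟨j, hj⟩ => hSnn hj⟩
  have hdisj : Pairwise (Function.onFun Disjoint S) := by
    intro i j hij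
    refine Set.disjoint_left.2 fun t hi hj => hij ?_
    rw [← (hmem (hSnn hi)).1 hi, (hmem (hSnn hj)).1 hj]
  have hint := integrableOn_floor_mul_exp ha n hk
  rw [← integral_Ici_eq_integral_Ioi]
  rw [hU] at hint ⊢
  rw [integral_iUnion (fun j => measurableSet_Ico) hdisj hint, genFun, ← tsum_mul_right,
    ← tsum_div_const]
  refine tsum_congr fun j => ?_
  have hle : (j : ℝ) / n ≤ (j + 1 : ℕ) / n := by gcongr; simp
  rw [setIntegral_congr_fun (g := fun t => a j * Real.exp (-(k * t))) measurableSet_Ico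
    fun t ht => by simp only [(hmem (hSnn ht)).1 ht], integral_const_mul,
    integral_Ico_eq_integral_Ioc, ← intervalIntegral.integral_of_le hle,
    intervalIntegral.integral_eq_sub_of_hasDerivAt
      (f := fun t => -(Real.exp (-(k * t)) / k))]
  · rw [← pow_mul, expInv_pow, expInv_pow]
    have e1 : Real.exp (-(k * ((j + 1 : ℕ) / n : ℝ)))
        = Real.exp (-((k * j : ℕ) / n : ℝ)) * Real.exp (-(k / n : ℝ)) := by
      rw [← Real.exp_add]; congr 1; push_cast; ring
    have e2 : Real.exp (-(k * ((j : ℝ) / n))) = Real.exp (-((k * j : ℕ) / n : ℝ)) := by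
      congr 1; push_cast; ring
    rw [e1, e2]
    ring
  · intro t _
    convert ((hasDerivAt_exp_neg_mul (k : ℝ) t).div_const (k : ℝ)).fun_neg using 1
    field_simp
  · exact Continuous.intervalIntegrable (by fun_prop) _ _

/-- The Abelian theorem for generating functions of regularly varying nonincreasing sequences. -/
theorem tendsto_genFun_mul_div {a : ℕ → ℝ} (ha : ∀ n, a n ∈ Set.Icc (0 : ℝ) 1)
    (hpos : ∀ n, 0 < a n) (hanti : Antitone a) {β : ℝ} (hβ0 : 0 < β) (hβ1 : β < 1)
    (h : ∀ p q : ℕ, 1 ≤ p → 1 ≤ q →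
      Tendsto (fun m : ℕ => a (p * m) / a (q * m)) atTop (𝓝 (((p : ℝ) / q) ^ (-β))))
    {k : ℕ} (hk : 1 ≤ k) :
    Tendsto (fun n : ℕ => genFun a (expInv n ^ k) * (1 - expInv n ^ k) / a n) atTop
      (𝓝 ((k : ℝ) ^ β * Real.Gamma (1 - β))) := by
  have hk' : (0 : ℝ) < k := by exact_mod_cast hk
  have hk1 : (1 : ℝ) ≤ k := by exact_mod_cast hk
  -- γ > β is required by Potter's bound, and γ < 1 makes t^(-γ) integrable at 0.
  obtain ⟨γ, hβγ, hγ1⟩ := exists_between hβ1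
  have hγ0 : 0 < γ := hβ0.trans hβγ
  obtain ⟨C, hC, hpot⟩ := exists_potter_bound hpos hanti hγ0 hβγ (h 1 2 le_rfl (by norm_num))
  have hlim : Tendsto (fun n : ℕ => ∫ t in Set.Ioi (0 : ℝ),
      (a ⌊n * t⌋₊ * Real.exp (-(k * t))) / a n) atTop
      (𝓝 (∫ t in Set.Ioi (0 : ℝ), t ^ (-β) * Real.exp (-(k * t)))) := by
    refine tendsto_integral_of_dominated_convergence
      (fun t => C * (Real.exp (-t) * t ^ ((1 - γ) - 1)) + Real.exp (-t) * t ^ ((1 : ℝ) - 1))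
      (fun n => ?_) ?_ (fun n => ?_) ?_
    · refine Measurable.aestronglyMeasurable ?_
      have : Measurable fun t : ℝ => a ⌊n * t⌋₊ :=
        (measurable_from_top (f := a)).comp (Nat.measurable_floor.comp (by fun_prop))
      fun_prop
    · exact ((Real.GammaIntegral_convergent (by linarith)).const_mul C).add
        (Real.GammaIntegral_convergent one_pos)
    · refine (ae_restrict_iff' measurableSet_Ioi).2 (ae_of_all _ fun t (ht : 0 < t) => ?_)
      have he : Real.exp (-(k * t)) ≤ Real.exp (-t) := Real.exp_le_exp.2 (by nlinarith)
      have hnn : 0 ≤ a ⌊n * t⌋₊ / a n := div_nonneg (hpos _).le (hpos _).le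
      rw [mul_div_right_comm, norm_mul, Real.norm_of_nonneg hnn,
        Real.norm_of_nonneg (Real.exp_pos _).le]
      -- Potter's bound handles t ≤ 1, using n t < ⌊n t⌋ + 1; monotonicity handles t > 1. For n = 0
      -- the quotient is a 0 / a 0 = 1.
      have hmain : a ⌊n * t⌋₊ / a n ≤ C * t ^ (-γ) + 1 := by
        have htγ : 0 < t ^ (-γ) := Real.rpow_pos_of_pos ht _
        rcases Nat.eq_zero_or_pos n with rfl | hn
        · simp [div_self (hpos 0).ne']; positivity
        have hn' : (0 : ℝ) < n := by exact_mod_cast hn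
        rw [div_le_iff₀ (hpos _)]
        rcases le_or_gt t 1 with ht1 | ht1
        · have hj : ⌊(n : ℝ) * t⌋₊ ≤ n := Nat.floor_le_of_le (by nlinarith)
          refine (hpot n _ hn hj).trans (mul_le_mul_of_nonneg_right ?_ (hpos _).le)
          have : ((n : ℝ) / ((⌊(n : ℝ) * t⌋₊ : ℕ) + 1)) ^ γ ≤ t ^ (-γ) := by
            rw [Real.rpow_neg ht.le, ← Real.inv_rpow ht.le]
            refine Real.rpow_le_rpow (by positivity) ?_ hγ0.le
            rw [div_le_iff₀ (by positivity), inv_mul_eq_div, le_div_iff₀ ht]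
            exact (Nat.lt_floor_add_one _).le
          nlinarith [mul_le_mul_of_nonneg_left this hC.le]
        · have : a ⌊(n : ℝ) * t⌋₊ ≤ a n := hanti (Nat.le_floor (by nlinarith))
          have h2 : 0 ≤ C * t ^ (-γ) * a n := by have := hpos n; positivity
          linarith
      calc _ ≤ (C * t ^ (-γ) + 1) * Real.exp (-t) :=
            mul_le_mul hmain he (Real.exp_pos _).le (by positivity)
        _ = _ := by
          rw [sub_self, Real.rpow_zero, show (1 - γ - 1 : ℝ) = -γ by ring]; ring
    · refine (ae_restrict_iff' measurableSet_Ioi).2 (ae_of_all _ fun t (ht : 0 < t) => ?_)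
      refine ((tendsto_floor_ratio hpos hanti h ht).mul_const (Real.exp (-(k * t)))).congr
        fun n => ?_
      ring
  have hval : ∫ t in Set.Ioi (0 : ℝ), t ^ (-β) * Real.exp (-(k * t))
      = (k : ℝ) ^ β * Real.Gamma (1 - β) / k := by
    have := Real.integral_rpow_mul_exp_neg_mul_Ioi (a := 1 - β) (r := k) (by linarith) hk'
    rw [show (1 - β - 1 : ℝ) = -β by ring] at this
    rw [this, one_div, Real.inv_rpow hk'.le, Real.rpow_sub hk', Real.rpow_one]
    have := Real.rpow_pos_of_pos hk' β
    field_simp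
  rw [hval] at hlim
  have h2 := hlim.mul_const (k : ℝ)
  rw [div_mul_cancel₀ _ hk'.ne'] at h2
  refine h2.congr' ?_
  filter_upwards [eventually_ge_atTop 1] with n hn
  rw [integral_div, integral_floor_mul_exp ha hn hk]
  field_simp

/-! ### Generating functions of renewal sequences -/

lemma tendsto_natCast_mul_one_sub_expInv_pow (k : ℕ) :
    Tendsto (fun n : ℕ => (n : ℝ) * (1 - expInv n ^ k)) atTop (𝓝 k) := by
  have hd : HasDerivAt (fun x : ℝ => Real.exp (-(k * x))) (-(k : ℝ)) 0 := by
    simpa using hasDerivAt_exp_neg_mul (k : ℝ) 0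
  have h2 := (hasDerivAt_iff_tendsto_slope.1 hd).neg
  have h3 : Tendsto (fun n : ℕ => ((n : ℝ))⁻¹) atTop (𝓝[≠] 0) := by
    refine tendsto_nhdsWithin_iff.2 ⟨tendsto_inv_atTop_nhds_zero_nat, ?_⟩
    filter_upwards [eventually_ge_atTop 1] with n hn
    have : (n : ℝ) ≠ 0 := by positivity
    simpa using this
  have h4 := h2.comp h3
  rw [neg_neg] at h4
  refine h4.congr fun n => ?_
  simp only [Function.comp, slope_def_field, expInv_pow, mul_zero, neg_zero, Real.exp_zero,
    sub_zero, div_inv_eq_mul]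
  rw [← div_eq_mul_inv]
  ring

/-- The renewal equation in terms of generating functions. -/
lemma genFun_mul_genFun {a u : ℕ → ℝ} (ha : ∀ n, a n ∈ Set.Icc (0 : ℝ) 1)
    (hu : ∀ n, u n ∈ Set.Icc (0 : ℝ) 1)
    (hren : ∀ n, ∑ k ∈ Finset.range (n + 1), u k * a (n - k) = 1) {r : ℝ} (h0 : 0 ≤ r)
    (h1 : r < 1) : genFun u r * (genFun a r * (1 - r)) = 1 := by
  have hsu := summable_genFun hu h0 h1
  have hsa := summable_genFun ha h0 h1
  have h := tsum_mul_tsum_eq_tsum_sum_antidiagonal_of_summable_norm hsu.norm hsa.norm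
  have h2 : ∀ n : ℕ, ∑ kl ∈ Finset.HasAntidiagonal.antidiagonal n, u kl.1 * r ^ kl.1 * (a kl.2 * r ^ kl.2)
      = r ^ n := by
    intro n
    rw [Finset.Nat.sum_antidiagonal_eq_sum_range_succ_mk, ← one_mul (r ^ n), ← hren n,
      Finset.sum_mul]
    refine Finset.sum_congr rfl fun k hk => ?_
    have : k ≤ n := by have := Finset.mem_range.1 hk; omega
    rw [show r ^ n = r ^ k * r ^ (n - k) by rw [← pow_add]; congr 1; omega]
    ring
  simp only [h2] at h
  rw [tsum_geometric_of_lt_one h0 h1] at h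
  rw [← mul_assoc, genFun, genFun, h, inv_mul_cancel₀ (by linarith)]

/-- If `u' = c u` asymptotically and the generating function of `u` diverges, then the generating
functions are asymptotically proportional. -/
lemma tendsto_genFun_div_genFun {u u' cs : ℕ → ℝ} {c : ℝ} (hu : ∀ n, u n ∈ Set.Icc (0 : ℝ) 1)
    (hu' : ∀ n, u' n ∈ Set.Icc (0 : ℝ) 1) (hcs : ∀ n, u' n = cs n * u n)
    (hc : Tendsto cs atTop (𝓝 c)) {x : ℕ → ℝ} (hx : ∀ᶠ n in atTop, x n ∈ Set.Ioo (0 : ℝ) 1)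
    (hdiv : Tendsto (fun n => genFun u (x n)) atTop atTop) :
    Tendsto (fun n => genFun u' (x n) / genFun u (x n)) atTop (𝓝 c) := by
  rw [Metric.tendsto_nhds]
  intro ε hε
  obtain ⟨N, hN⟩ := eventually_atTop.1 (Metric.tendsto_nhds.1 hc (ε / 2) (by positivity))
  -- The first N terms contribute at most K in total, since each u j x^j ≤ 1; the others contribute
  -- at most ε/2 times U. Divergence of U makes K negligible.
  set K := ∑ j ∈ Finset.range N, |cs j - c| with hK
  filter_upwards [hx, hdiv.eventually (eventually_gt_atTop (max 0 (2 * K / ε)))] with n hn hd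
  have hpos : 0 < genFun u (x n) := (le_max_left _ _).trans_lt hd
  have hKd : K < ε / 2 * genFun u (x n) := by
    have := (le_max_right _ _).trans_lt hd
    rw [div_lt_iff₀ hε] at this
    linarith
  have hsu := summable_genFun hu hn.1.le hn.2
  have hsu' := summable_genFun hu' hn.1.le hn.2
  have hdiff : ‖genFun u' (x n) - c * genFun u (x n)‖ ≤ ε / 2 * genFun u (x n) + K := by
    rw [genFun, genFun, ← tsum_mul_left, ← hsu'.tsum_sub (hsu.mul_left c)]
    have hs2 : HasSum (fun j => if j ∈ Finset.range N then |cs j - c| else 0) K := by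
      have : HasSum (fun j => if j ∈ Finset.range N then |cs j - c| else 0)
          (∑ j ∈ Finset.range N, if j ∈ Finset.range N then |cs j - c| else 0) :=
        hasSum_sum_of_ne_finset_zero fun j hj => if_neg hj
      rwa [Finset.sum_congr rfl fun j hj => if_pos hj] at this
    refine tsum_of_norm_bounded ((hsu.hasSum.mul_left (ε / 2)).add hs2) fun j => ?_
    have hp : 0 ≤ u j * x n ^ j := mul_nonneg (hu j).1 (pow_nonneg hn.1.le _)
    have hp1 : u j * x n ^ j ≤ 1 :=
      mul_le_one₀ (hu j).2 (pow_nonneg hn.1.le _) (pow_le_one₀ hn.1.le hn.2.le)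
    rw [hcs, show cs j * u j * x n ^ j - c * (u j * x n ^ j) = (cs j - c) * (u j * x n ^ j) by ring,
      norm_mul, Real.norm_of_nonneg hp, Real.norm_eq_abs]
    by_cases hj : j ∈ Finset.range N
    · rw [if_pos hj]
      have : 0 ≤ ε / 2 * (u j * x n ^ j) := by positivity
      nlinarith [abs_nonneg (cs j - c)]
    · rw [if_neg hj, add_zero]
      have := hN j (by simpa using hj)
      rw [Real.dist_eq] at this
      exact mul_le_mul_of_nonneg_right this.le hp
  rw [Real.dist_eq, show genFun u' (x n) / genFun u (x n) - c
    = (genFun u' (x n) - c * genFun u (x n)) / genFun u (x n) by field_simp, abs_div,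
    abs_of_pos hpos, div_lt_iff₀ hpos]
  rw [Real.norm_eq_abs] at hdiff
  linarith

/-- A positive nonincreasing regularly varying sequence of negative index tends to zero. -/
lemma tendsto_zero_of_tendsto_ratio {a : ℕ → ℝ} (hpos : ∀ n, 0 < a n) (hanti : Antitone a) {β : ℝ}
    (hβ0 : 0 < β)
    (h : ∀ p q : ℕ, 1 ≤ p → 1 ≤ q →
      Tendsto (fun m : ℕ => a (p * m) / a (q * m)) atTop (𝓝 (((p : ℝ) / q) ^ (-β)))) :
    Tendsto a atTop (𝓝 0) := by
  obtain ⟨l, hl⟩ : ∃ l, Tendsto a atTop (𝓝 l) :=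
    ⟨_, tendsto_atTop_ciInf hanti ⟨0, by rintro _ ⟨n, rfl⟩; exact (hpos n).le⟩⟩
  rcases eq_or_ne l 0 with rfl | hl0
  · exact hl
  exfalso
  have hmul : ∀ c : ℕ, 1 ≤ c → Tendsto (fun m : ℕ => c * m) atTop atTop := fun c hc =>
    tendsto_id.const_mul_atTop' hc
  have h1 := (hl.comp (hmul 1 le_rfl)).div (hl.comp (hmul 2 (by norm_num))) hl0
  rw [div_self hl0] at h1
  have h2 := tendsto_nhds_unique h1 (h 1 2 le_rfl (by norm_num))
  push_cast at h2
  have h3 : (1 : ℝ) < (1 / 2 : ℝ) ^ (-β) :=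
    Real.one_lt_rpow_of_pos_of_lt_one_of_neg (by norm_num) (by norm_num) (by linarith)
  exact h3.ne h2

/-- If two renewal sequences are asymptotically proportional, then so are their tails, provided
one of them is regularly varying of index in `(-1, 0)`; moreover the renewal function is determined
by the tail. -/
theorem renewal_comparison {a u a' u' cs : ℕ → ℝ} {c β : ℝ} {L : ℝ → ℝ}
    (ha : ∀ n, a n ∈ Set.Icc (0 : ℝ) 1) (hu : ∀ n, u n ∈ Set.Icc (0 : ℝ) 1)
    (ha' : ∀ n, a' n ∈ Set.Icc (0 : ℝ) 1) (hu' : ∀ n, u' n ∈ Set.Icc (0 : ℝ) 1)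
    (hanti : Antitone a) (hanti' : Antitone a')
    (hren : ∀ n, ∑ k ∈ Finset.range (n + 1), u k * a (n - k) = 1)
    (hren' : ∀ n, ∑ k ∈ Finset.range (n + 1), u' k * a' (n - k) = 1)
    (hcs : ∀ n, u' n = cs n * u n) (hc : Tendsto cs atTop (𝓝 c)) (hc0 : 0 < c)
    (hβ0 : 0 < β) (hβ1 : β < 1) (hL : SlowlyVarying L)
    (htail : Asymptotics.IsEquivalent atTop a
      fun n : ℕ => 1 / (Real.Gamma (1 - β) * (n : ℝ) ^ β * L n)) :
    Asymptotics.IsEquivalent atTop a'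
      (fun n : ℕ => 1 / (Real.Gamma (1 - β) * (n : ℝ) ^ β * (c * L n))) ∧
    Asymptotics.IsEquivalent atTop (fun n : ℕ => ∑ j ∈ Finset.range (n + 1), u' (j + 1))
      (fun n : ℕ => 1 / Real.Gamma (1 + β) * (n : ℝ) ^ β * (c * L n)) ∧
    Tendsto (fun n : ℕ => ∑ j ∈ Finset.range (n + 1), u' (j + 1)) atTop atTop := by
  have hΓ : 0 < Real.Gamma (1 - β) := Real.Gamma_pos_of_pos (by linarith)
  have hΓ' : 0 < Real.Gamma (1 + β) := Real.Gamma_pos_of_pos (by linarith)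
  have hLpos : ∀ᶠ n : ℕ in atTop, 0 < L n :=
    (tendsto_natCast_atTop_atTop (R := ℝ)).eventually hL.pos
  have hnz : ∀ᶠ n : ℕ in atTop, 0 < 1 / (Real.Gamma (1 - β) * (n : ℝ) ^ β * L n) := by
    filter_upwards [hLpos, eventually_ge_atTop 1] with n h1 h2
    have : (0 : ℝ) < n := by exact_mod_cast h2
    positivity
  have htail1 := (Asymptotics.isEquivalent_iff_tendsto_one
    (hnz.mono fun n hn => hn.ne')).1 htail
  -- A zero of the nonincreasing sequence `a` would persist, contradicting equivalence to an
  -- eventually positive sequence.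
  have hpos : ∀ n, 0 < a n := by
    intro n
    refine lt_of_le_of_ne (ha n).1 fun h => ?_
    have h1 : ∀ᶠ m in atTop, a m ≠ 0 := by
      filter_upwards [htail1.eventually (lt_mem_nhds (zero_lt_one' ℝ))] with m hm h0
      simp [h0] at hm
    obtain ⟨m, hm1, hm2⟩ := (h1.and (eventually_ge_atTop n)).exists
    exact hm1 (le_antisymm ((hanti hm2).trans h.symm.le) (ha m).1)
  have hrv : ∀ p q : ℕ, 1 ≤ p → 1 ≤ q →
      Tendsto (fun m : ℕ => a (p * m) / a (q * m)) atTop (𝓝 (((p : ℝ) / q) ^ (-β))) :=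
    fun p q hp hq => tendsto_ratio_of_isEquivalent hΓ hL htail hp hq
  have ha0 := tendsto_zero_of_tendsto_ratio hpos hanti hβ0 hrv
  have h00' : u' 0 * a' 0 = 1 := by simpa using hren' 0
  have ha0' : 0 < a' 0 := lt_of_le_of_ne (ha' 0).1 fun h => by simp [← h] at h00'
  have hu0' : 0 < u' 0 := lt_of_le_of_ne (hu' 0).1 fun h => by simp [← h] at h00'
  have hx : ∀ k : ℕ, 1 ≤ k → ∀ᶠ n : ℕ in atTop, expInv n ^ k ∈ Set.Ioo (0 : ℝ) 1 := by
    intro k hk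
    filter_upwards [eventually_ge_atTop 1] with n hn
    exact ⟨pow_pos (expInv_pos _) _,
      pow_lt_one₀ (expInv_pos _).le (expInv_lt_one hn) (by omega)⟩
  -- asymptotics of the generating functions of the tails
  have hT : ∀ k : ℕ, 1 ≤ k →
      Tendsto (fun n : ℕ => genFun a (expInv n ^ k) * (1 - expInv n ^ k) / a n) atTop
        (𝓝 ((k : ℝ) ^ β * Real.Gamma (1 - β))) := fun k hk =>
    tendsto_genFun_mul_div ha hpos hanti hβ0 hβ1 hrv hk
  have hT' : ∀ k : ℕ, 1 ≤ k →
      Tendsto (fun n : ℕ => genFun a' (expInv n ^ k) * (1 - expInv n ^ k) / a n) atTop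
        (𝓝 ((k : ℝ) ^ β * Real.Gamma (1 - β) / c)) := by
    intro k hk
    -- U = 1 / (A (1-r)), and A (1-r) is of the order of `a n`, which tends to zero.
    have hdiv : Tendsto (fun n => genFun u (expInv n ^ k)) atTop atTop := by
      have h1 := (hT k hk).mul ha0
      rw [mul_zero] at h1
      have h2 : Tendsto (fun n => (genFun a (expInv n ^ k) * (1 - expInv n ^ k) / a n * a n)⁻¹)
          atTop atTop := by
        refine tendsto_inv_nhdsGT_zero.comp (tendsto_nhdsWithin_iff.2 ⟨h1, ?_⟩)
        filter_upwards [hx k hk] with n hn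
        rw [div_mul_cancel₀ _ (hpos n).ne']
        exact mul_pos (genFun_pos ha (hpos 0) hn.1.le hn.2) (by linarith [hn.2])
      refine h2.congr' ?_
      filter_upwards [hx k hk] with n hn
      rw [div_mul_cancel₀ _ (hpos n).ne']
      exact (eq_inv_of_mul_eq_one_left (genFun_mul_genFun ha hu hren hn.1.le hn.2)).symm
    -- A' (1-r) = 1/U' = (A (1-r)) / (U'/U), and U'/U → c.
    have h1 := (hT k hk).div (tendsto_genFun_div_genFun hu hu' hcs hc (hx k hk) hdiv) hc0.ne'
    refine h1.congr' ?_
    filter_upwards [hx k hk] with n hn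
    have e1 := genFun_mul_genFun ha hu hren hn.1.le hn.2
    have e2 := genFun_mul_genFun ha' hu' hren' hn.1.le hn.2
    simp only [Pi.div_apply]
    have e3 : genFun u (expInv n ^ k) ≠ 0 := fun h => by simp [h] at e1
    have e4 : genFun u' (expInv n ^ k) ≠ 0 := fun h => by simp [h] at e2
    rw [eq_inv_of_mul_eq_one_right e1, eq_inv_of_mul_eq_one_right e2]
    have := (hpos n).ne'
    field_simp
  have hT1' : Tendsto (fun n : ℕ => genFun a' (expInv n) * (1 - expInv n) / a n) atTop
        (𝓝 (Real.Gamma (1 - β) / c)) := by simpa using hT' 1 le_rfl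
  have hTr' : ∀ k : ℕ, 1 ≤ k → Tendsto (fun n : ℕ =>
      (genFun a' (expInv n ^ k) * (1 - expInv n ^ k)) / (genFun a' (expInv n) * (1 - expInv n)))
      atTop (𝓝 ((k : ℝ) ^ β)) := by
    intro k hk
    have h1 := (hT' k hk).div hT1' (by positivity)
    rw [div_div_div_cancel_right₀ hc0.ne', mul_div_cancel_right₀ _ hΓ.ne'] at h1
    refine h1.congr fun n => ?_
    simp only [Pi.div_apply]
    rw [div_div_div_cancel_right₀ (hpos n).ne']
  have hone := tendsto_natCast_mul_one_sub_expInv_pow 1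
  simp only [pow_one, Nat.cast_one] at hone
  -- the tails
  have hrva : ∀ k : ℕ, 1 ≤ k → Tendsto (fun n => genFun a' (expInv n ^ k) / genFun a' (expInv n))
      atTop (𝓝 ((k : ℝ) ^ (-(1 - β)))) := by
    intro k hk
    have hk' : (0 : ℝ) < k := by exact_mod_cast hk
    have h1 := (hTr' k hk).mul (hone.div (tendsto_natCast_mul_one_sub_expInv_pow k) hk'.ne')
    -- The factor (1-r) / (1-r^k) → 1/k shifts the index, so A' is regularly varying of index ρ = 1
    -- - β at 1.
    have e : (k : ℝ) ^ β * (1 / k) = (k : ℝ) ^ (-(1 - β)) := by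
      rw [neg_sub, Real.rpow_sub hk', Real.rpow_one]; ring
    rw [e] at h1
    refine h1.congr' ?_
    filter_upwards [hx k hk, eventually_ge_atTop 1] with n hn hn1
    have h2 : 0 < genFun a' (expInv n) :=
      genFun_pos ha' ha0' (expInv_pos n).le (expInv_lt_one hn1)
    have h3 : 1 - expInv n ≠ 0 := by linarith [expInv_lt_one hn1]
    have h4 : 1 - expInv n ^ k ≠ 0 := by linarith [hn.2]
    have h5 : (n : ℝ) ≠ 0 := by positivity
    simp only [Pi.div_apply]
    field_simp
  have hratio : Tendsto (fun n => a' n / a n) atTop (𝓝 (1 / c)) := by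
    -- n a' n / A'(r) → 1/Γ(1-β), A'(r) (1-r) / a n → Γ(1-β)/c and n (1-r) → 1. The Gamma factors
    -- cancel and a' n / a n → 1/c.
    have h1 := ((tendsto_coeff_div_genFun ha' ha0' hanti' (by linarith : 0 < 1 - β) hrva).mul
      hT1').div hone one_ne_zero
    have e : 1 / Real.Gamma (1 - β) * (Real.Gamma (1 - β) / c) / 1 = 1 / c := by field_simp
    rw [e] at h1
    refine h1.congr' ?_
    filter_upwards [eventually_ge_atTop 1] with n hn1
    have h2 : 0 < genFun a' (expInv n) :=
      genFun_pos ha' ha0' (expInv_pos n).le (expInv_lt_one hn1)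
    have h3 : 1 - expInv n ≠ 0 := by linarith [expInv_lt_one hn1]
    have h5 : (n : ℝ) ≠ 0 := by positivity
    have h6 := (hpos n).ne'
    simp only [Pi.div_apply]
    field_simp
  -- the renewal function
  have hrvu : ∀ k : ℕ, 1 ≤ k → Tendsto (fun n => genFun u' (expInv n ^ k) / genFun u' (expInv n))
      atTop (𝓝 ((k : ℝ) ^ (-β))) := by
    intro k hk
    have hk' : (0 : ℝ) < k := by exact_mod_cast hk
    have h1 := (hTr' k hk).inv₀ (by positivity)
    rw [← Real.rpow_neg hk'.le] at h1
    refine h1.congr' ?_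
    filter_upwards [hx k hk, hx 1 le_rfl] with n hn hn1
    rw [pow_one] at hn1
    rw [eq_inv_of_mul_eq_one_left (genFun_mul_genFun ha' hu' hren' hn.1.le hn.2),
      eq_inv_of_mul_eq_one_left (genFun_mul_genFun ha' hu' hren' hn1.1.le hn1.2), inv_div_inv,
      inv_div]
  set V : ℕ → ℝ := fun n => ∑ j ∈ Finset.range (n + 1), u' (j + 1) with hV
  have hS : Tendsto (fun n : ℕ => V n * a n) atTop
      (𝓝 (c / (Real.Gamma (1 + β) * Real.Gamma (1 - β)))) := by
    have h1 := (tendsto_partialSum_div_genFun hu' hu0' hβ0 hrvu one_pos).div hT1' (by positivity)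
    -- The sum `V` starts at u' 1, because u' 0 = 1 stands for the start in the atom and not for a
    -- visit of the chain with initial law ν. The index shift changes the partial sum by a bounded
    -- amount, killed by a n → 0.
    have h2 : Tendsto (fun n : ℕ => (u' (n + 1) - u' 0) * a n) atTop (𝓝 0) := by
      refine squeeze_zero_norm (fun n => ?_) ha0
      rw [norm_mul, Real.norm_of_nonneg (hpos n).le]
      refine mul_le_of_le_one_left (hpos n).le ?_
      rw [Real.norm_eq_abs, abs_le]
      constructor <;> linarith [(hu' 0).1, (hu' 0).2, (hu' (n + 1)).1, (hu' (n + 1)).2]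
    have h3 := h1.add h2
    rw [Real.one_rpow, add_zero, div_div_div_eq, one_mul] at h3
    refine h3.congr' ?_
    filter_upwards [hx 1 le_rfl] with n hn1
    rw [pow_one] at hn1
    have e1 := genFun_mul_genFun ha' hu' hren' hn1.1.le hn1.2
    have e2 : genFun u' (expInv n) ≠ 0 := fun h => by simp [h] at e1
    have hVn : V n = ∑ j ∈ Finset.range (n + 1), u' j + (u' (n + 1) - u' 0) := by
      have e3 := Finset.sum_range_succ u' (n + 1)
      have e4 := Finset.sum_range_succ' u' (n + 1)
      simp only [hV]
      linarith
    simp only [Pi.div_apply, one_mul, Nat.floor_natCast]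
    rw [eq_inv_of_mul_eq_one_right e1, hVn]
    have := (hpos n).ne'
    field_simp
  refine ⟨?_, ?_, ?_⟩
  · rw [Asymptotics.isEquivalent_iff_tendsto_one]
    · have h1 := (hratio.mul htail1).mul_const c
      rw [mul_one, one_div_mul_cancel hc0.ne'] at h1
      refine h1.congr' ?_
      filter_upwards [hLpos, eventually_ge_atTop 1] with n hn hn1
      have h5 : (0 : ℝ) < n := by exact_mod_cast hn1
      have h6 := (hpos n).ne'
      have h7 := Real.rpow_pos_of_pos h5 β
      simp only [Pi.div_apply]
      field_simp
    · filter_upwards [hLpos, eventually_ge_atTop 1] with n hn hn1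
      have h5 : (0 : ℝ) < n := by exact_mod_cast hn1
      positivity
  · rw [Asymptotics.isEquivalent_iff_tendsto_one]
    · have h1 := (hS.div htail1 one_ne_zero).mul_const
        (Real.Gamma (1 + β) * Real.Gamma (1 - β) / c)
      rw [div_one, div_mul_div_cancel₀ (by positivity), div_self hc0.ne'] at h1
      refine h1.congr' ?_
      filter_upwards [hLpos, eventually_ge_atTop 1] with n hn hn1
      have h5 : (0 : ℝ) < n := by exact_mod_cast hn1
      have h6 := (hpos n).ne'
      have h7 := Real.rpow_pos_of_pos h5 β
      simp only [Pi.div_apply]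
      field_simp
    · filter_upwards [hLpos, eventually_ge_atTop 1] with n hn hn1
      have h5 : (0 : ℝ) < n := by exact_mod_cast hn1
      positivity
  · have h1 : Tendsto (fun n => (a n)⁻¹) atTop atTop :=
      tendsto_inv_nhdsGT_zero.comp (tendsto_nhdsWithin_iff.2 ⟨ha0, Eventually.of_forall hpos⟩)
    refine (hS.pos_mul_atTop (by positivity) h1).congr fun n => ?_
    rw [mul_assoc, mul_inv_cancel₀ (hpos n).ne', mul_one]

/-! ### Path space and the Markov property -/

section Path

variable {E : Type*} [MeasurableSpace E]

/-- The canonical filtration on path space. -/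
abbrev pathFiltration (E : Type*) [MeasurableSpace E] :
    Filtration ℕ (MeasurableSpace.pi : MeasurableSpace (ℕ → E)) :=
  Filtration.piLE (X := fun _ : ℕ => E)

lemma pathFiltration_eq (n : ℕ) : pathFiltration E n
    = MeasurableSpace.pi.comap (Preorder.frestrictLe (π := fun _ : ℕ => E) n) :=
  Filtration.piLE_eq_comap_frestrictLe n

lemma measurable_eval_pathFiltration {n j : ℕ} (h : j ≤ n) :
    Measurable[pathFiltration E n] fun ω : ℕ → E => ω j := by
  rw [pathFiltration_eq]
  have h1 : Measurable fun y : (Π _ : Finset.Iic n, E) => y ⟨j, Finset.mem_Iic.2 h⟩ :=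
    measurable_pi_apply _
  exact h1.comp (comap_measurable _)

/-- The shift on path space. -/
def pathShift {F : Type*} (n : ℕ) (ω : ℕ → F) : ℕ → F := fun k => ω (n + k)

lemma measurable_pathShift (n : ℕ) : Measurable (pathShift (F := E) n) :=
  measurable_pi_lambda _ fun _ => measurable_pi_apply _

lemma measurableSet_pathShift_preimage {n m : ℕ} {B : Set (ℕ → E)}
    (hB : MeasurableSet[pathFiltration E m] B) :
    MeasurableSet[pathFiltration E (n + m)] (pathShift n ⁻¹' B) := by
  rw [pathFiltration_eq] at hB
  obtain ⟨T, hT, rfl⟩ := hB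
  rw [← Set.preimage_comp]
  have : @Measurable _ _ (pathFiltration E (n + m)) _
      (Preorder.frestrictLe (π := fun _ : ℕ => E) m ∘ pathShift n) :=
    @measurable_pi_lambda _ _ _ (pathFiltration E (n + m)) _ _ fun i =>
      measurable_eval_pathFiltration (by have := Finset.mem_Iic.1 i.2; omega)
  exact this hT

/-- The Markov property of a measure on path space. -/
def HasMarkovProperty (P : Kernel E E) (M : Measure (ℕ → E)) : Prop :=
  ∀ (n : ℕ) (B : Set (ℕ → E)) (A : Set E), MeasurableSet[pathFiltration E n] B → MeasurableSet A →
    M (B ∩ {ω | ω (n + 1) ∈ A}) = ∫⁻ ω in B, P (ω n) A ∂M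

/-- A finite measure on path space with the Markov property is determined by its initial law. -/
theorem HasMarkovProperty.ext {P : Kernel E E} {M M' : Measure (ℕ → E)} [IsFiniteMeasure M]
    [IsFiniteMeasure M'] (h : HasMarkovProperty P M) (h' : HasMarkovProperty P M')
    (h0 : M.map (fun ω => ω 0) = M'.map (fun ω => ω 0)) : M = M' := by
  -- Finite-dimensional laws agree by induction: the Markov property expresses the joint law of the
  -- history and the next state, on rectangles, through the law of the history alone. Projective
  -- limits are unique.
  have key : ∀ n, M.map (Preorder.frestrictLe (π := fun _ : ℕ => E) n)
      = M'.map (Preorder.frestrictLe (π := fun _ : ℕ => E) n) := by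
    intro n
    induction n with
    | zero =>
      have hf : Measurable fun (x : E) (_ : Finset.Iic 0) => x :=
        measurable_pi_lambda _ fun _ => measurable_id
      have heq : Preorder.frestrictLe (π := fun _ : ℕ => E) 0
          = (fun (x : E) (_ : Finset.Iic 0) => x) ∘ fun ω : ℕ → E => ω 0 := by
        funext ω i
        obtain ⟨i, hi⟩ := i
        have : i = 0 := by simpa using hi
        subst this
        rfl
      rw [heq, ← Measure.map_map hf (measurable_pi_apply 0), h0,
        Measure.map_map hf (measurable_pi_apply 0)]
    | succ n ih =>
      have hpm : Measurable fun ω : ℕ → E =>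
          (Preorder.frestrictLe (π := fun _ : ℕ => E) n ω, ω (n + 1)) := by fun_prop
      have hpair : M.map (fun ω => (Preorder.frestrictLe (π := fun _ : ℕ => E) n ω, ω (n + 1)))
          = M'.map (fun ω => (Preorder.frestrictLe (π := fun _ : ℕ => E) n ω, ω (n + 1))) := by
        refine Measure.ext_prod fun {T A} hT hA => ?_
        have hB : MeasurableSet[pathFiltration E n]
            (Preorder.frestrictLe (π := fun _ : ℕ => E) n ⁻¹' T) := by
          rw [pathFiltration_eq]; exact ⟨T, hT, rfl⟩
        rw [Measure.map_apply hpm (hT.prod hA), Measure.map_apply hpm (hT.prod hA)]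
        have e1 := h n _ A hB hA
        have e2 := h' n _ A hB hA
        have hmk : Measurable fun y : (Π _ : Finset.Iic n, E) =>
            P (y ⟨n, Finset.mem_Iic.2 le_rfl⟩) A :=
          (P.measurable_coe hA).comp (measurable_pi_apply _)
        have e3 : ∀ N : Measure (ℕ → E),
            ∫⁻ ω in Preorder.frestrictLe (π := fun _ : ℕ => E) n ⁻¹' T, P (ω n) A ∂N
            = ∫⁻ y in T, P (y ⟨n, Finset.mem_Iic.2 le_rfl⟩) A
              ∂(N.map (Preorder.frestrictLe (π := fun _ : ℕ => E) n)) := fun N => by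
          rw [setLIntegral_map hT hmk (by fun_prop)]
          rfl
        rw [e3] at e1 e2
        rw [ih] at e1
        exact e1.trans e2.symm
      set glue : (Π _ : Finset.Iic n, E) × E → (Π _ : Finset.Iic (n + 1), E) := fun p i =>
        if hi : i.1 ≤ n then p.1 ⟨i.1, Finset.mem_Iic.2 hi⟩ else p.2 with hglue
      have hgm : Measurable glue := by
        refine measurable_pi_lambda _ fun i => ?_
        by_cases hi : i.1 ≤ n
        · simp only [hglue, hi, dite_true]
          exact (measurable_pi_apply _).comp measurable_fst
        · simp only [hglue, hi, dite_false]
          exact measurable_snd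
      have heq : Preorder.frestrictLe (π := fun _ : ℕ => E) (n + 1)
          = glue ∘ fun ω => (Preorder.frestrictLe (π := fun _ : ℕ => E) n ω, ω (n + 1)) := by
        funext ω i
        obtain ⟨i, hi⟩ := i
        by_cases hin : i ≤ n
        · simp [hglue, hin]
        · have : i = n + 1 := by have := Finset.mem_Iic.1 hi; omega
          subst this
          simp [hglue]
      rw [heq, ← Measure.map_map hgm hpm, hpair, Measure.map_map hgm hpm]
  have hproj : IsProjectiveMeasureFamily (α := fun _ : ℕ => E)
      (fun I : Finset ℕ => M.map (Finset.restrict (π := fun _ : ℕ => E) I)) := by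
    intro I J hJI
    rw [Measure.map_map (Finset.measurable_restrict₂ (X := fun _ : ℕ => E) hJI)
      (Finset.measurable_restrict (X := fun _ : ℕ => E) I)]
    rfl
  have hl : IsProjectiveLimit (α := fun _ : ℕ => E) M
      (fun I : Finset ℕ => M.map (Finset.restrict (π := fun _ : ℕ => E) I)) :=
    fun I => rfl
  have hl' : IsProjectiveLimit (α := fun _ : ℕ => E) M'
      (fun I : Finset ℕ => M.map (Finset.restrict (π := fun _ : ℕ => E) I)) := by
    rw [isProjectiveLimit_nat_iff hproj]
    exact fun n => (key n).symm
  exact hl.unique hl'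

variable (P : Kernel E E) [IsMarkovKernel P]

/-- The law of the path as a function of the starting point. -/
def pathKernel : Kernel E (ℕ → E) :=
  (Kernel.traj (X := fun _ => E)
    (fun n => P.comap (fun h : (Π _ : Finset.Iic n, E) => h ⟨n, Finset.mem_Iic.2 le_rfl⟩)
      (measurable_pi_apply _)) 0).comap
    (MeasurableEquiv.piUnique (fun _ : Finset.Iic 0 => E)).symm
    (MeasurableEquiv.measurable _)

lemma chainLaw_eq_bind (lam : Measure E) : chainLaw P lam = lam.bind (pathKernel P) := by
  rw [chainLaw, Kernel.trajMeasure]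
  ext s hs
  rw [Measure.bind_apply hs (Kernel.aemeasurable _), Measure.bind_apply hs (Kernel.aemeasurable _),
    lintegral_map (Kernel.measurable_coe _ hs) (MeasurableEquiv.measurable _)]
  rfl

lemma chainLaw_dirac (x : E) : chainLaw P (Measure.dirac x) = pathKernel P x := by
  rw [chainLaw_eq_bind, Measure.dirac_bind (Kernel.measurable _)]

lemma chainLaw_apply (lam : Measure E) {S : Set (ℕ → E)} (hS : MeasurableSet S) :
    chainLaw P lam S = ∫⁻ x, chainLaw P (Measure.dirac x) S ∂lam := by
  simp only [chainLaw_dirac]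
  rw [chainLaw_eq_bind, Measure.bind_apply hS (Kernel.aemeasurable _)]

lemma lintegral_chainLaw (lam : Measure E) {f : (ℕ → E) → ℝ≥0∞} (hf : Measurable f) :
    ∫⁻ ω, f ω ∂(chainLaw P lam) = ∫⁻ x, ∫⁻ ω, f ω ∂(chainLaw P (Measure.dirac x)) ∂lam := by
  simp only [chainLaw_dirac]
  rw [chainLaw_eq_bind, Measure.lintegral_bind (Kernel.aemeasurable _) hf.aemeasurable]

instance (lam : Measure E) [IsProbabilityMeasure lam] : IsProbabilityMeasure (chainLaw P lam) := by
  unfold chainLaw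
  infer_instance

instance (lam : Measure E) [IsFiniteMeasure lam] : IsFiniteMeasure (chainLaw P lam) := by
  refine ⟨?_⟩
  rw [chainLaw_apply P lam .univ]
  simp

lemma measurable_chainLaw {S : Set (ℕ → E)} (hS : MeasurableSet S) :
    Measurable fun x => chainLaw P (Measure.dirac x) S := by
  simp only [chainLaw_dirac]
  exact Kernel.measurable_coe _ hS

lemma chainLaw_map_zero (lam : Measure E) : (chainLaw P lam).map (fun ω => ω 0) = lam := by
  ext A hA
  have hm : MeasurableSet ((fun ω : ℕ → E => ω 0) ⁻¹' A) := measurable_pi_apply 0 hA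
  rw [Measure.map_apply (measurable_pi_apply 0) hA, chainLaw_apply P lam hm]
  have : ∀ x, chainLaw P (Measure.dirac x) ((fun ω : ℕ → E => ω 0) ⁻¹' A)
      = A.indicator 1 x := by
    intro x
    rw [chainLaw_dirac, pathKernel, Kernel.comap_apply]
    have e := Kernel.traj_map_frestrictLe_apply (X := fun _ => E)
      (κ := fun n => P.comap (fun h : (Π _ : Finset.Iic n, E) => h ⟨n, Finset.mem_Iic.2 le_rfl⟩)
      (measurable_pi_apply _)) 0 0 ((MeasurableEquiv.piUnique (fun _ : Finset.Iic 0 => E)).symm x)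
    rw [Kernel.partialTraj_self, Kernel.id_apply] at e
    have hA' : MeasurableSet ((fun y : (Π _ : Finset.Iic 0, E) =>
      y ⟨0, Finset.mem_Iic.2 le_rfl⟩) ⁻¹' A) := measurable_pi_apply _ hA
    have e2 := congrArg (fun m => m ((fun y : (Π _ : Finset.Iic 0, E) =>
      y ⟨0, Finset.mem_Iic.2 le_rfl⟩) ⁻¹' A)) e
    rw [Measure.map_apply (by fun_prop) hA', Measure.dirac_apply' _ hA'] at e2
    exact e2
  simp only [this]
  simp [lintegral_indicator hA]

/-- Shown for point masses and then integrated over the starting point. General initial measures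
matter since restarting the chain on an event produces an unnormalised law. -/
lemma hasMarkovProperty_chainLaw (lam : Measure E) :
    HasMarkovProperty P (chainLaw P lam) := by
  have hdirac : ∀ x, HasMarkovProperty P (chainLaw P (Measure.dirac x)) := by
    intro x n B A hB hA
    rw [pathFiltration_eq] at hB
    obtain ⟨T, hT, rfl⟩ := hB
    have e := Kernel.map_frestrictLe_trajMeasure_compProd_eq_map_trajMeasure (X := fun _ => E)
      (μ₀ := Measure.dirac x) (κ := fun n => P.comap
        (fun h : (Π _ : Finset.Iic n, E) => h ⟨n, Finset.mem_Iic.2 le_rfl⟩)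
        (measurable_pi_apply _)) (a := n)
    have e2 := congrArg (fun m => m (T ×ˢ A)) e
    rw [Measure.map_apply (by fun_prop) (hT.prod hA), Measure.compProd_apply_prod hT hA,
      setLIntegral_map hT (Kernel.measurable_coe _ hA) (by fun_prop)] at e2
    exact e2.symm
  intro n B A hB hA
  have hB' := (pathFiltration E).le n _ hB
  have hA' : MeasurableSet {ω : ℕ → E | ω (n + 1) ∈ A} := measurable_pi_apply (n + 1) hA
  have hm : Measurable fun ω : ℕ → E => P (ω n) A :=
    (P.measurable_coe hA).comp (measurable_pi_apply n)
  rw [chainLaw_apply P lam (hB'.inter hA'), ← lintegral_indicator hB',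
    lintegral_chainLaw P lam (hm.indicator hB')]
  refine lintegral_congr fun x => ?_
  rw [hdirac x n B A hB hA, lintegral_indicator hB']

/-- The simple Markov property. -/
theorem chainLaw_restrict_map_pathShift (lam : Measure E) [IsFiniteMeasure lam] {n : ℕ}
    {B : Set (ℕ → E)} (hB : MeasurableSet[pathFiltration E n] B) :
    ((chainLaw P lam).restrict B).map (pathShift n)
      = chainLaw P (((chainLaw P lam).restrict B).map fun ω => ω n) := by
  have hB' := (pathFiltration E).le n _ hB
  -- The shifted restricted law inherits the Markov property, as the shifted event intersected with
  -- `B` belongs to the history up to time n + m. Uniqueness identifies it from its initial law.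
  refine HasMarkovProperty.ext (P := P) ?_ (hasMarkovProperty_chainLaw P _) ?_
  · intro m C A hC hA
    have hC' := (pathFiltration E).le m _ hC
    have hA' : ∀ k, MeasurableSet {ω : ℕ → E | ω k ∈ A} := fun k => measurable_pi_apply k hA
    have hm : Measurable fun ω : ℕ → E => P (ω m) A :=
      (P.measurable_coe hA).comp (measurable_pi_apply m)
    rw [Measure.map_apply (measurable_pathShift n) (hC'.inter (hA' _)),
      setLIntegral_map hC' hm (measurable_pathShift n),
      Measure.restrict_apply (measurable_pathShift n (hC'.inter (hA' _))),
      Measure.restrict_restrict (measurable_pathShift n hC')]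
    have hB2 : MeasurableSet[pathFiltration E (n + m)] (pathShift n ⁻¹' C ∩ B) :=
      (measurableSet_pathShift_preimage hC).inter ((pathFiltration E).mono (by omega) _ hB)
    refine Eq.trans ?_ (hasMarkovProperty_chainLaw P lam (n + m) _ A hB2 hA)
    congr 1
    ext ω
    simp only [Set.mem_inter_iff, Set.mem_preimage, Set.mem_ofPred_eq, pathShift]
    rw [← add_assoc]
    tauto
  · rw [chainLaw_map_zero, Measure.map_map (measurable_pi_apply 0) (measurable_pathShift n)]
    rfl

lemma chainLaw_inter_pathShift (lam : Measure E) [IsFiniteMeasure lam] {n : ℕ}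
    {B : Set (ℕ → E)} (hB : MeasurableSet[pathFiltration E n] B) {S : Set (ℕ → E)}
    (hS : MeasurableSet S) :
    chainLaw P lam (pathShift n ⁻¹' S ∩ B)
      = ∫⁻ ω in B, chainLaw P (Measure.dirac (ω n)) S ∂(chainLaw P lam) := by
  have h := congrArg (fun m => m S) (chainLaw_restrict_map_pathShift P lam hB)
  rw [Measure.map_apply (measurable_pathShift n) hS,
    Measure.restrict_apply (measurable_pathShift n hS), chainLaw_apply P _ hS,
    lintegral_map (measurable_chainLaw P hS) (measurable_pi_apply n)] at h
  exact h

lemma chainLaw_map_eval (x : E) (n : ℕ) :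
    (chainLaw P (Measure.dirac x)).map (fun ω => ω n) = (P ^ n) x := by
  induction n with
  | zero => rw [chainLaw_map_zero, pow_zero]; exact (Kernel.id_apply x).symm
  | succ n ih =>
    ext A hA
    rw [Measure.map_apply (measurable_pi_apply _) hA, pow_succ']
    change _ = (P ∘ₖ (P ^ n)) x A
    rw [Kernel.comp_apply' _ _ _ hA, ← ih,
      lintegral_map (P.measurable_coe hA) (measurable_pi_apply n)]
    have := hasMarkovProperty_chainLaw P (Measure.dirac x) n Set.univ A .univ hA
    rw [Set.univ_inter, Measure.restrict_univ] at this
    exact this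

lemma lintegral_chainLaw_eval (x : E) (n : ℕ) {f : E → ℝ≥0∞} (hf : Measurable f) :
    ∫⁻ ω, f (ω n) ∂(chainLaw P (Measure.dirac x)) = ∫⁻ y, f y ∂((P ^ n) x) := by
  rw [← chainLaw_map_eval, lintegral_map hf (measurable_pi_apply n)]

lemma chainLaw_pathShift (x : E) (n : ℕ) {S : Set (ℕ → E)} (hS : MeasurableSet S) :
    chainLaw P (Measure.dirac x) (pathShift n ⁻¹' S)
      = ∫⁻ y, chainLaw P (Measure.dirac y) S ∂((P ^ n) x) := by
  have := chainLaw_inter_pathShift P (Measure.dirac x) (n := n) .univ hS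
  rw [Set.inter_univ, Measure.restrict_univ] at this
  rw [this, lintegral_chainLaw_eval P x n (measurable_chainLaw P hS)]

end Path

lemma measurable_comp_eval {E : Type*} [MeasurableSpace E] {g : E → ℝ≥0∞} (hg : Measurable g)
    (n : ℕ) : Measurable fun ω : ℕ → E => g (ω n) :=
  hg.comp (measurable_pi_apply n)

/-! ### Infinitely frequent visits, bounded harmonic functions and the zero-one law -/

section Path

variable {E : Type*} [MeasurableSpace E]

/-- The paths that visit `A`. -/
def hitSet {F : Type*} (A : Set F) : Set (ℕ → F) := {ω | ∃ t, ω t ∈ A}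

/-- The paths that visit `A` infinitely often. -/
def ioSet {F : Type*} (A : Set F) : Set (ℕ → F) := {ω | ∃ᶠ t in atTop, ω t ∈ A}

lemma measurableSet_hitSet {A : Set E} (hA : MeasurableSet A) : MeasurableSet (hitSet A) := by
  have : hitSet A = ⋃ t, (fun ω : ℕ → E => ω t) ⁻¹' A := by ext ω; simp [hitSet]
  rw [this]
  exact MeasurableSet.iUnion fun t => measurable_pi_apply t hA

lemma mem_pathShift_preimage_hitSet {F : Type*} {A : Set F} {n : ℕ} {ω : ℕ → F} :
    ω ∈ pathShift n ⁻¹' hitSet A ↔ ∃ t, n ≤ t ∧ ω t ∈ A := by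
  simp only [Set.mem_preimage, hitSet, Set.mem_ofPred_eq, pathShift]
  exact ⟨fun ⟨t, ht⟩ => ⟨n + t, by omega, ht⟩,
    fun ⟨t, h1, h2⟩ => ⟨t - n, by rwa [Nat.add_sub_cancel' h1]⟩⟩

lemma ioSet_eq_iInter {F : Type*} (A : Set F) : ioSet A = ⋂ n, pathShift n ⁻¹' hitSet A := by
  ext ω
  simp only [Set.mem_iInter, mem_pathShift_preimage_hitSet]
  exact frequently_atTop

lemma antitone_pathShift_preimage_hitSet {F : Type*} (A : Set F) :
    Antitone fun n => pathShift n ⁻¹' hitSet A := by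
  intro n m hnm ω hω
  rw [mem_pathShift_preimage_hitSet] at *
  obtain ⟨t, ht, h⟩ := hω
  exact ⟨t, hnm.trans ht, h⟩

lemma measurableSet_ioSet {A : Set E} (hA : MeasurableSet A) : MeasurableSet (ioSet A) := by
  rw [ioSet_eq_iInter]
  exact MeasurableSet.iInter fun n => measurable_pathShift n (measurableSet_hitSet hA)

lemma pathShift_preimage_ioSet {F : Type*} (A : Set F) (n : ℕ) : pathShift n ⁻¹' ioSet A = ioSet A := by
  ext ω
  simp only [Set.mem_preimage, ioSet, Set.mem_ofPred_eq, pathShift, frequently_atTop]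
  constructor
  · intro h a
    obtain ⟨b, hb, hb2⟩ := h a
    exact ⟨n + b, by omega, hb2⟩
  · intro h a
    obtain ⟨b, hb, hb2⟩ := h (n + a)
    exact ⟨b - n, by omega, by rwa [Nat.add_sub_cancel' (by omega)]⟩

/-- Invariant functions along iterates. -/
lemma lintegral_pow_of_harmonic (P : Kernel E E) {g : E → ℝ≥0∞} (hg : Measurable g)
    (hharm : ∀ x, ∫⁻ y, g y ∂(P x) = g x) (n : ℕ) (x : E) : ∫⁻ y, g y ∂((P ^ n) x) = g x := by
  induction n with
  | zero =>
    rw [pow_zero]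
    change ∫⁻ y, g y ∂(Kernel.id x) = g x
    rw [Kernel.id_apply, lintegral_dirac' _ hg]
  | succ n ih =>
    rw [pow_succ']
    change ∫⁻ y, g y ∂((P ∘ₖ (P ^ n)) x) = g x
    rw [Kernel.lintegral_comp _ _ _ hg]
    simpa only [hharm] using ih

variable (P : Kernel E E) [IsMarkovKernel P]

lemma tendsto_chainLaw_hitSet {A : Set E} (hA : MeasurableSet A) (x : E) :
    Tendsto (fun n => chainLaw P (Measure.dirac x) (pathShift n ⁻¹' hitSet A)) atTop
      (𝓝 (chainLaw P (Measure.dirac x) (ioSet A))) := by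
  rw [ioSet_eq_iInter]
  exact tendsto_measure_iInter_atTop
    (fun n => (measurable_pathShift n (measurableSet_hitSet hA)).nullMeasurableSet)
    (antitone_pathShift_preimage_hitSet A) ⟨0, measure_ne_top _ _⟩

lemma setLIntegral_eval_succ {x : E} {n : ℕ} {B : Set (ℕ → E)}
    (hB : MeasurableSet[pathFiltration E n] B) {g : E → ℝ≥0∞} (hg : Measurable g) :
    ∫⁻ ω in B, g (ω (n + 1)) ∂(chainLaw P (Measure.dirac x))
      = ∫⁻ ω in B, ∫⁻ y, g y ∂(P (ω n)) ∂(chainLaw P (Measure.dirac x)) := by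
  have h := chainLaw_restrict_map_pathShift P (Measure.dirac x) hB
  have h1 : ∫⁻ ω in B, g (ω (n + 1)) ∂(chainLaw P (Measure.dirac x))
      = ∫⁻ ω, g (ω 1) ∂(((chainLaw P (Measure.dirac x)).restrict B).map (pathShift n)) := by
    rw [lintegral_map (measurable_comp_eval hg 1) (measurable_pathShift n)]
    rfl
  rw [h1, h, lintegral_chainLaw P _ (measurable_comp_eval hg 1)]
  simp only [lintegral_chainLaw_eval P _ 1 hg, pow_one]
  rw [lintegral_map hg.lintegral_kernel (measurable_pi_apply n)]

lemma integrable_toReal_eval {M : Measure (ℕ → E)} [IsFiniteMeasure M] {g : E → ℝ≥0∞}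
    (hg : Measurable g) (hg1 : ∀ x, g x ≤ 1) (n : ℕ) : Integrable (fun ω => (g (ω n)).toReal) M := by
  refine Integrable.of_bound
    (hg.ennreal_toReal.comp (measurable_pi_apply n)).aestronglyMeasurable 1 (ae_of_all _ fun ω => ?_)
  rw [Real.norm_of_nonneg ENNReal.toReal_nonneg]
  exact ENNReal.toReal_le_of_le_ofReal zero_le_one (by simpa using hg1 _)

/-- A bounded harmonic function converges along almost every path. -/
lemma ae_exists_tendsto_of_harmonic {g : E → ℝ≥0∞} (hg : Measurable g) (hg1 : ∀ x, g x ≤ 1)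
    (hharm : ∀ x, ∫⁻ y, g y ∂(P x) = g x) (x : E) :
    ∀ᵐ ω ∂(chainLaw P (Measure.dirac x)),
      ∃ c : ℝ, Tendsto (fun n => (g (ω n)).toReal) atTop (𝓝 c) := by
  have hint := fun n => integrable_toReal_eval (M := chainLaw P (Measure.dirac x)) hg hg1 n
  have hmart : Martingale (fun n (ω : ℕ → E) => (g (ω n)).toReal) (pathFiltration E)
      (chainLaw P (Measure.dirac x)) := by
    refine martingale_of_setIntegral_eq_succ (fun n => ?_) hint fun n B hB => ?_
    · exact (hg.ennreal_toReal.comp (measurable_eval_pathFiltration le_rfl)).stronglyMeasurable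
    · have hlt : ∀ y, g y < ∞ := fun y => (hg1 y).trans_lt ENNReal.one_lt_top
      rw [integral_toReal (measurable_comp_eval hg n).aemeasurable
        (ae_of_all _ fun ω => hlt _),
        integral_toReal (measurable_comp_eval hg (n + 1)).aemeasurable
        (ae_of_all _ fun ω => hlt _), setLIntegral_eval_succ P hB hg]
      simp only [hharm]
  refine hmart.submartingale.exists_ae_tendsto_of_bdd (R := 1) fun n => ?_
  refine (eLpNorm_le_of_ae_bound (C := 1) (ae_of_all _ fun ω => ?_)).trans ?_
  · rw [Real.norm_of_nonneg ENNReal.toReal_nonneg]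
    exact ENNReal.toReal_le_of_le_ofReal zero_le_one (by simpa using hg1 _)
  · simp

/-- Bounded harmonic functions of a Harris recurrent chain are constant. -/
theorem IsHarrisRecurrent.exists_const_of_harmonic {ϕ : Measure E} {P : Kernel E E}
    [IsMarkovKernel P] (hP : IsHarrisRecurrent ϕ P) {g : E → ℝ≥0∞} (hg : Measurable g)
    (hg1 : ∀ x, g x ≤ 1) (hharm : ∀ x, ∫⁻ y, g y ∂(P x) = g x) :
    ∃ c : ℝ≥0∞, ∀ x, g x = c := by
  have hgr : Measurable fun x => (g x).toReal := hg.ennreal_toReal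
  have hgr1 : ∀ x, (g x).toReal ≤ 1 := fun x =>
    ENNReal.toReal_le_of_le_ofReal zero_le_one (by simpa using hg1 _)
  -- The supremum c of `R` is the ϕ-essential supremum of g. Each of its neighbourhoods is attained
  -- on a set of positive ϕ-measure, hence visited infinitely often, so the almost sure martingale
  -- limit of g along the path must be c.
  set R : Set ℝ := {r | 0 < ϕ {x | r < (g x).toReal}} with hR
  have hRne : R.Nonempty := by
    refine ⟨-1, ?_⟩
    have : {x | (-1 : ℝ) < (g x).toReal} = Set.univ :=
      Set.eq_univ_of_forall fun x => neg_one_lt_zero.trans_le ENNReal.toReal_nonneg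
    rw [hR, Set.mem_ofPred_eq, this]
    simpa [pos_iff_ne_zero] using hP.ne_zero
  have hRbdd : BddAbove R := by
    refine ⟨1, fun r hr => ?_⟩
    by_contra h
    have : {x | r < (g x).toReal} = ∅ :=
      Set.eq_empty_of_forall_notMem fun x hx => by
        have h1 : r < (g x).toReal := hx
        linarith [hgr1 x, not_le.1 h]
    rw [hR, Set.mem_ofPred_eq, this] at hr
    simp at hr
  set c := sSup R with hc
  have hpos : ∀ ε : ℝ, 0 < ε → 0 < ϕ {x | |(g x).toReal - c| < ε} := by
    intro ε hε
    obtain ⟨r, hr, hrc⟩ := exists_lt_of_lt_csSup hRne (show c - ε < c by linarith)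
    have h1 : ϕ {x | c + ε / 2 < (g x).toReal} = 0 := by
      by_contra h
      have : c + ε / 2 ≤ c := le_csSup hRbdd (pos_iff_ne_zero.2 h)
      linarith
    by_contra h
    have h2 : ϕ {x | |(g x).toReal - c| < ε} = 0 := by simpa using h
    refine (ne_of_gt hr) (measure_mono_null ?_ (measure_union_null h1 h2))
    intro x hx
    have hx : r < (g x).toReal := hx
    by_cases hx2 : c + ε / 2 < (g x).toReal
    · exact Or.inl hx2
    · refine Or.inr ?_
      rw [Set.mem_ofPred_eq, abs_lt]
      constructor <;> linarith
  refine ⟨ENNReal.ofReal c, fun x => ?_⟩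
  have hlim : ∀ᵐ ω ∂(chainLaw P (Measure.dirac x)),
      Tendsto (fun n => (g (ω n)).toReal) atTop (𝓝 c) := by
    have h1 : ∀ k : ℕ, ∀ᵐ ω ∂(chainLaw P (Measure.dirac x)),
        ∃ᶠ t in atTop, ω t ∈ {x | |(g x).toReal - c| < 1 / ((k : ℝ) + 1)} := fun k =>
      hP.recurrent _ (measurableSet_lt (hgr.sub_const c).abs measurable_const)
        (hpos _ (by positivity)) x
    filter_upwards [ae_exists_tendsto_of_harmonic P hg hg1 hharm x, ae_all_iff.2 h1] with ω h2 h3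
    obtain ⟨l, hl⟩ := h2
    have hlc : l = c := by
      have h4 : ∀ k : ℕ, |l - c| ≤ 1 / ((k : ℝ) + 1) := by
        intro k
        by_contra h
        have h5 := ((hl.sub_const c).abs).eventually (lt_mem_nhds (not_le.1 h))
        obtain ⟨t, ht1, ht2⟩ := ((h3 k).and_eventually h5).exists
        have ht1 : |(g (ω t)).toReal - c| < 1 / ((k : ℝ) + 1) := ht1
        linarith
      have h5 := ge_of_tendsto' (tendsto_one_div_add_atTop_nhds_zero_nat (𝕜 := ℝ)) h4
      have h6 := abs_eq_zero.1 (le_antisymm h5 (abs_nonneg _))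
      linarith
    rwa [← hlc]
  -- The expectation of g at time n is g x for every n, whereas bounded convergence sends it to c.
  have hDCT := tendsto_integral_of_dominated_convergence (fun _ => (1 : ℝ))
    (fun n => (hgr.comp (measurable_pi_apply n)).aestronglyMeasurable)
    (integrable_const (μ := chainLaw P (Measure.dirac x)) 1)
    (fun n => ae_of_all _ fun ω => by
      rw [Function.comp, Real.norm_of_nonneg ENNReal.toReal_nonneg]; exact hgr1 _) hlim
  have hval : ∀ n, ∫ ω, ((fun x => (g x).toReal) ∘ fun ω : ℕ → E => ω n) ω
      ∂(chainLaw P (Measure.dirac x)) = (g x).toReal := by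
    intro n
    simp only [Function.comp]
    rw [integral_toReal (measurable_comp_eval hg n).aemeasurable
      (ae_of_all _ fun ω => (hg1 _).trans_lt ENNReal.one_lt_top),
      lintegral_chainLaw_eval P x n hg, lintegral_pow_of_harmonic P hg hharm]
  simp only [hval, integral_const, probReal_univ, one_smul] at hDCT
  rw [← tendsto_nhds_unique tendsto_const_nhds hDCT,
    ENNReal.ofReal_toReal ((hg1 x).trans_lt ENNReal.one_lt_top).ne]

lemma pi_le_iSup_pathFiltration :
    (MeasurableSpace.pi : MeasurableSpace (ℕ → E)) ≤ ⨆ n, pathFiltration E n := by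
  refine iSup_le fun n => ?_
  refine le_trans ?_ (le_iSup (fun n => (pathFiltration E n : MeasurableSpace (ℕ → E))) n)
  exact (measurable_eval_pathFiltration (E := E) le_rfl).comap_le

/-- Lévy's zero-one law for shift invariant events. -/
lemma ae_tendsto_of_invariant {S : Set (ℕ → E)} (hS : MeasurableSet S)
    (hinv : ∀ n, pathShift n ⁻¹' S = S) (x : E) :
    ∀ᵐ ω ∂(chainLaw P (Measure.dirac x)),
      Tendsto (fun n => (chainLaw P (Measure.dirac (ω n))).real S) atTop
        (𝓝 (S.indicator (fun _ => (1 : ℝ)) ω)) := by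
  set M := chainLaw P (Measure.dirac x)
  have hgint : Integrable (S.indicator fun _ => (1 : ℝ)) M := (integrable_const 1).indicator hS
  -- Invariance lets the event be read off the path after time n, so by the Markov property its
  -- conditional probability is a function of the current state.
  have hcond : ∀ n, M[S.indicator (fun _ => (1 : ℝ)) | pathFiltration E n]
      =ᵐ[M] fun ω => (chainLaw P (Measure.dirac (ω n))).real S := by
    intro n
    have hint := integrable_toReal_eval (M := M) (measurable_chainLaw P hS)
      (fun x => prob_le_one) n
    refine (ae_eq_condExp_of_forall_setIntegral_eq ((pathFiltration E).le n) hgint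
      (fun B _ _ => hint.integrableOn) (fun B hB _ => ?_) ?_).symm
    · have hB' := (pathFiltration E).le n _ hB
      rw [setIntegral_indicator hS, setIntegral_const, smul_eq_mul, mul_one]
      simp only [Measure.real]
      rw [integral_toReal (measurable_comp_eval (measurable_chainLaw P hS) n).aemeasurable
        (ae_of_all _ fun ω => measure_lt_top _ _), Set.inter_comm]
      have := chainLaw_inter_pathShift P (Measure.dirac x) hB hS
      rw [hinv] at this
      rw [this]
    · exact ((measurable_chainLaw P hS).ennreal_toReal.comp
        (measurable_eval_pathFiltration le_rfl)).stronglyMeasurable.aestronglyMeasurable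
  have hSm : StronglyMeasurable[⨆ n, pathFiltration E n] (S.indicator fun _ => (1 : ℝ)) :=
    stronglyMeasurable_const.indicator (pi_le_iSup_pathFiltration S hS)
  filter_upwards [hgint.tendsto_ae_condExp hSm, ae_all_iff.2 hcond] with ω h1 h2
  simpa only [h2] using h1

/-- If the probability of a shift invariant event does not depend on the starting point, then it
is zero or one. -/
lemma chainLaw_zero_or_one_of_const {S : Set (ℕ → E)} (hS : MeasurableSet S)
    (hinv : ∀ n, pathShift n ⁻¹' S = S) {c : ℝ≥0∞}
    (hc : ∀ x, chainLaw P (Measure.dirac x) S = c) [Nonempty E] : c = 0 ∨ c = 1 := by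
  obtain ⟨x⟩ := ‹Nonempty E›
  obtain ⟨ω, hω⟩ := (ae_tendsto_of_invariant P hS hinv x).exists
  have hct : c ≠ ∞ := hc x ▸ measure_ne_top _ _
  simp only [Measure.real, hc] at hω
  have h := tendsto_nhds_unique tendsto_const_nhds hω
  by_cases hωS : ω ∈ S
  · right
    rw [Set.indicator_of_mem hωS] at h
    rw [← ENNReal.ofReal_toReal hct, h, ENNReal.ofReal_one]
  · left
    rw [Set.indicator_of_notMem hωS] at h
    rw [← ENNReal.ofReal_toReal hct, h, ENNReal.ofReal_zero]

/-- The Markov property at time 1: invariant events have harmonic probabilities. -/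
lemma lintegral_chainLaw_of_invariant {S : Set (ℕ → E)} (hS : MeasurableSet S)
    (hinv : ∀ n, pathShift n ⁻¹' S = S) (x : E) :
    ∫⁻ y, chainLaw P (Measure.dirac y) S ∂(P x) = chainLaw P (Measure.dirac x) S := by
  have := chainLaw_pathShift P x 1 hS
  rw [hinv, pow_one] at this
  exact this.symm

end Path

/-! ### The split chain and the renewal equation of its atom -/

section Iterates

variable {E : Type*} [MeasurableSpace E] (P : Kernel E E)

lemma lintegral_pow_zero (x : E) {f : E → ℝ≥0∞} (hf : Measurable f) :
    ∫⁻ y, f y ∂((P ^ 0) x) = f x := by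
  rw [pow_zero]
  change ∫⁻ y, f y ∂(Kernel.id x) = f x
  rw [Kernel.id_apply, lintegral_dirac' _ hf]

lemma lintegral_pow_add (x : E) (m n : ℕ) {f : E → ℝ≥0∞} (hf : Measurable f) :
    ∫⁻ y, f y ∂((P ^ (m + n)) x) = ∫⁻ z, ∫⁻ y, f y ∂((P ^ n) z) ∂((P ^ m) x) := by
  rw [add_comm, Kernel.pow_add, Kernel.lintegral_comp _ _ _ hf]

instance isMarkovKernel_pow [IsMarkovKernel P] (n : ℕ) : IsMarkovKernel (P ^ n) := by
  induction n with
  | zero => rw [pow_zero]; exact inferInstanceAs (IsMarkovKernel Kernel.id)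
  | succ n ih => rw [pow_succ]; exact inferInstanceAs (IsMarkovKernel ((P ^ n) ∘ₖ P))

end Iterates

section Split

variable {E : Type*} [MeasurableSpace E] {P : Kernel E E} [IsMarkovKernel P] {s : E → ℝ≥0∞}
  {ν : Measure E}

/-- Where s x = 1 the conventional Dirac value of the residual has weight zero, and ν ≤ P x between
measures of equal mass forces equality. -/
lemma Minorizes.eq_residual_add (h : Minorizes P s ν) (x : E) :
    P x = (1 - s x) • residual P s ν h x + s x • ν := by
  have := h.prob
  have hres : residual P s ν h x
      = if s x < 1 then (1 - s x)⁻¹ • (P x - s x • ν) else Measure.dirac x := rfl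
  have hle := h.smul_le x
  have h1 := h.le_one x
  have hfin : IsFiniteMeasure (s x • ν) :=
    ⟨by simpa using h1.trans_lt ENNReal.one_lt_top⟩
  rw [hres]
  split_ifs with hs
  · have h0 : 1 - s x ≠ 0 := (tsub_pos_of_lt hs).ne'
    have h2 : 1 - s x ≠ ∞ := (lt_of_le_of_lt tsub_le_self ENNReal.one_lt_top).ne
    rw [smul_smul, ENNReal.mul_inv_cancel h0 h2, one_smul, Measure.sub_add_cancel_of_le hle]
  · have hs1 : s x = 1 := le_antisymm h1 (not_lt.1 hs)
    rw [hs1, tsub_self, zero_smul, zero_add, one_smul]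
    rw [hs1, one_smul] at hle
    exact (Measure.eq_of_le_of_measure_univ_eq hle (by simp)).symm

lemma Minorizes.lintegral_eq (h : Minorizes P s ν) (x : E) (f : E → ℝ≥0∞) :
    ∫⁻ y, f y ∂(P x)
      = (1 - s x) * ∫⁻ y, f y ∂(residual P s ν h x) + s x * ∫⁻ y, f y ∂ν := by
  conv_lhs => rw [h.eq_residual_add x]
  rw [lintegral_add_measure, lintegral_smul_measure, lintegral_smul_measure]
  rfl

/-- The probability that the split chain, started at `x` with a still undecided mark, carries no
mark up to time `n - 1`. -/
def tailFun (h : Minorizes P s ν) : ℕ → E → ℝ≥0∞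
  | 0 => fun _ => 1
  | n + 1 => fun x => (1 - s x) * ∫⁻ y, tailFun h n y ∂(residual P s ν h x)

lemma measurable_tailFun (h : Minorizes P s ν) (n : ℕ) : Measurable (tailFun h n) := by
  induction n with
  | zero => exact measurable_const
  | succ n ih => exact (measurable_const.sub h.measurable).mul ih.lintegral_kernel

lemma antitone_tailFun (h : Minorizes P s ν) (x : E) : Antitone fun n => tailFun h n x := by
  refine antitone_nat_of_succ_le fun n => ?_
  induction n generalizing x with
  | zero =>
    simp only [tailFun, lintegral_const, measure_univ, mul_one]
    exact tsub_le_self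
  | succ n ih =>
    simp only [tailFun] at *
    gcongr
    exact ih _

/-- `∫ P ^ n s dν`, the probability of being marked at time `n + 1` when starting from the
atom. -/
def atomReturn (P : Kernel E E) (s : E → ℝ≥0∞) (ν : Measure E) (n : ℕ) : ℝ≥0∞ :=
  ∫⁻ x, ∫⁻ y, s y ∂((P ^ n) x) ∂ν

lemma atomReturn_le_one (h : Minorizes P s ν) (n : ℕ) : atomReturn P s ν n ≤ 1 := by
  have := h.prob
  calc atomReturn P s ν n ≤ ∫⁻ x, ∫⁻ y, 1 ∂((P ^ n) x) ∂ν :=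
        lintegral_mono fun x => lintegral_mono fun y => h.le_one y
    _ = 1 := by simp

lemma lintegral_tailFun_le_one (h : Minorizes P s ν) (n : ℕ) : ∫⁻ x, tailFun h n x ∂ν ≤ 1 := by
  have := h.prob
  calc ∫⁻ x, tailFun h n x ∂ν ≤ ∫⁻ x, 1 ∂ν :=
        lintegral_mono fun x => antitone_tailFun h x (Nat.zero_le n)
    _ = 1 := by simp

/-- Last exit decomposition. -/
lemma tailFun_add_sum (h : Minorizes P s ν) (n : ℕ) (x : E) :
    tailFun h n x + ∑ j ∈ Finset.range n,
      (∫⁻ y, tailFun h (n - 1 - j) y ∂ν) * ∫⁻ y, s y ∂((P ^ j) x) = 1 := by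
  induction n generalizing x with
  | zero => simp [tailFun]
  | succ n ih =>
    have hm : ∀ j, Measurable fun z => ∫⁻ y, s y ∂((P ^ j) z) := fun j =>
      h.measurable.lintegral_kernel
    -- The summand j is the event that the last mark before time n occurs at time j, after which the
    -- chain regenerates from ν. For the induction the identity at n is averaged over one step;
    -- splitting P x into residual and atom in the first term alone creates the new tail and the
    -- summand j = 0.
    have h1 : ∫⁻ z, (tailFun h n z + ∑ j ∈ Finset.range n,
        (∫⁻ y, tailFun h (n - 1 - j) y ∂ν) * ∫⁻ y, s y ∂((P ^ j) z)) ∂(P x) = 1 := by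
      simp [ih]
    rw [lintegral_add_left (measurable_tailFun h n), h.lintegral_eq x,
      lintegral_finsetSum _ fun j _ => (hm j).const_mul _] at h1
    simp only [lintegral_const_mul _ (hm _)] at h1
    rw [← h1, Finset.sum_range_succ']
    simp only [Nat.add_sub_cancel, Nat.sub_zero, lintegral_pow_zero P x h.measurable]
    have h2 : ∀ j, ∫⁻ y, s y ∂((P ^ (j + 1)) x) = ∫⁻ z, ∫⁻ y, s y ∂((P ^ j) z) ∂(P x) := by
      intro j
      rw [add_comm, lintegral_pow_add P x 1 j h.measurable, pow_one]
    have h3 : ∀ j, n - (j + 1) = n - 1 - j := fun j => by omega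
    have h4 : ∑ k ∈ Finset.range n, (∫⁻ y, tailFun h (n - (k + 1)) y ∂ν) *
          ∫⁻ y, s y ∂((P ^ (k + 1)) x)
        = ∑ k ∈ Finset.range n, (∫⁻ y, tailFun h (n - 1 - k) y ∂ν) *
          ∫⁻ z, ∫⁻ y, s y ∂((P ^ k) z) ∂(P x) :=
      Finset.sum_congr rfl fun k _ => by rw [h2, h3]
    rw [h4, mul_comm (∫⁻ y, tailFun h n y ∂ν) (s x), add_comm (∑ j ∈ Finset.range n, _), ← add_assoc]
    rfl

/-- The renewal sequence of the atom. -/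
def renewalSeq (P : Kernel E E) (s : E → ℝ≥0∞) (ν : Measure E) : ℕ → ℝ
  | 0 => 1
  | n + 1 => (atomReturn P s ν n).toReal

/-- The tails of the recurrence time of the atom. -/
def tailSeq (h : Minorizes P s ν) (n : ℕ) : ℝ := (∫⁻ x, tailFun h n x ∂ν).toReal

lemma toReal_mem_Icc {x : ℝ≥0∞} (hx : x ≤ 1) : x.toReal ∈ Set.Icc (0 : ℝ) 1 :=
  ⟨ENNReal.toReal_nonneg, ENNReal.toReal_le_of_le_ofReal zero_le_one (by simpa using hx)⟩

lemma renewalSeq_mem_Icc (h : Minorizes P s ν) (n : ℕ) :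
    renewalSeq P s ν n ∈ Set.Icc (0 : ℝ) 1 := by
  cases n with
  | zero => simp [renewalSeq]
  | succ n => exact toReal_mem_Icc (atomReturn_le_one h n)

lemma tailSeq_mem_Icc (h : Minorizes P s ν) (n : ℕ) : tailSeq h n ∈ Set.Icc (0 : ℝ) 1 :=
  toReal_mem_Icc (lintegral_tailFun_le_one h n)

lemma antitone_tailSeq (h : Minorizes P s ν) : Antitone (tailSeq h) := fun m _ hmn =>
  ENNReal.toReal_mono ((lintegral_tailFun_le_one h m).trans_lt ENNReal.one_lt_top).ne
    (lintegral_mono fun x => antitone_tailFun h x hmn)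

/-- The last exit decomposition averaged over ν. The event without any mark is the term k = 0, and a
last mark at time j of the chain started from ν is the term k = j + 1. -/
lemma renewal_equation (h : Minorizes P s ν) (n : ℕ) :
    ∑ k ∈ Finset.range (n + 1), renewalSeq P s ν k * tailSeq h (n - k) = 1 := by
  have := h.prob
  have hm : ∀ j, Measurable fun z => ∫⁻ y, s y ∂((P ^ j) z) := fun j =>
    h.measurable.lintegral_kernel
  have h1 : ∫⁻ z, (tailFun h n z + ∑ j ∈ Finset.range n,
      (∫⁻ y, tailFun h (n - 1 - j) y ∂ν) * ∫⁻ y, s y ∂((P ^ j) z)) ∂ν = 1 := by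
    simp [tailFun_add_sum h]
  rw [lintegral_add_left (measurable_tailFun h n),
    lintegral_finsetSum _ fun j _ => (hm j).const_mul _] at h1
  simp only [lintegral_const_mul _ (hm _)] at h1
  have hfin : ∀ n, ∫⁻ x, tailFun h n x ∂ν ≠ ∞ := fun n =>
    ((lintegral_tailFun_le_one h n).trans_lt ENNReal.one_lt_top).ne
  have hfin' : ∀ n, ∫⁻ x, ∫⁻ y, s y ∂((P ^ n) x) ∂ν ≠ ∞ := fun n =>
    ((atomReturn_le_one h n).trans_lt ENNReal.one_lt_top).ne
  have h2 := congrArg ENNReal.toReal h1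
  rw [ENNReal.toReal_add (hfin n) (ENNReal.sum_ne_top.2 fun j _ => ENNReal.mul_ne_top (hfin _)
    (hfin' _)), ENNReal.toReal_sum fun j _ => ENNReal.mul_ne_top (hfin _) (hfin' _)] at h2
  simp only [ENNReal.toReal_mul, ENNReal.toReal_one] at h2
  rw [Finset.sum_range_succ', add_comm, ← h2]
  congr 1
  · simp [renewalSeq, tailSeq]
  · refine Finset.sum_congr rfl fun k hk => ?_
    rw [mul_comm]
    have : n - (k + 1) = n - 1 - k := by omega
    rw [this]
    rfl

/-- The paths of the split chain without a mark at the times `1, …, n`. -/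
def unmarkedSet (E : Type*) (n : ℕ) : Set (ℕ → E × Bool) :=
  {ω | ∀ t, 1 ≤ t → t ≤ n → (ω t).2 = false}

lemma lt_recurrenceTime_iff {F : Type*} (n : ℕ) (ω : ℕ → F × Bool) :
    (n : ℕ∞) < recurrenceTime ω ↔ ω ∈ unmarkedSet F n := by
  constructor
  · intro h t h1 h2
    by_contra h3
    have h4 : recurrenceTime ω ≤ (t : ℕ∞) :=
      iInf₂_le t ⟨h1, by simpa using h3⟩
    have h5 : (t : ℕ∞) ≤ n := by exact_mod_cast h2
    exact absurd (h4.trans h5) (not_le.2 h)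
  · intro h
    refine lt_of_lt_of_le (b := ((n + 1 : ℕ) : ℕ∞)) (by exact_mod_cast Nat.lt_succ_self n) ?_
    refine le_iInf₂ fun t ht => ?_
    have : n + 1 ≤ t := by
      by_contra h3
      have := h t ht.1 (by omega)
      rw [ht.2] at this
      exact absurd this (by simp)
    exact_mod_cast this

lemma measurableSet_unmarkedSet (n : ℕ) : MeasurableSet (unmarkedSet E n) := by
  have : unmarkedSet E n = ⋂ t, ⋂ (_ : 1 ≤ t), ⋂ (_ : t ≤ n),
      {ω : ℕ → E × Bool | (ω t).2 = false} := by
    ext ω; simp [unmarkedSet]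
  rw [this]
  refine MeasurableSet.iInter fun t => MeasurableSet.iInter fun _ => MeasurableSet.iInter fun _ => ?_
  exact (measurable_snd.comp (measurable_pi_apply t)) (measurableSet_singleton false)

lemma chainLaw_dirac_inter_zero {F : Type*} [MeasurableSpace F] (K : Kernel F F)
    [IsMarkovKernel K] (z : F) {B : Set F} (hB : MeasurableSet B) {S : Set (ℕ → F)} :
    chainLaw K (Measure.dirac z) ({ω | ω 0 ∈ B} ∩ S)
      = B.indicator (fun z => chainLaw K (Measure.dirac z) S) z := by
  have hB0 : MeasurableSet {ω : ℕ → F | ω 0 ∈ B} := measurable_pi_apply 0 hB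
  have hlaw : chainLaw K (Measure.dirac z) {ω | ω 0 ∈ B} = Measure.dirac z B := by
    conv_rhs => rw [← chainLaw_map_zero K (Measure.dirac z)]
    rw [Measure.map_apply (measurable_pi_apply 0) hB]
    rfl
  rw [Measure.dirac_apply' _ hB] at hlaw
  by_cases hz : z ∈ B
  · rw [Set.indicator_of_mem hz] at hlaw ⊢
    have h0 : chainLaw K (Measure.dirac z) {ω | ω 0 ∈ B}ᶜ = 0 :=
      (prob_compl_eq_zero_iff hB0).2 hlaw
    rw [Set.inter_comm]
    exact measure_inter_conull h0
  · rw [Set.indicator_of_notMem hz] at hlaw ⊢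
    exact measure_mono_null Set.inter_subset_left hlaw

lemma lintegral_splitMark {P : Kernel E E} (h : Minorizes P s ν) (x : E) {f : E × Bool → ℝ≥0∞}
    (hf : Measurable f) :
    ∫⁻ z, f z ∂(splitMark P s ν h x) = s x * f (x, true) + (1 - s x) * f (x, false) := by
  change ∫⁻ z, f z ∂(s x • Measure.dirac (x, true) + (1 - s x) • Measure.dirac (x, false)) = _
  rw [lintegral_add_measure, lintegral_smul_measure, lintegral_smul_measure,
    lintegral_dirac' _ hf, lintegral_dirac' _ hf]
  rfl

/-- First step analysis, with the step divided into the move and the subsequent toss of the mark: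
only the outcome `false`, of probability 1 - s y, survives. -/
lemma chainLaw_unmarkedSet_succ (h : Minorizes P s ν) (n : ℕ) (z : E × Bool) :
    chainLaw (splitKernel P s ν h) (Measure.dirac z) (unmarkedSet E (n + 1))
      = ∫⁻ y, (1 - s y) * chainLaw (splitKernel P s ν h) (Measure.dirac (y, false))
          (unmarkedSet E n) ∂(splitMove P s ν h z) := by
  set B : Set (E × Bool) := {z | z.2 = false}
  have hB : MeasurableSet B := measurable_snd (measurableSet_singleton false)
  have hset : unmarkedSet E (n + 1) = pathShift 1 ⁻¹' ({ω | ω 0 ∈ B} ∩ unmarkedSet E n) := by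
    ext ω
    simp only [unmarkedSet, Set.mem_preimage, Set.mem_inter_iff, Set.mem_ofPred_eq, pathShift, B]
    constructor
    · exact fun hω => ⟨hω 1 le_rfl (by omega), fun t h1 h2 => hω (1 + t) (by omega) (by omega)⟩
    · rintro ⟨h1, h2⟩ t ht1 ht2
      obtain ⟨k, rfl⟩ := Nat.exists_eq_add_of_le ht1
      rcases Nat.eq_zero_or_pos k with rfl | hk
      · exact h1
      · exact h2 k hk (by omega)
  have hm := measurableSet_unmarkedSet (E := E) n
  have hB0 : MeasurableSet {ω : ℕ → E × Bool | ω 0 ∈ B} := measurable_pi_apply 0 hB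
  rw [hset, chainLaw_pathShift _ _ _ (hB0.inter hm), pow_one]
  simp only [chainLaw_dirac_inter_zero _ _ hB]
  have hmeas := (measurable_chainLaw (splitKernel P s ν h) hm).indicator hB
  have hk : splitKernel P s ν h z = (splitMark P s ν h ∘ₖ splitMove P s ν h) z := rfl
  rw [hk, Kernel.lintegral_comp _ _ _ hmeas]
  refine lintegral_congr fun y => ?_
  rw [lintegral_splitMark h y hmeas]
  simp [B]

/-- The factor 1 - s x restores the toss of the mark at time 0, which `tailFun` counts and
`unmarkedSet` does not; hence the index n + 1. -/
lemma one_sub_mul_chainLaw_unmarkedSet (h : Minorizes P s ν) (n : ℕ) (x : E) :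
    (1 - s x) * chainLaw (splitKernel P s ν h) (Measure.dirac (x, false)) (unmarkedSet E n)
      = tailFun h (n + 1) x := by
  induction n generalizing x with
  | zero =>
    have : unmarkedSet E 0 = Set.univ :=
      Set.eq_univ_of_forall fun ω t h1 h2 => absurd h1 (by omega)
    rw [this]
    simp [tailFun]
  | succ n ih =>
    rw [chainLaw_unmarkedSet_succ]
    simp only [ih]
    rfl

/-- The tails of the recurrence time of the atom under the law of the split chain. -/
theorem chainLaw_real_lt_recurrenceTime (h : Minorizes P s ν) (n : ℕ) (x : E) :
    (chainLaw (splitKernel P s ν h) (Measure.dirac (x, true))).real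
      {ω | (n : ℕ∞) < recurrenceTime ω} = tailSeq h n := by
  have := h.prob
  have hset : {ω : ℕ → E × Bool | (n : ℕ∞) < recurrenceTime ω} = unmarkedSet E n :=
    Set.ext fun ω => lt_recurrenceTime_iff n ω
  rw [hset, Measure.real, tailSeq]
  congr 1
  cases n with
  | zero =>
    have : unmarkedSet E 0 = Set.univ :=
      Set.eq_univ_of_forall fun ω t h1 h2 => absurd h1 (by omega)
    rw [this]
    simp [tailFun]
  | succ n =>
    rw [chainLaw_unmarkedSet_succ]
    simp only [one_sub_mul_chainLaw_unmarkedSet]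
    rfl

end Split

/-! ### Recurrence from a divergent renewal function -/

/-- If the expected number of visits to an atom, starting from the atom, is infinite, then no set
that is reached from the atom with positive probability is transient from every point. -/
theorem exists_chainLaw_ioSet_ne_zero {E : Type*} [MeasurableSpace E] {P : Kernel E E}
    [IsMarkovKernel P] {s : E → ℝ≥0∞} {ν : Measure E} (h : Minorizes P s ν)
    (hdiv : ∀ C : ℝ≥0∞, C ≠ ∞ → ∃ T, C < ∑ t ∈ Finset.range T, atomReturn P s ν t)
    {A : Set E} (hA : MeasurableSet A) {n : ℕ} (hn : 0 < ∫⁻ x, (P ^ n) x A ∂ν) :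
    ∃ x, chainLaw P (Measure.dirac x) (ioSet A) ≠ 0 := by
  by_contra! hcon
  have := h.prob
  have hH := measurableSet_hitSet hA
  set q : E → ℝ≥0∞ := fun x => chainLaw P (Measure.dirac x) (hitSet A) with hq
  have hqm : Measurable q := measurable_chainLaw P hH
  have hq1 : ∀ x, q x ≤ 1 := fun x => prob_le_one
  have hPq : ∀ t x, ∫⁻ y, q y ∂((P ^ t) x)
      = chainLaw P (Measure.dirac x) (pathShift t ⁻¹' hitSet A) := fun t x =>
    (chainLaw_pathShift P x t hH).symm
  have hPq1 : ∀ x, ∫⁻ y, q y ∂(P x) ≤ q x := by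
    intro x
    have h1 := hPq 1 x
    rw [pow_one] at h1
    rw [h1]
    exact measure_mono fun ω ⟨t, ht⟩ => ⟨1 + t, ht⟩
  have hPm : Measurable fun x => ∫⁻ y, q y ∂(P x) := hqm.lintegral_kernel
  -- The hitting probability q is superharmonic, and its charge `w` is the probability of being in
  -- `A` now and never again. If infinitely many visits have probability zero, then P^T q → 0 and q
  -- is the potential of `w`.
  set w : E → ℝ≥0∞ := fun x => q x - ∫⁻ y, q y ∂(P x) with hw
  have hwm : Measurable w := hqm.sub hPm
  have hqw : ∀ x, q x = ∫⁻ y, q y ∂(P x) + w x := fun x => (add_tsub_cancel_of_le (hPq1 x)).symm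
  -- telescoping
  have htel : ∀ T x, q x = ∫⁻ y, q y ∂((P ^ T) x)
      + ∑ t ∈ Finset.range T, ∫⁻ y, w y ∂((P ^ t) x) := by
    intro T x
    induction T with
    | zero => rw [lintegral_pow_zero P x hqm]; simp
    | succ T ih =>
      rw [Finset.sum_range_succ, lintegral_pow_add P x T 1 hqm, pow_one,
        add_comm (∑ t ∈ Finset.range T, _), ← add_assoc, ← lintegral_add_left hPm]
      simp only [← hqw]
      exact ih
  have hwν : ∀ t, Measurable fun x => ∫⁻ y, w y ∂((P ^ t) x) := fun t => hwm.lintegral_kernel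
  have htelν : ∀ T, ∫⁻ x, q x ∂ν = ∫⁻ x, ∫⁻ y, q y ∂((P ^ T) x) ∂ν
      + ∑ t ∈ Finset.range T, ∫⁻ x, ∫⁻ y, w y ∂((P ^ t) x) ∂ν := by
    intro T
    rw [← lintegral_finsetSum _ fun t _ => hwν t, ← lintegral_add_right _
      (Finset.measurable_sum _ fun t _ => hwν t)]
    exact lintegral_congr (htel T)
  have hqν : ∫⁻ x, q x ∂ν ≠ 0 := by
    refine (hn.trans_le (lintegral_mono fun x => ?_)).ne'
    simp only [hq]
    rw [← chainLaw_map_eval, Measure.map_apply (measurable_pi_apply n) hA]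
    exact measure_mono fun ω hω => ⟨n, hω⟩
  have hlim : Tendsto (fun T => ∫⁻ x, ∫⁻ y, q y ∂((P ^ T) x) ∂ν) atTop (𝓝 0) := by
    have := tendsto_lintegral_of_dominated_convergence (μ := ν)
      (F := fun T x => ∫⁻ y, q y ∂((P ^ T) x)) (f := fun _ => 0) (fun _ => 1)
      (fun T => hqm.lintegral_kernel)
      (fun T => ae_of_all _ fun x => (hPq T x).trans_le prob_le_one) (by simp)
      (ae_of_all _ fun x => by
        have h1 := tendsto_chainLaw_hitSet P hA x
        rw [hcon x] at h1
        simpa only [hPq] using h1)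
    simpa using this
  -- The set is reached from ν with positive probability, so the potential of `w` has positive
  -- ν-integral and one of its terms is nonzero.
  obtain ⟨j, hj⟩ : ∃ j, ∫⁻ x, ∫⁻ y, w y ∂((P ^ j) x) ∂ν ≠ 0 := by
    by_contra! h0
    refine hqν (tendsto_nhds_unique tendsto_const_nhds (hlim.congr fun T => ?_))
    rw [htelν T]
    simp [h0]
  set η := ∫⁻ x, ∫⁻ y, w y ∂((P ^ j) x) ∂ν with hη
  have hbound : ∀ T, (∑ t ∈ Finset.range T, atomReturn P s ν t) * η ≤ 1 := by
    intro T
    -- By P ≥ s ⊗ ν, a mark at time t restarts the chain from ν at time t + 1, and j further steps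
    -- collect η. Summing over t bounds the expected number of returns by 1/η.
    have hterm : ∀ t, atomReturn P s ν t * η ≤ ∫⁻ x, ∫⁻ y, w y ∂((P ^ (t + 1 + j)) x) ∂ν := by
      intro t
      have hsm : Measurable fun x => ∫⁻ y, s y ∂((P ^ t) x) := h.measurable.lintegral_kernel
      rw [atomReturn, ← lintegral_mul_const _ hsm]
      refine lintegral_mono fun x => ?_
      rw [add_assoc, lintegral_pow_add P x t (1 + j) hwm, ← lintegral_mul_const _ h.measurable]
      refine lintegral_mono fun y => ?_
      rw [lintegral_pow_add P y 1 j hwm, pow_one, h.lintegral_eq y]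
      exact le_add_self
    calc (∑ t ∈ Finset.range T, atomReturn P s ν t) * η
        = ∑ t ∈ Finset.range T, atomReturn P s ν t * η := Finset.sum_mul _ _ _
      _ ≤ ∑ t ∈ Finset.range T, ∫⁻ x, ∫⁻ y, w y ∂((P ^ (t + 1 + j)) x) ∂ν :=
          Finset.sum_le_sum fun t _ => hterm t
      _ = ∑ k ∈ (Finset.range T).image (fun t => t + 1 + j),
            ∫⁻ x, ∫⁻ y, w y ∂((P ^ k) x) ∂ν :=
          (Finset.sum_image (g := fun t => t + 1 + j)
            (f := fun k => ∫⁻ x, ∫⁻ y, w y ∂((P ^ k) x) ∂ν)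
            fun a _ b _ (hab : a + 1 + j = b + 1 + j) => by omega).symm
      _ ≤ ∑ k ∈ Finset.range (T + 1 + j), ∫⁻ x, ∫⁻ y, w y ∂((P ^ k) x) ∂ν := by
          refine Finset.sum_le_sum_of_subset fun k hk => ?_
          simp only [Finset.mem_image, Finset.mem_range] at hk ⊢
          obtain ⟨t, ht, rfl⟩ := hk
          omega
      _ ≤ ∫⁻ x, q x ∂ν := by rw [htelν (T + 1 + j)]; exact le_add_self
      _ ≤ ∫⁻ _, 1 ∂ν := lintegral_mono hq1
      _ = 1 := by simp
  obtain ⟨T, hT⟩ := hdiv η⁻¹ (ENNReal.inv_ne_top.2 hj)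
  have hηtop : η ≠ ∞ := by
    refine ne_top_of_le_ne_top (b := 1) ENNReal.one_ne_top ?_
    calc η ≤ ∑ k ∈ Finset.range (j + 1), ∫⁻ x, ∫⁻ y, w y ∂((P ^ k) x) ∂ν :=
          Finset.single_le_sum (f := fun k => ∫⁻ x, ∫⁻ y, w y ∂((P ^ k) x) ∂ν)
            (fun _ _ => zero_le) (Finset.self_mem_range_succ j)
      _ ≤ ∫⁻ x, q x ∂ν := by rw [htelν (j + 1)]; exact le_add_self
      _ ≤ ∫⁻ _, 1 ∂ν := lintegral_mono hq1
      _ = 1 := by simp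
  have h1 := (ENNReal.mul_lt_mul_iff_left hj hηtop).2 hT
  rw [ENNReal.inv_mul_cancel hj hηtop] at h1
  exact absurd (hbound T) (not_le.2 h1)

/-! ### The product of a Harris recurrent and an ergodic chain -/

/-- Closeness of two measures on all measurable sets bounds the difference of the integrals of
functions with values in `[0, 1]`. -/
lemma lintegral_le_add_of_measure_le {E : Type*} [MeasurableSpace E] {μ ν : Measure E}
    {ε : ℝ≥0∞} (h : ∀ A, MeasurableSet A → μ A ≤ ν A + ε) {f : E → ℝ≥0∞} (hf : Measurable f)
    (hf1 : ∀ x, f x ≤ 1) : ∫⁻ x, f x ∂μ ≤ ∫⁻ x, f x ∂ν + ε := by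
  have hfr : Measurable fun x => (f x).toReal := hf.ennreal_toReal
  have hfr1 : ∀ x, (f x).toReal ≤ 1 := fun x => (toReal_mem_Icc (hf1 x)).2
  -- In the layer cake formula only levels in (0, 1] contribute, so the error ε per level set
  -- integrates to ε.
  have hcake : ∀ M : Measure E, ∫⁻ x, f x ∂M
      = ∫⁻ t in Set.Ioc (0 : ℝ) 1, M {x | t < (f x).toReal} := by
    intro M
    have h1 := lintegral_eq_lintegral_meas_lt M (f := fun x => (f x).toReal)
      (ae_of_all _ fun x => ENNReal.toReal_nonneg) hfr.aemeasurable
    have h2 : ∀ x, ENNReal.ofReal (f x).toReal = f x := fun x =>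
      ENNReal.ofReal_toReal ((hf1 x).trans_lt ENNReal.one_lt_top).ne
    simp only [h2] at h1
    rw [h1, ← Set.Ioc_union_Ioi_eq_Ioi (zero_le_one (α := ℝ)),
      lintegral_union measurableSet_Ioi Set.Ioc_disjoint_Ioi_same]
    have h3 : ∫⁻ t in Set.Ioi (1 : ℝ), M {x | t < (f x).toReal} = 0 := by
      rw [setLIntegral_congr_fun (g := fun _ => 0) measurableSet_Ioi fun t ht => ?_]
      · simp
      · have : {x | t < (f x).toReal} = ∅ := Set.eq_empty_of_forall_notMem fun x hx =>
          absurd ((hfr1 x).trans (le_of_lt ht)) (not_le.2 hx)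
        simp [this]
    rw [h3, add_zero]
  rw [hcake μ, hcake ν]
  calc ∫⁻ t in Set.Ioc (0 : ℝ) 1, μ {x | t < (f x).toReal}
      ≤ ∫⁻ t in Set.Ioc (0 : ℝ) 1, (ν {x | t < (f x).toReal} + ε) :=
        lintegral_mono fun t => h _ (measurableSet_lt measurable_const hfr)
    _ = _ := by
        rw [lintegral_add_right _ measurable_const]
        simp

/-- The convergence in an ergodic chain, for integrals of functions with values in `[0, 1]`. -/
lemma exists_uniform_lintegral_le {E : Type*} [MeasurableSpace E] {P : Kernel E E}
    [IsMarkovKernel P] {π : Measure E} [IsProbabilityMeasure π]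
    (hconv : ∀ x : E, ∀ ε : ℝ, 0 < ε → ∀ᶠ n : ℕ in atTop,
      ∀ A : Set E, MeasurableSet A → |((P ^ n) x).real A - π.real A| ≤ ε)
    (x : E) {ε : ℝ} (hε : 0 < ε) :
    ∀ᶠ n : ℕ in atTop, ∀ f : E → ℝ≥0∞, Measurable f → (∀ x, f x ≤ 1) →
      ∫⁻ y, f y ∂((P ^ n) x) ≤ ∫⁻ y, f y ∂π + ENNReal.ofReal ε ∧
      ∫⁻ y, f y ∂π ≤ ∫⁻ y, f y ∂((P ^ n) x) + ENNReal.ofReal ε := by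
  filter_upwards [hconv x ε hε] with n hn f hf hf1
  have key : ∀ μ ν : Measure E, IsProbabilityMeasure μ → IsProbabilityMeasure ν → ∀ A : Set E,
      μ.real A ≤ ν.real A + ε → μ A ≤ ν A + ENNReal.ofReal ε := by
    intro μ ν _ _ A hA
    rw [← ofReal_measureReal (μ := μ), ← ofReal_measureReal (μ := ν),
      ← ENNReal.ofReal_add measureReal_nonneg hε.le]
    exact ENNReal.ofReal_le_ofReal hA
  constructor
  · refine lintegral_le_add_of_measure_le (fun A hA => key _ _ inferInstance inferInstance A ?_)
      hf hf1
    linarith [(abs_le.1 (hn A hA)).2]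
  · refine lintegral_le_add_of_measure_le (fun A hA => key _ _ inferInstance inferInstance A ?_)
      hf hf1
    linarith [(abs_le.1 (hn A hA)).1]

section Product

variable {E₁ E₂ : Type*} [MeasurableSpace E₁] [MeasurableSpace E₂]
  {P₁ : Kernel E₁ E₁} [IsMarkovKernel P₁] {P₂ : Kernel E₂ E₂} [IsMarkovKernel P₂]

lemma parallelComp_pow (P₁ : Kernel E₁ E₁) [IsMarkovKernel P₁] (P₂ : Kernel E₂ E₂)
    [IsMarkovKernel P₂] (n : ℕ) : (P₁ ∥ₖ P₂) ^ n = (P₁ ^ n) ∥ₖ (P₂ ^ n) := by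
  induction n with
  | zero => simp only [pow_zero]; exact Kernel.id_parallelComp_id.symm
  | succ n ih =>
    rw [pow_succ, pow_succ, pow_succ, ih]
    exact Kernel.parallelComp_comp_parallelComp

lemma lintegral_parallelComp_pow (n : ℕ) (z : E₁ × E₂) {f : E₁ × E₂ → ℝ≥0∞} (hf : Measurable f) :
    ∫⁻ y, f y ∂(((P₁ ∥ₖ P₂) ^ n) z)
      = ∫⁻ x, ∫⁻ y, f (x, y) ∂((P₂ ^ n) z.2) ∂((P₁ ^ n) z.1) := by
  rw [parallelComp_pow, Kernel.parallelComp_apply, lintegral_prod _ hf.aemeasurable]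

/-- For the product of a Harris recurrent and an ergodic chain, the probability of a shift
invariant event does not depend on the starting point. -/
theorem exists_const_chainLaw_parallelComp {ϕ₁ : Measure E₁} (hP₁ : IsHarrisRecurrent ϕ₁ P₁)
    (hP₂ : IsErgodic P₂) {S : Set (ℕ → E₁ × E₂)} (hS : MeasurableSet S)
    (hinv : ∀ n, pathShift n ⁻¹' S = S) :
    ∃ c : ℝ≥0∞, ∀ z, chainLaw (P₁ ∥ₖ P₂) (Measure.dirac z) S = c := by
  obtain ⟨π, hπ, -, hconv⟩ := hP₂
  set h : E₁ × E₂ → ℝ≥0∞ := fun z => chainLaw (P₁ ∥ₖ P₂) (Measure.dirac z) S with hh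
  have hm : Measurable h := measurable_chainLaw _ hS
  have h1 : ∀ z, h z ≤ 1 := fun z => prob_le_one
  have hharm : ∀ z, ∫⁻ y, h y ∂((P₁ ∥ₖ P₂) z) = h z := fun z =>
    lintegral_chainLaw_of_invariant _ hS hinv z
  have hn : ∀ n z, h z = ∫⁻ x, ∫⁻ y, h (x, y) ∂((P₂ ^ n) z.2) ∂((P₁ ^ n) z.1) := fun n z => by
    rw [← lintegral_parallelComp_pow n z hm, lintegral_pow_of_harmonic _ hm hharm]
  -- Run n steps with n so large that the second chain from w and from w' is within ε/2 of π. The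
  -- total variation bound is uniform over the sections h (x', ·), so it survives integration over
  -- the first coordinate.
  have hle : ∀ x w w', h (x, w) ≤ h (x, w') := by
    intro x w w'
    refine ENNReal.le_of_forall_pos_le_add fun ε hε _ => ?_
    have hε2 : (0 : ℝ) < (ε : ℝ) / 2 := by positivity
    obtain ⟨n, hn1, hn2⟩ := ((exists_uniform_lintegral_le hconv w hε2).and
      (exists_uniform_lintegral_le hconv w' hε2)).exists
    have hsec : ∀ x', Measurable fun y => h (x', y) := fun x' => hm.comp measurable_prodMk_left
    have e : (ε : ℝ≥0∞) = ENNReal.ofReal ((ε : ℝ) / 2) + ENNReal.ofReal ((ε : ℝ) / 2) := by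
      rw [← ENNReal.ofReal_add hε2.le hε2.le, add_halves, ENNReal.ofReal_coe_nnreal]
    calc h (x, w) = ∫⁻ x', ∫⁻ y, h (x', y) ∂((P₂ ^ n) w) ∂((P₁ ^ n) x) := hn n (x, w)
      _ ≤ ∫⁻ x', (∫⁻ y, h (x', y) ∂((P₂ ^ n) w') + ε) ∂((P₁ ^ n) x) := by
          refine lintegral_mono fun x' => ?_
          rw [e, ← add_assoc]
          exact ((hn1 _ (hsec x') fun y => h1 _).1).trans
            (add_le_add_left ((hn2 _ (hsec x') fun y => h1 _).2) _)
      _ = h (x, w') + ε := by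
          rw [lintegral_add_right _ measurable_const, ← hn n (x, w')]
          simp
  obtain ⟨w₀⟩ := nonempty_of_isProbabilityMeasure π
  -- Since h depends on the first coordinate only, its harmonicity for the product is harmonicity
  -- for P₁.
  obtain ⟨c, hc⟩ := hP₁.exists_const_of_harmonic (g := fun x => h (x, w₀))
    (hm.comp measurable_prodMk_right) (fun x => h1 _) fun x => by
      have e := hn 1 (x, w₀)
      simp only [pow_one] at e
      rw [e]
      refine lintegral_congr fun x' => ?_
      have : ∀ y, h (x', y) = h (x', w₀) := fun y => le_antisymm (hle _ _ _) (hle _ _ _)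
      simp [this]
  exact ⟨c, fun z => (le_antisymm (hle z.1 z.2 w₀) (hle z.1 w₀ z.2)).trans (hc z.1)⟩

variable {s₁ : E₁ → ℝ≥0∞} {ν₁ : Measure E₁} {s₂ : E₂ → ℝ≥0∞} {ν₂ : Measure E₂}

lemma Minorizes.prod (h₁ : Minorizes P₁ s₁ ν₁) (h₂ : Minorizes P₂ s₂ ν₂) :
    Minorizes (P₁ ∥ₖ P₂) (prodFun s₁ s₂) (ν₁.prod ν₂) where
  measurable := (h₁.measurable.comp measurable_fst).mul (h₂.measurable.comp measurable_snd)
  prob := by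
    have := h₁.prob
    have := h₂.prob
    infer_instance
  le := by
    have := h₁.prob
    have := h₂.prob
    rintro ⟨x, y⟩ A hA
    rw [Kernel.parallelComp_apply' hA, Measure.prod_apply hA, prodFun, mul_assoc,
      ← lintegral_const_mul _ (measurable_measure_prodMk_left hA),
      ← smul_eq_mul, ← lintegral_smul_measure]
    exact lintegral_mono' (h₁.smul_le x) fun x' => h₂.le y _ (measurable_prodMk_left hA)

/-- Independence of the coordinates: kernel, function and initial law all factor. This links the
product atom to the first atom. -/
lemma atomReturn_prod (h₁ : Minorizes P₁ s₁ ν₁) (h₂ : Minorizes P₂ s₂ ν₂) (n : ℕ) :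
    atomReturn (P₁ ∥ₖ P₂) (prodFun s₁ s₂) (ν₁.prod ν₂) n
      = atomReturn P₁ s₁ ν₁ n * atomReturn P₂ s₂ ν₂ n := by
  have := h₁.prob
  have := h₂.prob
  have hm := (h₁.prod h₂).measurable
  have hz : ∀ z, ∫⁻ y, prodFun s₁ s₂ y ∂(((P₁ ∥ₖ P₂) ^ n) z)
      = (∫⁻ x, s₁ x ∂((P₁ ^ n) z.1)) * ∫⁻ y, s₂ y ∂((P₂ ^ n) z.2) := by
    intro z
    rw [lintegral_parallelComp_pow n z hm]
    simp only [prodFun]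
    simp only [lintegral_const_mul _ h₂.measurable, lintegral_mul_const _ h₁.measurable]
  simp only [atomReturn, hz]
  exact lintegral_prod_mul h₁.measurable.lintegral_kernel.aemeasurable
    h₂.measurable.lintegral_kernel.aemeasurable

/-- The renewal sequence of an atom of an ergodic chain converges to a positive limit. -/
lemma exists_tendsto_atomReturn {ϕ₂ : Measure E₂} (hirr : P₂.IsIrreducible ϕ₂)
    (hatom : IsAtom ϕ₂ P₂ s₂ ν₂) (herg : IsErgodic P₂) :
    ∃ c : ℝ, 0 < c ∧ Tendsto (fun n => (atomReturn P₂ s₂ ν₂ n).toReal) atTop (𝓝 c) := by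
  have := hatom.prob
  obtain ⟨π, hπ, hinv, hconv⟩ := herg
  have hsm := hatom.measurable
  have hs1 : ∀ x, s₂ x ≤ 1 := hatom.toMinorizes.le_one
  have hπ1 : ∫⁻ y, s₂ y ∂π ≤ 1 :=
    (lintegral_mono hs1).trans (by simp)
  have hπtop : ∫⁻ y, s₂ y ∂π ≠ ∞ := (hπ1.trans_lt ENNReal.one_lt_top).ne
  have hsupp : MeasurableSet (Function.support s₂) := measurableSet_support hsm
  have hinvn : ∀ n, ∫⁻ x, (P₂ ^ n) x (Function.support s₂) ∂π = π (Function.support s₂) := by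
    intro n
    have hn : π.bind (P₂ ^ n) = π := by
      induction n with
      | zero => rw [pow_zero]; exact Measure.bind_dirac
      | succ n ih =>
        rw [pow_succ]
        change π.bind ((P₂ ^ n) ∘ₖ P₂) = π
        rw [← Measure.comp_assoc]
        rw [hinv.def, ih]
    rw [← Measure.bind_apply hsupp (Kernel.aemeasurable _), hn]
  -- Otherwise invariance shows that π-almost every point never reaches the support of s₂, against
  -- irreducibility.
  have hpos : ∫⁻ y, s₂ y ∂π ≠ 0 := by
    intro h0
    rw [lintegral_eq_zero_iff hsm] at h0
    have h1 : π (Function.support s₂) = 0 := h0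
    have h2 : ∀ n, ∀ᵐ x ∂π, (P₂ ^ n) x (Function.support s₂) = 0 := by
      intro n
      have := hinvn n
      rw [h1, lintegral_eq_zero_iff (Kernel.measurable_coe _ hsupp)] at this
      exact this
    obtain ⟨x, hx⟩ := (ae_all_iff.2 h2).exists
    obtain ⟨n, hn⟩ := hirr.irreducible hsupp hatom.pos x
    exact hn.ne' (hx n)
  have hpt : ∀ x, Tendsto (fun n => ∫⁻ y, s₂ y ∂((P₂ ^ n) x)) atTop (𝓝 (∫⁻ y, s₂ y ∂π)) := by
    intro x
    rw [ENNReal.tendsto_nhds hπtop]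
    intro ε hε
    rcases eq_or_ne ε ∞ with rfl | hεtop
    · exact Eventually.of_forall fun n => by simp
    have hε' : 0 < ε.toReal := ENNReal.toReal_pos hε.ne' hεtop
    filter_upwards [exists_uniform_lintegral_le hconv x hε'] with n hn
    have := hn s₂ hsm hs1
    rw [ENNReal.ofReal_toReal hεtop] at this
    exact ⟨tsub_le_iff_right.2 this.2, this.1⟩
  have hlim : Tendsto (fun n => atomReturn P₂ s₂ ν₂ n) atTop (𝓝 (∫⁻ y, s₂ y ∂π)) := by
    have := tendsto_lintegral_of_dominated_convergence (μ := ν₂)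
      (F := fun n x => ∫⁻ y, s₂ y ∂((P₂ ^ n) x)) (f := fun _ => ∫⁻ y, s₂ y ∂π) (fun _ => 1)
      (fun n => hsm.lintegral_kernel)
      (fun n => ae_of_all _ fun x => (lintegral_mono hs1).trans (by simp)) (by simp)
      (ae_of_all _ hpt)
    simpa [atomReturn] using this
  exact ⟨_, ENNReal.toReal_pos hpos hπtop, (ENNReal.tendsto_toReal hπtop).comp hlim⟩

/-- The product of a Harris recurrent chain and an ergodic chain, both with an atom, is Harris
recurrent as soon as the product atom has infinite expected number of returns. -/
theorem isHarrisRecurrent_parallelComp {ϕ₁ : Measure E₁} (hP₁ : IsHarrisRecurrent ϕ₁ P₁)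
    (hP₂ : IsErgodic P₂) (h : Minorizes (P₁ ∥ₖ P₂) (prodFun s₁ s₂) (ν₁.prod ν₂))
    (hdiv : ∀ C : ℝ≥0∞, C ≠ ∞ → ∃ T, C < ∑ t ∈ Finset.range T,
      atomReturn (P₁ ∥ₖ P₂) (prodFun s₁ s₂) (ν₁.prod ν₂) t) :
    IsHarrisRecurrent (Measure.sum fun n => (ν₁.prod ν₂).bind ⇑((P₁ ∥ₖ P₂) ^ n)) (P₁ ∥ₖ P₂) := by
  have := h.prob
  -- This measure charges exactly the measurable sets that are reached from the atom with positive
  -- probability.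
  set ϕ := Measure.sum fun n => (ν₁.prod ν₂).bind ⇑((P₁ ∥ₖ P₂) ^ n) with hϕ
  have hne : Nonempty (E₁ × E₂) := nonempty_of_isProbabilityMeasure (ν₁.prod ν₂)
  have hrec : ∀ A : Set (E₁ × E₂), MeasurableSet A → 0 < ϕ A → ∀ x,
      chainLaw (P₁ ∥ₖ P₂) (Measure.dirac x) (ioSet A) = 1 := by
    intro A hA hpos
    obtain ⟨n, hn⟩ : ∃ n, ∫⁻ x, ((P₁ ∥ₖ P₂) ^ n) x A ∂(ν₁.prod ν₂) ≠ 0 := by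
      by_contra! h0
      rw [hϕ, Measure.sum_apply _ hA] at hpos
      simp [Measure.bind_apply hA (Kernel.aemeasurable _), h0] at hpos
    obtain ⟨c, hc⟩ := exists_const_chainLaw_parallelComp hP₁ hP₂ (measurableSet_ioSet hA)
      (pathShift_preimage_ioSet A)
    obtain ⟨x, hx⟩ := exists_chainLaw_ioSet_ne_zero h hdiv hA (pos_iff_ne_zero.2 hn)
    rcases chainLaw_zero_or_one_of_const _ (measurableSet_ioSet hA)
      (pathShift_preimage_ioSet A) hc with h0 | h1
    · exact absurd ((hc x).trans h0) hx
    · exact fun y => (hc y).trans h1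
  refine ⟨?_, ⟨fun A hA hpos x => ?_⟩, fun A hA hpos x => ?_⟩
  · intro h0
    have h1 : ϕ Set.univ = 0 := by simp [h0]
    rw [hϕ, Measure.sum_apply _ .univ, ENNReal.tsum_eq_zero] at h1
    have h2 := h1 0
    have h3 : ∀ x, ((P₁ ∥ₖ P₂) ^ 0) x Set.univ = 1 := fun x => measure_univ
    rw [Measure.bind_apply .univ (Kernel.aemeasurable _)] at h2
    simp only [h3, lintegral_const, measure_univ, mul_one] at h2
    exact one_ne_zero h2
  -- Irreducibility follows from recurrence: a set never reached from x with positive probability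
  -- cannot be visited infinitely often.
  · by_contra! h0
    have h1 : ∀ n, chainLaw (P₁ ∥ₖ P₂) (Measure.dirac x) ((fun ω => ω n) ⁻¹' A) = 0 := by
      intro n
      rw [← Measure.map_apply (measurable_pi_apply n) hA, chainLaw_map_eval]
      exact le_antisymm (h0 n) zero_le
    have h2 := hrec A hA hpos x
    have h3 : chainLaw (P₁ ∥ₖ P₂) (Measure.dirac x) (ioSet A) = 0 := by
      refine measure_mono_null (fun ω hω => ?_) (measure_iUnion_null h1)
      obtain ⟨t, ht⟩ := Frequently.exists (show ∃ᶠ t in atTop, ω t ∈ A from hω)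
      exact Set.mem_iUnion.2 ⟨t, ht⟩
    rw [h3] at h2
    exact zero_ne_one h2
  · exact (prob_compl_eq_zero_iff (measurableSet_ioSet hA)).2 (hrec A hA hpos x)

end Product

/-! ### Independent Markov chains run in parallel -/

section PairChain

variable {Ω E E' : Type*}

lemma sup_eq_generateFrom_inter (m m' : MeasurableSpace Ω) :
    m ⊔ m' = MeasurableSpace.generateFrom
      {s | ∃ F G, MeasurableSet[m] F ∧ MeasurableSet[m'] G ∧ F ∩ G = s} := by
  refine le_antisymm (sup_le (fun F hF => ?_) fun G hG => ?_) (MeasurableSpace.generateFrom_le ?_)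
  · exact MeasurableSpace.measurableSet_generateFrom ⟨F, Set.univ, hF, .univ, Set.inter_univ F⟩
  · exact MeasurableSpace.measurableSet_generateFrom ⟨Set.univ, G, .univ, hG, Set.univ_inter G⟩
  · rintro _ ⟨F, G, hF, hG, rfl⟩
    exact @MeasurableSet.inter _ (m ⊔ m') _ _ (le_sup_left (a := m) _ hF)
      (le_sup_right (a := m) _ hG)

lemma isPiSystem_inter (m m' : MeasurableSpace Ω) :
    IsPiSystem {s | ∃ F G, MeasurableSet[m] F ∧ MeasurableSet[m'] G ∧ F ∩ G = s} := by
  rintro _ ⟨F, G, hF, hG, rfl⟩ _ ⟨F', G', hF', hG', rfl⟩ _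
  exact ⟨F ∩ F', G ∩ G', hF.inter hF', hG.inter hG', Set.inter_inter_inter_comm _ _ _ _⟩

variable [mE : MeasurableSpace E]

/-- The history of a process up to time `n`. -/
abbrev history (X : ℕ → Ω → E) (n : ℕ) : MeasurableSpace Ω := ⨆ j ≤ n, mE.comap (X j)

lemma history_le_comap_path (X : ℕ → Ω → E) (n : ℕ) :
    history X n ≤ MeasurableSpace.comap (fun ω t => X t ω) MeasurableSpace.pi := by
  refine iSup₂_le fun j _ => ?_
  rintro _ ⟨A, hA, rfl⟩
  exact ⟨(fun f : ℕ → E => f j) ⁻¹' A, measurable_pi_apply j hA, rfl⟩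

lemma history_prod [mE' : MeasurableSpace E'] (X : ℕ → Ω → E) (W : ℕ → Ω → E') (n : ℕ) :
    history (fun t ω => (X t ω, W t ω)) n = history X n ⊔ history W n := by
  simp only [history, ← iSup_sup_eq]
  exact iSup_congr fun j => iSup_congr fun _ => MeasurableSpace.comap_prodMk (X j) (W j)

variable [mΩ : MeasurableSpace Ω] [mE' : MeasurableSpace E'] {μ : Measure Ω}
  [IsProbabilityMeasure μ]

lemma history_le {X : ℕ → Ω → E} (hX : ∀ t, Measurable (X t)) (n : ℕ) : history X n ≤ mΩ :=
  iSup₂_le fun j _ => (hX j).comap_le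

/-- Without conditional expectations the Markov property is an equality of finite measures on the
history, which can be checked on a π-system. -/
lemma isMarkovChain_iff_measure_inter {X : ℕ → Ω → E} (hX : ∀ t, Measurable (X t))
    {P : Kernel E E} [IsMarkovKernel P] :
    IsMarkovChain X P μ ↔ ∀ n A, MeasurableSet A → ∀ F, MeasurableSet[history X n] F →
      μ (X (n + 1) ⁻¹' A ∩ F) = ∫⁻ ω in F, P (X n ω) A ∂μ := by
  have hint : ∀ n A, MeasurableSet A → Integrable (fun ω => (P (X n ω)).real A) μ := by
    intro n A hA
    refine Integrable.of_bound (C := 1) ?_ (ae_of_all _ fun ω => ?_)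
    · exact (((P.measurable_coe hA).comp (hX n)).ennreal_toReal).aestronglyMeasurable
    · rw [Real.norm_of_nonneg measureReal_nonneg]
      exact measureReal_le_one
  have hreal : ∀ n A, MeasurableSet A → ∀ F : Set Ω,
      ∫ ω in F, (P (X n ω)).real A ∂μ = (∫⁻ ω in F, P (X n ω) A ∂μ).toReal := by
    intro n A hA F
    exact integral_toReal ((P.measurable_coe hA).comp (hX n)).aemeasurable
      (ae_of_all _ fun ω => measure_lt_top _ _)
  have hfin : ∀ n A, ∀ F : Set Ω, ∫⁻ ω in F, P (X n ω) A ∂μ ≠ ∞ := by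
    intro n A F
    refine ((lintegral_mono (g := fun _ => 1) fun ω => prob_le_one).trans_lt ?_).ne
    simp
  have hind : ∀ n A, MeasurableSet A → ∀ F : Set Ω, MeasurableSet F →
      ∫ ω in F, (X (n + 1) ⁻¹' A).indicator (fun _ => (1 : ℝ)) ω ∂μ
        = μ.real (X (n + 1) ⁻¹' A ∩ F) := by
    intro n A hA F hF
    rw [integral_indicator (hX _ hA), Measure.restrict_restrict (hX _ hA)]
    simp
  have hindint : ∀ n A, MeasurableSet A →
      Integrable ((X (n + 1) ⁻¹' A).indicator (fun _ => (1 : ℝ))) μ := fun n A hA =>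
    (integrable_const _).indicator (hX _ hA)
  constructor
  · intro h n A hA F hF
    have h1 := setIntegral_condExp (μ := μ) (history_le hX n) (hindint n A hA) hF
    rw [hind n A hA F (history_le hX n _ hF),
      setIntegral_congr_ae (history_le hX n _ hF) ((h.markov n A hA).mono fun ω hω _ => hω),
      hreal n A hA] at h1
    exact ((ENNReal.toReal_eq_toReal_iff' (hfin n A F) (measure_ne_top _ _)).1 h1).symm
  · intro h
    refine ⟨hX, fun n A hA => (ae_eq_condExp_of_forall_setIntegral_eq (history_le hX n)
      (hindint n A hA) (fun F _ _ => (hint n A hA).integrableOn) (fun F hF _ => ?_) ?_).symm⟩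
    · rw [hind n A hA F (history_le hX n _ hF), hreal n A hA, ← h n A hA F hF]
      rfl
    · have hXn : Measurable[history X n] (X n) :=
        measurable_iff_comap_le.2 (le_iSup₂_of_le n le_rfl le_rfl)
      exact (((P.measurable_coe hA).comp hXn).ennreal_toReal).stronglyMeasurable.aestronglyMeasurable

/-- Two independent Markov chains run in parallel form a Markov chain. -/
theorem IsMarkovChain.prodMk {X : ℕ → Ω → E} {W : ℕ → Ω → E'} {P : Kernel E E}
    [IsMarkovKernel P] {Q : Kernel E' E'} [IsMarkovKernel Q]
    (hX : IsMarkovChain X P μ) (hW : IsMarkovChain W Q μ)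
    (hindep : IndepFun (fun ω t => X t ω) (fun ω t => W t ω) μ) :
    IsMarkovChain (fun t ω => (X t ω, W t ω)) (P ∥ₖ Q) μ := by
  have hXm := hX.measurable
  have hWm := hW.measurable
  have hZm : ∀ t, Measurable fun ω => (X t ω, W t ω) := fun t => (hXm t).prodMk (hWm t)
  rw [isMarkovChain_iff_measure_inter hXm] at hX
  rw [isMarkovChain_iff_measure_inter hWm] at hW
  rw [isMarkovChain_iff_measure_inter hZm]
  have hpX : Measurable fun ω t => X t ω := measurable_pi_lambda _ hXm
  have hpW : Measurable fun ω t => W t ω := measurable_pi_lambda _ hWm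
  -- For events F, G of the two separate histories and a rectangle A × B as target, independence
  -- factors both sides, and each factor is the Markov property of one chain.
  have key : ∀ n F G, MeasurableSet[history X n] F → MeasurableSet[history W n] G →
      (μ.restrict (F ∩ G)).map (fun ω => (X (n + 1) ω, W (n + 1) ω))
        = (μ.restrict (F ∩ G)).bind fun ω => (P ∥ₖ Q) (X n ω, W n ω) := by
    intro n F G hF hG
    have hFm := history_le hXm n _ hF
    have hGm := history_le hWm n _ hG
    have hK : Measurable fun ω => (P ∥ₖ Q) (X n ω, W n ω) := (P ∥ₖ Q).measurable.comp (hZm n)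
    have hfin : IsFiniteMeasure ((μ.restrict (F ∩ G)).map
      (fun ω => (X (n + 1) ω, W (n + 1) ω))) := by infer_instance
    refine Measure.ext_prod fun {A B} hA hB => ?_
    rw [Measure.map_apply (hZm _) (hA.prod hB), Measure.bind_apply (hA.prod hB) hK.aemeasurable,
      Measure.restrict_apply (hZm _ (hA.prod hB))]
    have hF' := history_le_comap_path X n _ hF
    have hG' := history_le_comap_path W n _ hG
    have hX1 : ∀ t, Measurable[MeasurableSpace.comap (fun ω t => X t ω) MeasurableSpace.pi] (X t) :=
      fun t => (measurable_pi_apply t).comp (comap_measurable fun ω t => X t ω)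
    have hW1 : ∀ t, Measurable[MeasurableSpace.comap (fun ω t => W t ω) MeasurableSpace.pi] (W t) :=
      fun t => (measurable_pi_apply t).comp (comap_measurable fun ω t => W t ω)
    have e1 : (fun ω => (X (n + 1) ω, W (n + 1) ω)) ⁻¹' A ×ˢ B ∩ (F ∩ G)
        = (X (n + 1) ⁻¹' A ∩ F) ∩ (W (n + 1) ⁻¹' B ∩ G) := by
      ext ω
      simp only [Set.mem_inter_iff, Set.mem_preimage, Set.mem_prod]
      tauto
    have e2 : ∫⁻ ω in F ∩ G, (P ∥ₖ Q) (X n ω, W n ω) (A ×ˢ B) ∂μ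
        = ∫⁻ ω, F.indicator (fun ω => P (X n ω) A) ω * G.indicator (fun ω => Q (W n ω) B) ω ∂μ := by
      rw [← lintegral_indicator (hFm.inter hGm)]
      refine lintegral_congr fun ω => ?_
      rw [← Set.inter_indicator_mul]
      simp only [Kernel.parallelComp_apply, Measure.prod_prod]
    have e3 := lintegral_mul_eq_lintegral_mul_lintegral_of_independent_measurableSpace hpX.comap_le
      hpW.comap_le hindep (((P.measurable_coe hA).comp (hX1 n)).indicator hF')
      (((Q.measurable_coe hB).comp (hW1 n)).indicator hG')
    simp only [Function.comp_def] at e3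
    rw [e1, e2, (IndepFun_iff _ _ _).1 hindep _ _ ((hX1 (n + 1) hA).inter hF')
      ((hW1 (n + 1) hB).inter hG'), e3, lintegral_indicator hFm, lintegral_indicator hGm, hX n A hA F hF, hW n B hB G hG]
  intro n C hC H hH
  have hK : Measurable fun ω => (P ∥ₖ Q) (X n ω, W n ω) := (P ∥ₖ Q).measurable.comp (hZm n)
  -- The intersections F ∩ G form a π-system generating the joint history.
  have hpi : ∀ s ∈ {s | ∃ F G, MeasurableSet[history X n] F ∧ MeasurableSet[history W n] G ∧
      F ∩ G = s}, (μ.restrict ((fun ω => (X (n + 1) ω, W (n + 1) ω)) ⁻¹' C)) s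
        = (μ.withDensity fun ω => (P ∥ₖ Q) (X n ω, W n ω) C) s := by
    rintro _ ⟨F, G, hF, hG, rfl⟩
    have hFG := (history_le hXm n _ hF).inter (history_le hWm n _ hG)
    have h1 := congrArg (fun ρ : Measure (E × E') => ρ C) (key n F G hF hG)
    rw [Measure.map_apply (hZm _) hC, Measure.bind_apply hC hK.aemeasurable,
      Measure.restrict_apply (hZm _ hC)] at h1
    rw [Measure.restrict_apply hFG, withDensity_apply _ hFG, ← h1, Set.inter_comm]
  have h2 := ext_on_measurableSpace_of_generate_finite mΩ _ hpi
    (history_le hZm n) ((history_prod X W n).trans (sup_eq_generateFrom_inter _ _))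
    (isPiSystem_inter _ _) (hpi _ ⟨Set.univ, Set.univ, .univ, .univ, Set.univ_inter _⟩) hH
  have hHm := history_le hZm n _ hH
  rw [Measure.restrict_apply hHm, withDensity_apply _ hHm] at h2
  rw [Set.inter_comm]
  exact h2

end PairChain

/-! ### Expected visits to the atom and the proof of the theorem -/

lemma SlowlyVarying.const_mul {L : ℝ → ℝ} (hL : SlowlyVarying L) {c : ℝ} (hc : 0 < c) :
    SlowlyVarying fun x => c * L x := by
  refine ⟨hL.measurable.const_mul c, hL.pos.mono fun x hx => mul_pos hc hx, fun d hd => ?_⟩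
  refine (hL.tendsto d hd).congr fun x => ?_
  rw [mul_div_mul_left _ _ hc.ne']

lemma lintegral_chainLaw_sum_eq {E : Type*} [MeasurableSpace E] (P : Kernel E E)
    [IsMarkovKernel P] {s : E → ℝ≥0∞} (hs : Measurable s) (ν : Measure E) (n : ℕ) :
    ∫⁻ ω, ∑ t ∈ Finset.range n, s (ω t) ∂(chainLaw P ν)
      = ∑ t ∈ Finset.range n, atomReturn P s ν t := by
  have hm : ∀ t : ℕ, Measurable fun ω : ℕ → E => s (ω t) := fun t =>
    hs.comp (measurable_pi_apply t)
  rw [lintegral_finsetSum _ fun t _ => hm t]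
  refine Finset.sum_congr rfl fun t _ => ?_
  rw [lintegral_chainLaw P ν (hm t)]
  exact lintegral_congr fun x => lintegral_chainLaw_eval P x t hs

lemma toReal_sum_atomReturn {E : Type*} [MeasurableSpace E] {P : Kernel E E}
    [IsMarkovKernel P] {s : E → ℝ≥0∞} {ν : Measure E} (h : Minorizes P s ν) (n : ℕ) :
    (∑ t ∈ Finset.range n, atomReturn P s ν t).toReal
      = ∑ t ∈ Finset.range n, renewalSeq P s ν (t + 1) :=
  ENNReal.toReal_sum fun t _ => ((atomReturn_le_one h t).trans_lt ENNReal.one_lt_top).ne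

end
end NullRecurrent

theorem lemma3p1
    {Ω E₁ E₂ : Type*} [MeasurableSpace Ω] [MeasurableSpace E₁] [MeasurableSpace E₂]
    (μ : Measure Ω) [IsProbabilityMeasure μ]
    (X : ℕ → Ω → E₁) (W : ℕ → Ω → E₂)
    (P₁ : Kernel E₁ E₁) [IsMarkovKernel P₁] (P₂ : Kernel E₂ E₂) [IsMarkovKernel P₂]
    (hX : NullRecurrent.IsMarkovChain X P₁ μ) (hW : NullRecurrent.IsMarkovChain W P₂ μ)
    (hindep : IndepFun (fun ω t => X t ω) (fun ω t => W t ω) μ)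
    (ϕ₁ : Measure E₁) (s₁ : E₁ → ℝ≥0∞) (ν₁ : Measure E₁)
    (hharris₁ : NullRecurrent.IsHarrisRecurrent ϕ₁ P₁)
    (hatom₁ : NullRecurrent.IsAtom ϕ₁ P₁ s₁ ν₁)
    (ϕ₂ : Measure E₂) (s₂ : E₂ → ℝ≥0∞) (ν₂ : Measure E₂)
    (hϕ₂ : ϕ₂ ≠ 0) (hirr₂ : P₂.IsIrreducible ϕ₂)
    (hatom₂ : NullRecurrent.IsAtom ϕ₂ P₂ s₂ ν₂)
    (hergodic : NullRecurrent.IsErgodic P₂)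
    (β : ℝ) (htail : NullRecurrent.TailCondition P₁ s₁ ν₁ hatom₁.toMinorizes β) :
    NullRecurrent.IsMarkovChain (fun t ω => (X t ω, W t ω)) (P₁ ∥ₖ P₂) μ ∧
    ∃ ϕ : Measure (E₁ × E₂),
      NullRecurrent.IsBetaNullRecurrent ϕ (P₁ ∥ₖ P₂) β ∧
      ∃ hatom : NullRecurrent.IsAtom ϕ (P₁ ∥ₖ P₂)
          (NullRecurrent.prodFun s₁ s₂) (ν₁.prod ν₂),
        NullRecurrent.TailCondition (P₁ ∥ₖ P₂) (NullRecurrent.prodFun s₁ s₂) (ν₁.prod ν₂)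
          hatom.toMinorizes β := by
  open NullRecurrent in
  refine ⟨hX.prodMk hW hindep, ?_⟩
  have h₁ := hatom₁.toMinorizes
  have h₂ := hatom₂.toMinorizes
  have hm := h₁.prod h₂
  have hν₁ := h₁.prob
  have hν := hm.prob
  obtain ⟨x₁⟩ := nonempty_of_isProbabilityMeasure ν₁
  obtain ⟨hβ0, hβ1, L, hL, ht⟩ := htail
  obtain ⟨c, hc0, hc⟩ := exists_tendsto_atomReturn hirr₂ hatom₂ hergodic
  set s := prodFun s₁ s₂ with hs
  set ν := ν₁.prod ν₂ with hν_def
  -- The quotient of the two renewal sequences is the renewal sequence of the second atom; its value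
  -- at 0 is 1 because both start at 1.
  let cs : ℕ → ℝ := fun n => Nat.casesOn n 1 fun k => (atomReturn P₂ s₂ ν₂ k).toReal
  have hcs : Tendsto cs atTop (𝓝 c) := (tendsto_add_atTop_iff_nat 1).1 hc
  have htail₁ := ht x₁
  simp only [chainLaw_real_lt_recurrenceTime] at htail₁
  obtain ⟨htail', hsum, hdiv⟩ := renewal_comparison (a := tailSeq h₁) (u := renewalSeq P₁ s₁ ν₁)
    (a' := tailSeq hm) (u' := renewalSeq (P₁ ∥ₖ P₂) s ν) (cs := cs)
    (tailSeq_mem_Icc h₁) (renewalSeq_mem_Icc h₁) (tailSeq_mem_Icc hm) (renewalSeq_mem_Icc hm)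
    (antitone_tailSeq h₁) (antitone_tailSeq hm) (renewal_equation h₁) (renewal_equation hm)
    (fun n => by
      cases n with
      | zero => simp [cs, renewalSeq]
      | succ n =>
        change (atomReturn (P₁ ∥ₖ P₂) s ν n).toReal
          = (atomReturn P₂ s₂ ν₂ n).toReal * (atomReturn P₁ s₁ ν₁ n).toReal
        rw [hs, hν_def, atomReturn_prod h₁ h₂, ENNReal.toReal_mul, mul_comm])
    hcs hc0 hβ0 hβ1 hL htail₁
  have hdiv' : ∀ C : ℝ≥0∞, C ≠ ∞ → ∃ T, C < ∑ t ∈ Finset.range T,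
      atomReturn (P₁ ∥ₖ P₂) s ν t := by
    intro C hC
    obtain ⟨n, hn⟩ := (hdiv.eventually_gt_atTop C.toReal).exists
    rw [← toReal_sum_atomReturn hm] at hn
    refine ⟨n + 1, (ENNReal.toReal_lt_toReal hC ?_).1 hn⟩
    exact (ENNReal.sum_lt_top.2 fun t _ =>
      (atomReturn_le_one hm t).trans_lt ENNReal.one_lt_top).ne
  have hharris := isHarrisRecurrent_parallelComp hharris₁ hergodic hm hdiv'
  set ϕ := Measure.sum fun n => ν.bind ⇑((P₁ ∥ₖ P₂) ^ n) with hϕ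
  have hsupp : MeasurableSet (Function.support s) := measurableSet_support hm.measurable
  -- Divergence of the renewal function makes some return probability positive, so the support of s
  -- is reachable from ν.
  have hpos : 0 < ϕ (Function.support s) := by
    obtain ⟨T, hT⟩ := hdiv' 0 ENNReal.zero_ne_top
    obtain ⟨n, -, hn⟩ := Finset.exists_ne_zero_of_sum_ne_zero hT.ne'
    rw [pos_iff_ne_zero]
    intro h0
    rw [hϕ, Measure.sum_apply _ hsupp, ENNReal.tsum_eq_zero] at h0
    refine hn ?_
    rw [atomReturn, ← Measure.lintegral_bind (Kernel.aemeasurable _) hm.measurable.aemeasurable,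
      lintegral_eq_zero_iff hm.measurable]
    exact h0 n
  have hL' := hL.const_mul hc0
  -- The small function is s itself, with κ = ν and m = b = 1. Starting from λ = ν turns the
  -- expected visits into partial sums of the renewal sequence, and both asymptotics use the slowly
  -- varying function c L.
  refine ⟨ϕ, ⟨hharris, hβ0, hβ1, s, ν, _, ⟨hm.measurable, hpos, ν, 1, 1,
    IsProbabilityMeasure.ne_zero ν, one_pos, le_rfl, fun x A hA => ?_⟩, hν, hL', ?_⟩,
    ⟨hm, hpos⟩, hβ0, hβ1, _, hL', fun x => ?_⟩
  · rw [pow_one, ENNReal.coe_one, one_mul]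
    exact hm.le x A hA
  · simpa only [lintegral_chainLaw_sum_eq _ hm.measurable, toReal_sum_atomReturn hm] using hsum
  · simpa only [chainLaw_real_lt_recurrenceTime] using htail'
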